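/- **Setting.** Let $X$ be a compact complex threefold with a Kähler form $\omega_0$ and a holomorphic $(3,0)$-form $\Omega$, normalized by $\|\Omega\|_{\omega_0}\equiv 1$. Here $(\cdot,\cdot)_\omega$ is the hermitian inner product on forms defined by a positive $(1,1)$-form $\omega$ (so $(dz_i,dz_j)=2\delta_{ij}$ for $\omega=\frac{\sqrt{-1}}2\sum dz_i\wedge d\bar z_i$), $\|\Omega\|_\omega=(\Omega,\Omega)_\omega^{1/2}$, $*_\omega$ is the $\mathbb C$-linear star operator, $(\varphi,\psi)_\omega\,\omega^3/3!=\varphi\wedge *_\omega\bar\psi$, $d^*_{\omega}=-*_{\omega}d\,*_{\omega}$, and $d_c=\sqrt{-1}(\bar\partial-\partial)$. Let $(E,D'')$ be a holomorphic vector bundle of rank $r$ on $X$ with a smooth hermitian reference metric $\langle\,,\rangle$. Let $\mathcal H(E)_1$ be the set of smooth positive definite $\langle\,,\rangle$-hermitian endomorphisms $H$ of $E$ with $\det H=1$; endomorphisms act on the right, and $H$ stands for the metric $\langle u,v\rangle_H=\langle uH,v\rangle$, with hermitian (Chern) connection $D_H=D'_H+D''$ and curvature $F_H$. Let $\mathcal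 H(X)$ be the set of smooth positive real $(1,1)$-forms $\omega$, and $R_\omega$ the curvature of the hermitian (Chern) connection of $\omega$ on $TX$. Strominger's operator is $\mathbf L=(\mathbf L_1,\mathbf L_2,\mathbf L_3)$, $$\mathbf L_1(H,\omega)=H^{-1/2}F_HH^{1/2}\wedge\omega^2,\qquad \mathbf L_2(H,\omega)=\tfrac12dd_c\omega+\operatorname{tr}(F_H\wedge F_H)-\operatorname{tr}(R_\omega\wedge R_\omega),\qquad \mathbf L_3(H,\omega)=*_{\omega_0}d(\|\Omega\|_\omega\,\omega^2).$$ **Proposition.** Suppose $H\in\mathcal H(E)_1$ and $\mathbf L(H,\omega_0)=0$. Let $\delta h$ be a smooth traceless $\langle\,,\rangle$-hermitian endomorphism of $E$ and $\delta\omega$ a smooth real $(1,1)$-form. Then there is a smooth curve $(H_t,\omega_t)$, $|t|<\varepsilon$, in $\mathcal H(E)_1\times\mathcal H(X)$ through $(H,\omega_0)$ at $t=0$ with velocity there $$\delta H=H^{1/2}\,\delta h\,H^{1/2},\qquad \delta\omega ,$$ and for every such curve $F_{H_t}$, $R_{\omega_t}$ and $\mathbf L_i(H_t,\omega_t)$ are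 differentiable in $t$ at $t=0$ at each point of $X$. The derivatives of $F_{H_t}$ and $R_{\omega_t}$ are the directional derivatives $\delta F_H(\delta h)$ of $F$ at $H$ along $\delta H$ and $\delta R_{\omega_0}(\delta\omega)$ of $R$ at $\omega_0$ along $\delta\omega$, and the derivatives $\delta\mathbf L_i(H,\omega_0)(\delta h,\delta\omega)$ of $\mathbf L_i(H_t,\omega_t)$ are $$\delta\mathbf L_1=H^{-1/2}\bigl(D''D'_H(H^{1/2}\,\delta h\,H^{-1/2})\bigr)H^{1/2}\wedge\omega_0^2+2H^{-1/2}F_HH^{1/2}\wedge\omega_0\wedge\delta\omega,$$ $$\delta\mathbf L_2=\tfrac12dd_c\,\delta\omega+2\bigl(\operatorname{tr}(\delta F_H(\delta h)\wedge F_H)-\operatorname{tr}(\delta R_{\omega_0}(\delta\omega)\wedge R_{\omega_0})\bigr),$$ $$\delta\mathbf L_3=2d^*_{\omega_0}\delta\omega-d^*_{\omega_0}\bigl((\delta\omega,\omega_0)_{\omega_0}\,\omega_0\bigr).$$ If moreover $D''H=0$ (that is, $H$ is parallel), then $$\delta\mathbf L_1=D''D'_H\,\delta h\wedge\omega_0^2+2H^{-1/2}F_HH^{1/2}\wedge\omega_0\wedge\delta\omega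 .$$ -/

import Mathlib

open Bundle
open scoped Manifold ContDiff ComplexConjugate

noncomputable section

namespace Strominger

/-! ## Complex valued differential forms on `ℂ³` -/

/-- The model space `ℂ³`. -/
abbrev C3 : Type := Fin 3 → ℂ

/-- Complex valued (real multilinear) alternating `k`-forms on `ℂ³`. -/
abbrev CForm (k : ℕ) : Type := C3 [⋀^Fin k]→L[ℝ] ℂ

/-- Multiplication by `√-1` on `ℂ³`, as a real linear map. -/
def mulI : C3 →L[ℝ] C3 :=
  (Complex.I • ContinuousLinearMap.id ℂ C3).restrictScalars ℝ

/-- The tensor product `α ⊗ β` of two alternating forms, as a multilinear map. -/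
def tensor {p q : ℕ} (α : CForm p) (β : CForm q) :
    ContinuousMultilinearMap ℝ (fun _ : Fin (p + q) => C3) ℂ where
  toFun v := α (fun i => v (Fin.castAdd q i)) * β (fun j => v (Fin.natAdd p j))
  map_update_add' := by
    intro inst v i x y
    obtain rfl : inst = instDecidableEqFin (p + q) := Subsingleton.elim _ _
    have hA : ∀ j : Fin q, ∀ z : C3, (fun i => Function.update v (Fin.natAdd p j) z
        (Fin.castAdd q i)) = fun i => v (Fin.castAdd q i) := fun j z => by
      funext i
      exact Function.update_of_ne (by simp [Fin.ext_iff]; omega) _ _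
    have hB : ∀ j : Fin p, ∀ z : C3, (fun i => Function.update v (Fin.castAdd q j) z
        (Fin.natAdd p i)) = fun i => v (Fin.natAdd p i) := fun j z => by
      funext i
      exact Function.update_of_ne (by simp [Fin.ext_iff]; omega) _ _
    have hA' : ∀ j : Fin p, ∀ z : C3, (fun i => Function.update v (Fin.castAdd q j) z
        (Fin.castAdd q i)) = Function.update (fun i => v (Fin.castAdd q i)) j z := fun j z =>
      Function.update_comp_eq_of_injective v (Fin.castAdd_injective p q) j z
    have hB' : ∀ j : Fin q, ∀ z : C3, (fun i => Function.update v (Fin.natAdd p j) z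
        (Fin.natAdd p i)) = Function.update (fun i => v (Fin.natAdd p i)) j z := fun j z =>
      Function.update_comp_eq_of_injective v (Fin.natAdd_injective q p) j z
    induction i using Fin.addCases with
    | left j => simp only [hB, hA', α.map_update_add, add_mul]
    | right j => simp only [hA, hB', β.map_update_add, mul_add]
  map_update_smul' := by
    intro inst v i c x
    obtain rfl : inst = instDecidableEqFin (p + q) := Subsingleton.elim _ _
    have hA : ∀ j : Fin q, ∀ z : C3, (fun i => Function.update v (Fin.natAdd p j) z
        (Fin.castAdd q i)) = fun i => v (Fin.castAdd q i) := fun j z => by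
      funext i
      exact Function.update_of_ne (by simp [Fin.ext_iff]; omega) _ _
    have hB : ∀ j : Fin p, ∀ z : C3, (fun i => Function.update v (Fin.castAdd q j) z
        (Fin.natAdd p i)) = fun i => v (Fin.natAdd p i) := fun j z => by
      funext i
      exact Function.update_of_ne (by simp [Fin.ext_iff]; omega) _ _
    have hA' : ∀ j : Fin p, ∀ z : C3, (fun i => Function.update v (Fin.castAdd q j) z
        (Fin.castAdd q i)) = Function.update (fun i => v (Fin.castAdd q i)) j z := fun j z =>
      Function.update_comp_eq_of_injective v (Fin.castAdd_injective p q) j z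
    have hB' : ∀ j : Fin q, ∀ z : C3, (fun i => Function.update v (Fin.natAdd p j) z
        (Fin.natAdd p i)) = Function.update (fun i => v (Fin.natAdd p i)) j z := fun j z =>
      Function.update_comp_eq_of_injective v (Fin.natAdd_injective q p) j z
    induction i using Fin.addCases with
    | left j => simp only [hB, hA', α.map_update_smul, smul_mul_assoc]
    | right j => simp only [hA, hB', β.map_update_smul, mul_smul_comm]
  cont := by
    refine (α.cont.comp ?_).mul (β.cont.comp ?_) <;> fun_prop

/-- The wedge product `α ∧ β = (1 / (p! q!)) ∑_σ sign(σ) (α ⊗ β) ∘ σ`. -/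
def wedge {p q : ℕ} (α : CForm p) (β : CForm q) : CForm (p + q) :=
  ((p.factorial * q.factorial : ℕ) : ℂ)⁻¹ •
    ContinuousMultilinearMap.alternatization (tensor α β)

/-- `∂̄ α`: antisymmetrize the complex antilinear part of the derivative of `α`.
(The exterior derivative `extDeriv` antisymmetrizes the full real derivative.) -/
def delbar {k : ℕ} (α : C3 → CForm k) (z : C3) : CForm (k + 1) :=
  ContinuousAlternatingMap.alternatizeUncurryFin
    ((2 : ℝ)⁻¹ • (fderiv ℝ α z + Complex.I • (fderiv ℝ α z).comp mulI))

/-- `∂ α`: antisymmetrize the complex linear part of the derivative of `α`. -/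
def del {k : ℕ} (α : C3 → CForm k) (z : C3) : CForm (k + 1) :=
  ContinuousAlternatingMap.alternatizeUncurryFin
    ((2 : ℝ)⁻¹ • (fderiv ℝ α z - Complex.I • (fderiv ℝ α z).comp mulI))

/-- `d_c = √-1 (∂̄ - ∂)`, so that `(1/2) d d_c = √-1 ∂ ∂̄`. -/
def dc {k : ℕ} (α : C3 → CForm k) (z : C3) : CForm (k + 1) :=
  Complex.I • (delbar α z - del α z)

/-! ## Pointwise linear algebra of a positive (1,1)-form -/

/-- `w` is a real form of type (1,1). -/
def IsReal11 (w : CForm 2) : Prop :=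
  (∀ u v, w ![Complex.I • u, Complex.I • v] = w ![u, v]) ∧ ∀ v, (w v).im = 0

/-- `w` is positive: `g(u,u) = w(u, √-1 u) > 0` for `u ≠ 0`. -/
def IsPositive (w : CForm 2) : Prop :=
  ∀ u, u ≠ 0 → 0 < (w ![u, Complex.I • u]).re

/-- The real basis `e_j, √-1 e_j` (`j = 0, 1, 2`) of `ℂ³`. -/
def realBasis (a : Fin 3 × Fin 2) : C3 :=
  Pi.single a.1 (if a.2 = 0 then 1 else Complex.I)

/-- Gram matrix `g_{ab} = w(b_a, √-1 b_b)` of the Riemannian metric of `w` in the real basis.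
Normalized so that `(√-1/2) ∑ dz_j ∧ dz̄_j` gives the standard metric, `(dz_i, dz_j) = 2δ_{ij}`. -/
def gramReal (w : CForm 2) : Matrix (Fin 3 × Fin 2) (Fin 3 × Fin 2) ℂ :=
  fun a b => w ![realBasis a, Complex.I • realBasis b]

/-- The Hermitian inner product `(α, β)_w` on `k`-forms, obtained by raising indices with the
inverse of the metric: `(1/k!) ∑ g^{a₁b₁} ⋯ g^{a_k b_k} α_{a₁⋯a_k} conj(β_{b₁⋯b_k})`. -/
def formInner {k : ℕ} (w : CForm 2) (α β : CForm k) : ℂ :=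
  (k.factorial : ℂ)⁻¹ * ∑ a : Fin k → Fin 3 × Fin 2, ∑ b : Fin k → Fin 3 × Fin 2,
    (∏ i, (gramReal w)⁻¹ (a i) (b i)) *
      α (fun i => realBasis (a i)) * conj (β (fun i => realBasis (b i)))

/-- The norm `‖α‖_w = (α, α)_w ^ (1/2)`. -/
def formNorm {k : ℕ} (w : CForm 2) (α : CForm k) : ℝ := Real.sqrt (formInner w α α).re

/-- The volume form `w³ / 3!`. -/
def vol (w : CForm 2) : CForm 6 := (6 : ℂ)⁻¹ • wedge (wedge w w) w

/-- `contract k α v = α(v₁, …, v_k, ·, …, ·)`. -/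
def contract : (k : ℕ) → {l : ℕ} → CForm (l + k) → (Fin k → C3) → CForm l
  | 0, _, α, _ => α
  | k + 1, _, α, v => contract k (α.curryLeft (v 0)) (fun i => v i.succ)

/-- The complex linear star operator of `w` on `k`-forms, `l = 6 - k`:
`*β = (1/k!) ∑ g^{a₁b₁} ⋯ g^{a_k b_k} β_{a₁⋯a_k} vol(e_{b₁}, …, e_{b_k}, ·)`. It is the operator
with `(φ, ψ)_w w³/3! = φ ∧ *ψ̄`. -/
def star {k l : ℕ} (h : 6 = l + k) (w : CForm 2) (β : CForm k) : CForm l :=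
  (k.factorial : ℂ)⁻¹ • ∑ a : Fin k → Fin 3 × Fin 2, ∑ b : Fin k → Fin 3 × Fin 2,
    ((∏ i, (gramReal w)⁻¹ (a i) (b i)) * β (fun i => realBasis (a i))) •
      contract k (h ▸ vol w : CForm (l + k)) (fun i => realBasis (b i))

/-- The codifferential `d^*_w = - *_w d *_w` on 2-forms (the real dimension is even). -/
def codiff (w : C3 → CForm 2) (α : C3 → CForm 2) (z : C3) : CForm 1 :=
  - star (k := 5) rfl (w z) (extDeriv (fun y => star (k := 2) (l := 4) rfl (w y) (α y)) z)

/-! ## Matrices of forms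

An endomorphism of a vector bundle is written, in a local holomorphic frame `e₁, …, e_r`, as the
matrix `A` with `e_i A = ∑_j A_{ij} e_j`; endomorphisms act on the right, so that composition
`u ↦ u A B` corresponds to the matrix product `A B`. -/

/-- `r × r`-matrices of `k`-forms. -/
abbrev MForm (r k : ℕ) : Type := Matrix (Fin r) (Fin r) (CForm k)

/-- Product of a matrix of functions with a matrix of forms. -/
def lmul {r k : ℕ} (A : Matrix (Fin r) (Fin r) ℂ) (T : MForm r k) : MForm r k :=
  fun i j => ∑ l, A i l • T l j

/-- Product of a matrix of forms with a matrix of functions. -/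
def rmul {r k : ℕ} (T : MForm r k) (A : Matrix (Fin r) (Fin r) ℂ) : MForm r k :=
  fun i j => ∑ l, A l j • T i l

/-- The wedge product of matrices of forms. -/
def mwedge {r p q : ℕ} (S : MForm r p) (T : MForm r q) : MForm r (p + q) :=
  fun i j => ∑ l, wedge (S i l) (T l j)

/-- The wedge product of a matrix of forms with a scalar form. -/
def swedge {r p q : ℕ} (S : MForm r p) (β : CForm q) : MForm r (p + q) :=
  fun i j => wedge (S i j) β

/-- The trace of a matrix of forms. -/
def mtrace {r k : ℕ} (T : MForm r k) : CForm k := ∑ i, T i i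

/-- A function, as a 0-form. -/
def zeroForm (f : C3 → ℂ) (z : C3) : CForm 0 :=
  ContinuousAlternatingMap.constOfIsEmpty ℝ C3 (Fin 0) (f z)

/-- `∂` of a matrix of functions. -/
def mdel {r : ℕ} (A : C3 → Matrix (Fin r) (Fin r) ℂ) (z : C3) : MForm r 1 :=
  fun i j => del (zeroForm fun y => A y i j) z

/-- `∂̄` of a matrix of functions, i.e. `D''` of an endomorphism in a holomorphic frame. -/
def mdelbarZero {r : ℕ} (A : C3 → Matrix (Fin r) (Fin r) ℂ) (z : C3) : MForm r 1 :=
  fun i j => delbar (zeroForm fun y => A y i j) z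

/-- `∂̄` of a matrix of `k`-forms, i.e. `D''` in a holomorphic frame. -/
def mdelbar {r k : ℕ} (T : C3 → MForm r k) (z : C3) : MForm r (k + 1) :=
  fun i j => delbar (fun y => T y i j) z

/-- The connection matrix `θ = ∂G · G⁻¹` (`D e_i = ∑ θ_{ij} e_j`) of the hermitian connection
of the metric with Gram matrix `G_{ij} = ⟨e_i, e_j⟩` in a holomorphic frame. -/
def chernConn {r : ℕ} (G : C3 → Matrix (Fin r) (Fin r) ℂ) (z : C3) : MForm r 1 :=
  rmul (mdel G z) (G z)⁻¹

/-- The curvature `D ∘ D`, with matrix `dθ - θ ∧ θ`, of the hermitian connection. -/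
def curvature {r : ℕ} (G : C3 → Matrix (Fin r) (Fin r) ℂ) (z : C3) : MForm r 2 :=
  fun i j => extDeriv (fun y => chernConn G y i j) z - mwedge (chernConn G z) (chernConn G z) i j

/-- The (1,0)-part `D' A = ∂A + Aθ - θA` of the connection induced on endomorphisms. -/
def dprime {r : ℕ} (G A : C3 → Matrix (Fin r) (Fin r) ℂ) (z : C3) : MForm r 1 :=
  mdel A z + lmul (A z) (chernConn G z) - rmul (chernConn G z) (A z)

/-- The Gram matrix, in the frame `∂/∂z_i`, of the hermitian metric on the holomorphic tangent
bundle given by `w`: `h(u,v) = w(u, √-1 v) - √-1 w(u, v)`, linear in `u`, antilinear in `v`. -/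
def tangentGram (w : C3 → CForm 2) (z : C3) : Matrix (Fin 3) (Fin 3) ℂ :=
  fun i j => w z ![Pi.single i 1, Complex.I • Pi.single j 1]
    - Complex.I * w z ![Pi.single i 1, Pi.single j 1]

/-- The curvature `R_w` of the hermitian (Chern) connection of `w` on the tangent bundle. -/
def tangentCurv (w : C3 → CForm 2) : C3 → MForm 3 2 := curvature (tangentGram w)

/-! ## Tensor fields on a complex threefold and a holomorphic vector bundle over it -/

section Manifold

variable {X : Type*} [TopologicalSpace X] [ChartedSpace C3 X]

variable (X) in
/-- Complex valued `k`-forms on `X` (not necessarily continuous). -/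
abbrev FormField (k : ℕ) : Type _ := ∀ x : X, TangentSpace 𝓘(ℝ, C3) x [⋀^Fin k]→L[ℝ] ℂ

/-- The expression of a form in a chart: its pull back under the inverse of the chart. -/
def inChart {k : ℕ} (φ : OpenPartialHomeomorph X C3) (α : FormField X k) (z : C3) : CForm k :=
  (α (φ.symm z)).compContinuousLinearMap (mfderiv 𝓘(ℝ, C3) 𝓘(ℝ, C3) φ.symm z : C3 →L[ℝ] _)

/-- `α ∈ Ω^{1,1}_ℝ(X)`: a smooth real (1,1)-form. -/
def IsReal11Form (α : FormField X 2) : Prop :=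
  ∀ φ ∈ atlas C3 X, ContDiffOn ℝ ∞ (inChart φ α) φ.target ∧
    ∀ z ∈ φ.target, IsReal11 (inChart φ α z)

/-- `w` belongs to the cone `𝓗(X)` of positive definite hermitian forms. -/
def IsHermitianForm (w : FormField X 2) : Prop :=
  IsReal11Form w ∧ ∀ φ ∈ atlas C3 X, ∀ z ∈ φ.target, IsPositive (inChart φ w z)

/-- `w` is a Kähler form. -/
def IsKahlerForm (w : FormField X 2) : Prop :=
  IsHermitianForm w ∧ ∀ φ ∈ atlas C3 X, ∀ z ∈ φ.target, extDeriv (inChart φ w) z = 0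

/-- `Ω` is a holomorphic (3,0)-form. -/
def IsHolomorphicThreeForm (Ω : FormField X 3) : Prop :=
  ∀ φ ∈ atlas C3 X, ContDiffOn ℝ ∞ (inChart φ Ω) φ.target ∧
    (∀ z ∈ φ.target, ∀ u v w,
      inChart φ Ω z ![Complex.I • u, v, w] = Complex.I * inChart φ Ω z ![u, v, w]) ∧
    ∀ v, DifferentiableOn ℂ (fun z => inChart φ Ω z v) φ.target

variable {r : ℕ} {E : X → Type*} [∀ x, AddCommGroup (E x)] [∀ x, Module ℂ (E x)]
  [TopologicalSpace (TotalSpace (Fin r → ℂ) E)] [∀ x, TopologicalSpace (E x)]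
  [FiberBundle (Fin r → ℂ) E]

variable (r E) in
/-- A chart of `X` together with a trivialization of `E`, both taken from the given atlases. If
`E` is a holomorphic vector bundle the trivialization is the same as a holomorphic frame. -/
structure Patch where
  /-- the chart -/
  chart : OpenPartialHomeomorph X C3
  /-- it belongs to the complex atlas -/
  chart_mem : chart ∈ atlas C3 X
  /-- the trivialization -/
  triv : Trivialization (Fin r → ℂ) (TotalSpace.proj : TotalSpace (Fin r → ℂ) E → X)
  /-- it belongs to the trivialization atlas -/
  triv_mem : MemTrivializationAtlas triv

/-- The open subset of `ℂ³` on which chart and frame are both defined. -/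
def Patch.dom (P : Patch r E) : Set C3 := P.chart.target ∩ P.chart.symm ⁻¹' P.triv.baseSet

/-- The `i`-th vector of the frame, at the point with coordinates `z`. -/
def Patch.frame (P : Patch r E) (z : C3) (i : Fin r) : E (P.chart.symm z) :=
  P.triv.symm (P.chart.symm z) (Pi.single i 1)

variable (E) in
/-- A family of pairings on the fibres of `E`. -/
abbrev PairingField : Type _ := ∀ x : X, E x → E x → ℂ

variable (E) in
/-- A family of endomorphisms of the fibres of `E`. -/
abbrev EndField : Type _ := ∀ x : X, E x →ₗ[ℂ] E x

/-- The Gram matrix `⟨e_i, e_j⟩` of a pairing. -/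
def Patch.gram (P : Patch r E) (k : PairingField E) (z : C3) : Matrix (Fin r) (Fin r) ℂ :=
  fun i j => k _ (P.frame z i) (P.frame z j)

/-- The matrix of an endomorphism: `e_i A = ∑_j A_{ij} e_j`. -/
def Patch.mat (P : Patch r E) (A : EndField E) (z : C3) : Matrix (Fin r) (Fin r) ℂ :=
  fun i j => (P.triv ⟨P.chart.symm z, A _ (P.frame z i)⟩).2 j

variable (r) in
/-- `k` is a smooth hermitian metric on `E`. -/
structure IsHermitianMetric (k : PairingField E) : Prop where
  add_left : ∀ x u v w, k x (u + v) w = k x u w + k x v w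
  smul_left : ∀ x (c : ℂ) u v, k x (c • u) v = c * k x u v
  conj_symm : ∀ x u v, conj (k x u v) = k x v u
  pos : ∀ x u, u ≠ 0 → 0 < (k x u u).re
  smooth : ∀ P : Patch r E, ∀ i j, ContDiffOn ℝ ∞ (fun z => P.gram k z i j) P.dom

variable (r) in
/-- `A` is a smooth endomorphism of `E`. -/
def IsSmoothEnd (A : EndField E) : Prop :=
  ∀ P : Patch r E, ∀ i j, ContDiffOn ℝ ∞ (fun z => P.mat A z i j) P.dom

variable (r) in
/-- `H ∈ 𝓗(E)₁`: a smooth endomorphism, hermitian symmetric and positive definite with respect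
to the reference metric `k`, of determinant one. It stands for the metric `⟨u, v⟩_H = ⟨uH, v⟩`. -/
structure IsMetricOne (k : PairingField E) (H : EndField E) : Prop where
  smooth : IsSmoothEnd r H
  symm : ∀ x u v, k x (H x u) v = k x u (H x v)
  pos : ∀ x u, u ≠ 0 → 0 < (k x (H x u) u).re
  det : ∀ x, LinearMap.det (H x) = 1

variable (r) in
/-- `A ∈ Ω⁰(Her⁰ E)`: a smooth traceless endomorphism, hermitian symmetric with respect to `k`. -/
structure IsHerZero (k : PairingField E) (A : EndField E) : Prop where
  smooth : IsSmoothEnd r A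
  symm : ∀ x u v, k x (A x u) v = k x u (A x v)
  trace : ∀ x, LinearMap.trace ℂ (E x) (A x) = 0

/-- The hermitian metric `⟨u, v⟩_H = ⟨uH, v⟩`. -/
def metricOf (k : PairingField E) (H : EndField E) : PairingField E :=
  fun x u v => k x (H x u) v

/-- `S` is a positive definite `k`-hermitian square root of `A`. -/
def IsSqrt {W : Type*} [AddCommGroup W] [Module ℂ W] (k : W → W → ℂ) (A S : W →ₗ[ℂ] W) : Prop :=
  (∀ u v, k (S u) v = k u (S v)) ∧ (∀ u, u ≠ 0 → 0 < (k (S u) u).re) ∧ S ∘ₗ S = A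

open Classical in
/-- `H^{1/2}`, the positive definite `k`-hermitian square root of `H`. -/
def sqrtEnd (k : PairingField E) (H : EndField E) : EndField E :=
  fun x => if h : ∃ S, IsSqrt (k x) (H x) S then h.choose else 0

/-! ## Strominger's operator and its linearization -/

/-- The curvature `F_H` of the hermitian connection of `⟨,⟩_H`. -/
def curvH (P : Patch r E) (k : PairingField E) (H : EndField E) : C3 → MForm r 2 :=
  curvature (P.gram (metricOf k H))

/-- `H^{-1/2} T H^{1/2}`. -/
def conjSqrt {p : ℕ} (P : Patch r E) (k : PairingField E) (H : EndField E) (z : C3)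
    (T : MForm r p) : MForm r p :=
  rmul (lmul (P.mat (sqrtEnd k H) z)⁻¹ T) (P.mat (sqrtEnd k H) z)

/-- `L₁(H, w) = H^{-1/2} F_H H^{1/2} ∧ w²`. -/
def L1 (P : Patch r E) (k : PairingField E) (H : EndField E) (w : FormField X 2) (z : C3) :
    MForm r 6 :=
  swedge (conjSqrt P k H z (curvH P k H z)) (wedge (inChart P.chart w z) (inChart P.chart w z))

/-- `L₂(H, w) = (1/2) d d_c w + (tr (F_H ∧ F_H) - tr (R_w ∧ R_w))`. -/
def L2 (P : Patch r E) (k : PairingField E) (H : EndField E) (w : FormField X 2) (z : C3) :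
    CForm 4 :=
  (2 : ℂ)⁻¹ • extDeriv (dc (inChart P.chart w)) z
    + (mtrace (mwedge (curvH P k H z) (curvH P k H z))
      - mtrace (mwedge (tangentCurv (inChart P.chart w) z) (tangentCurv (inChart P.chart w) z)))

/-- `L₃(H, w) = *_{w₀} d (‖Ω‖_w w²)` (it does not involve `H`). -/
def L3 (φ : OpenPartialHomeomorph X C3) (w₀ : FormField X 2) (Ω : FormField X 3)
    (w : FormField X 2) (z : C3) : CForm 1 :=
  star (k := 5) rfl (inChart φ w₀ z)
    (extDeriv (fun y => (formNorm (inChart φ w y) (inChart φ Ω y) : ℂ) •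
      wedge (inChart φ w y) (inChart φ w y)) z)

variable (r) in
/-- `L(H, w) = 0`. -/
def IsSolution (k : PairingField E) (w₀ : FormField X 2) (Ω : FormField X 3)
    (H : EndField E) (w : FormField X 2) : Prop :=
  ∀ P : Patch r E, ∀ z ∈ P.dom,
    L1 P k H w z = 0 ∧ L2 P k H w z = 0 ∧ L3 P.chart w₀ Ω w z = 0

/-- The tangent vector `δH = H^{1/2} δh H^{1/2}` of `𝓗(E)₁` at `H` given by `δh`. -/
def deltaH (k : PairingField E) (H δh : EndField E) : EndField E :=
  fun x => sqrtEnd k H x ∘ₗ δh x ∘ₗ sqrtEnd k H x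

/-- `δF_H(δh)`: the directional derivative of `H ↦ F_H` in the direction `δH`. -/
def deltaF (P : Patch r E) (k : PairingField E) (H δh : EndField E) (z : C3) : MForm r 2 :=
  fun i j => deriv (fun t : ℝ =>
    curvH P k (fun x => H x + (t : ℂ) • deltaH k H δh x) z i j) 0

/-- `δR_w(δw)`: the directional derivative of `w ↦ R_w` in the direction `δw`. -/
def deltaR (w δw : C3 → CForm 2) (z : C3) : MForm 3 2 :=
  fun i j => deriv (fun t : ℝ => tangentCurv (fun y => w y + t • δw y) z i j) 0

variable (r) in
/-- `(Ht, wt)`, `|t| < ε`, is a smooth curve in `𝓗(E)₁ × 𝓗(X)` through `(H, w₀)` at `t = 0` with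
velocity `(δH, δw)` there, where `δH = H^{1/2} δh H^{1/2}`. -/
structure IsVariation (k : PairingField E) (H : EndField E) (w₀ : FormField X 2)
    (δh : EndField E) (δw : FormField X 2)
    (ε : ℝ) (Ht : ℝ → EndField E) (wt : ℝ → FormField X 2) : Prop where
  pos : 0 < ε
  mem_H : ∀ t ∈ Set.Ioo (-ε) ε, IsMetricOne r k (Ht t)
  mem_w : ∀ t ∈ Set.Ioo (-ε) ε, IsHermitianForm (wt t)
  smooth_H : ∀ P : Patch r E, ∀ i j, ContDiffOn ℝ ∞
    (fun p : ℝ × C3 => P.mat (Ht p.1) p.2 i j) (Set.Ioo (-ε) ε ×ˢ P.dom)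
  smooth_w : ∀ φ ∈ atlas C3 X, ContDiffOn ℝ ∞
    (fun p : ℝ × C3 => inChart φ (wt p.1) p.2) (Set.Ioo (-ε) ε ×ˢ φ.target)
  zero_H : Ht 0 = H
  zero_w : wt 0 = w₀
  deriv_H : ∀ P : Patch r E, ∀ z ∈ P.dom, ∀ i j,
    HasDerivAt (fun t => P.mat (Ht t) z i j) (P.mat (deltaH k H δh) z i j) 0
  deriv_w : ∀ φ ∈ atlas C3 X, ∀ z ∈ φ.target,
    HasDerivAt (fun t => inChart φ (wt t) z) (inChart φ δw z) 0

end Manifold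

end Strominger

end

noncomputable section

namespace Strominger

/-! ## Smooth one-parameter families -/

section Families

variable {B V W Z : Type*} [NormedAddCommGroup B] [NormedSpace ℝ B]
  [NormedAddCommGroup V] [NormedSpace ℝ V] [NormedAddCommGroup W] [NormedSpace ℝ W]
  [NormedAddCommGroup Z] [NormedSpace ℝ Z]

/-- `f t y` is jointly smooth near `{0} × U`, with `t`-derivative `f' y` at `t = 0`. -/
def SmoothFamily (U : Set B) (f : ℝ → B → V) (f' : B → V) : Prop :=
  ∀ y ∈ U, ContDiffAt ℝ ∞ (Function.uncurry f) (0, y) ∧ HasDerivAt (fun t => f t y) (f' y) 0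

theorem SmoothFamily.hasDerivAt {U : Set B} {f : ℝ → B → V} {f' : B → V}
    (h : SmoothFamily U f f') {y : B} (hy : y ∈ U) : HasDerivAt (fun t => f t y) (f' y) 0 :=
  (h y hy).2

theorem SmoothFamily.contDiffAt {U : Set B} {f : ℝ → B → V} {f' : B → V}
    (h : SmoothFamily U f f') {y : B} (hy : y ∈ U) :
    ContDiffAt ℝ ∞ (Function.uncurry f) (0, y) := (h y hy).1

theorem hasDerivAt_slice {F : ℝ × B → V} {y : B} (h : DifferentiableAt ℝ F (0, y)) :
    HasDerivAt (fun t => F (t, y)) (fderiv ℝ F (0, y) (1, 0)) 0 := by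
  have h1 : HasDerivAt (fun t : ℝ => (t, y)) ((1 : ℝ), (0 : B)) 0 :=
    (hasDerivAt_id 0).prodMk (hasDerivAt_const 0 y)
  exact HasFDerivAt.comp_hasDerivAt (f := fun t : ℝ => (t, y)) 0 h.hasFDerivAt h1

theorem SmoothFamily.contDiffAt_base {U : Set B} {f : ℝ → B → V} {f' : B → V}
    (h : SmoothFamily U f f') {y : B} (hy : y ∈ U) : ContDiffAt ℝ ∞ (f 0) y :=
  ContDiffAt.comp (g := Function.uncurry f) (f := fun y : B => ((0 : ℝ), y)) y (h.contDiffAt hy)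
    (contDiffAt_const.prodMk contDiffAt_id)

theorem SmoothFamily.deriv_eq {U : Set B} {f : ℝ → B → V} {f' : B → V}
    (h : SmoothFamily U f f') {y : B} (hy : y ∈ U) :
    f' y = fderiv ℝ (Function.uncurry f) (0, y) (1, 0) :=
  (h.hasDerivAt hy).unique
    (hasDerivAt_slice ((h.contDiffAt hy).differentiableAt (by simp)))

theorem SmoothFamily.contDiffAt_deriv {U : Set B} (hU : IsOpen U) {f : ℝ → B → V} {f' : B → V}
    (h : SmoothFamily U f f') {y : B} (hy : y ∈ U) : ContDiffAt ℝ ∞ f' y := by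
  have h1 : ContDiffAt ℝ ∞ (fun y : B => fderiv ℝ (Function.uncurry f) (0, y) (1, 0)) y := by
    refine ContDiffAt.clm_apply ?_ contDiffAt_const
    exact ContDiffAt.comp (g := fderiv ℝ (Function.uncurry f)) (f := fun y : B => ((0 : ℝ), y)) y
      ((h.contDiffAt hy).fderiv_right (by simp))
      (contDiffAt_const.prodMk contDiffAt_id)
  refine h1.congr_of_eventuallyEq ?_
  filter_upwards [hU.mem_nhds hy] with x hx using h.deriv_eq hx

theorem SmoothFamily.congr_deriv {U : Set B} {f : ℝ → B → V} {f' g' : B → V}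
    (h : SmoothFamily U f f') (he : ∀ y ∈ U, f' y = g' y) : SmoothFamily U f g' :=
  fun y hy => ⟨(h y hy).1, he y hy ▸ (h y hy).2⟩

/-- Families agreeing near `{0} × U`. -/
theorem SmoothFamily.congr {U : Set B} {f g : ℝ → B → V} {f' : B → V}
    (h : SmoothFamily U f f')
    (he : ∀ y ∈ U, Function.uncurry g =ᶠ[nhds (0, y)] Function.uncurry f) :
    SmoothFamily U g f' := by
  intro y hy
  refine ⟨(h y hy).1.congr_of_eventuallyEq (he y hy), (h y hy).2.congr_of_eventuallyEq ?_⟩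
  have : Filter.Tendsto (fun t : ℝ => (t, y)) (nhds 0) (nhds (0, y)) :=
    (Continuous.prodMk_left y).tendsto 0
  exact this.eventually (he y hy)

theorem smoothFamily_const {U : Set B} {f : B → V} (hf : ∀ y ∈ U, ContDiffAt ℝ ∞ f y) :
    SmoothFamily U (fun _ => f) (fun _ => 0) := fun y hy =>
  ⟨ContDiffAt.comp (g := f) (f := Prod.snd) ((0 : ℝ), y) (hf y hy) contDiffAt_snd,
    hasDerivAt_const _ _⟩

theorem SmoothFamily.sub {U : Set B} {f g : ℝ → B → V} {f' g' : B → V}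
    (hf : SmoothFamily U f f') (hg : SmoothFamily U g g') :
    SmoothFamily U (fun t y => f t y - g t y) (fun y => f' y - g' y) := fun y hy =>
  ⟨(hf y hy).1.sub (hg y hy).1, (hf y hy).2.sub (hg y hy).2⟩

theorem SmoothFamily.sum {ι : Type*} {s : Finset ι} {U : Set B} {f : ι → ℝ → B → V}
    {f' : ι → B → V} (hf : ∀ i ∈ s, SmoothFamily U (f i) (f' i)) :
    SmoothFamily U (fun t y => ∑ i ∈ s, f i t y) (fun y => ∑ i ∈ s, f' i y) := fun y hy =>
  ⟨ContDiffAt.sum (f := fun i (p : ℝ × B) => f i p.1 p.2) fun i hi => (hf i hi y hy).1,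
    HasDerivAt.fun_sum fun i hi => (hf i hi y hy).2⟩

theorem SmoothFamily.clm {U : Set B} {f : ℝ → B → V} {f' : B → V} (L : V →L[ℝ] W)
    (hf : SmoothFamily U f f') : SmoothFamily U (fun t y => L (f t y)) (fun y => L (f' y)) :=
  fun y hy => ⟨L.contDiff.contDiffAt.comp _ (hf y hy).1, L.hasFDerivAt.comp_hasDerivAt _ (hf y hy).2⟩

theorem SmoothFamily.bilin {U : Set B} {f : ℝ → B → V} {f' : B → V} {g : ℝ → B → W} {g' : B → W}
    (L : V →L[ℝ] W →L[ℝ] Z) (hf : SmoothFamily U f f') (hg : SmoothFamily U g g') :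
    SmoothFamily U (fun t y => L (f t y) (g t y)) (fun y => L (f 0 y) (g' y) + L (f' y) (g 0 y)) :=
  fun y hy => ⟨(L.contDiff.contDiffAt.comp _ (hf y hy).1).clm_apply (hg y hy).1,
    L.hasDerivAt_of_bilinear (fun _ => (hf y hy).2) (fun _ => (hg y hy).2)⟩

theorem SmoothFamily.comp {U : Set B} {f : ℝ → B → V} {f' : B → V} {Φ : V → W}
    (hf : SmoothFamily U f f') (hΦ : ∀ y ∈ U, ContDiffAt ℝ ∞ Φ (f 0 y)) :
    SmoothFamily U (fun t y => Φ (f t y)) (fun y => fderiv ℝ Φ (f 0 y) (f' y)) := fun y hy =>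
  ⟨ContDiffAt.comp ((0 : ℝ), y) (g := Φ) (f := Function.uncurry f) (hΦ y hy) (hf y hy).1,
    ((hΦ y hy).differentiableAt (by simp)).hasFDerivAt.comp_hasDerivAt
      (f := fun t => f t y) (0 : ℝ) (hf y hy).2⟩

/-- The derivative in `y` of a smooth family is a smooth family. -/
theorem SmoothFamily.spaceDeriv {U : Set B} (hU : IsOpen U) {f : ℝ → B → V} {f' : B → V}
    (h : SmoothFamily U f f') :
    SmoothFamily U (fun t y => fderiv ℝ (f t) y) (fun y => fderiv ℝ f' y) := by
  intro y hy
  set F := Function.uncurry f with hF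
  have hFd := h.contDiffAt hy
  constructor
  · refine ContDiffAt.fderiv (f := fun (p : ℝ × B) => f p.1) (g := Prod.snd) (m := ∞) (n := ∞) ?_
      contDiffAt_snd (le_of_eq rfl)
    exact ContDiffAt.comp (g := F) (f := fun q : (ℝ × B) × B => (q.1.1, q.2)) ((0, y), y) hFd
      ((contDiffAt_fst.fst).prodMk contDiffAt_snd)
  · have hdF : DifferentiableAt ℝ (fderiv ℝ F) (0, y) :=
      (hFd.fderiv_right (m := ∞) (le_of_eq rfl)).differentiableAt (by simp)
    have hev : ∀ᶠ p in nhds ((0 : ℝ), y), DifferentiableAt ℝ F p := by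
      have := (hFd.of_le (m := 1) (by simp)).eventually (by simp)
      filter_upwards [this] with p hp using hp.differentiableAt (by simp)
    have hslice : ∀ᶠ t in nhds (0 : ℝ), fderiv ℝ (f t) y
        = (fderiv ℝ F (t, y)).comp (ContinuousLinearMap.inr ℝ ℝ B) := by
      have ht : Filter.Tendsto (fun t : ℝ => (t, y)) (nhds 0) (nhds (0, y)) :=
        (Continuous.prodMk_left y).tendsto 0
      filter_upwards [ht.eventually hev] with t hp
      have h1 : HasFDerivAt (fun x : B => (t, x)) (ContinuousLinearMap.inr ℝ ℝ B) y :=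
        hasFDerivAt_prodMk_right t y
      exact (HasFDerivAt.comp (g := F) (f := fun x : B => (t, x)) y hp.hasFDerivAt h1).fderiv
    have key : HasDerivAt (fun t => (fderiv ℝ F (t, y)).comp (ContinuousLinearMap.inr ℝ ℝ B))
        ((fderiv ℝ (fderiv ℝ F) (0, y) (1, 0)).comp (ContinuousLinearMap.inr ℝ ℝ B)) 0 :=
      ((ContinuousLinearMap.compL ℝ B (ℝ × B) V).flip
        (ContinuousLinearMap.inr ℝ ℝ B)).hasFDerivAt.comp_hasDerivAt 0 (hasDerivAt_slice hdF)
    have hf' : HasFDerivAt f' ((fderiv ℝ (fderiv ℝ F) (0, y) (1, 0)).comp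
        (ContinuousLinearMap.inr ℝ ℝ B)) y := by
      have h1 : HasFDerivAt (fun x : B => ((0 : ℝ), x)) (ContinuousLinearMap.inr ℝ ℝ B) y :=
        hasFDerivAt_prodMk_right 0 y
      have h2 := (HasFDerivAt.comp (g := fderiv ℝ F) (f := fun x : B => ((0 : ℝ), x)) y
        hdF.hasFDerivAt h1)
      have h3 := h2.clm_apply (hasFDerivAt_const ((1 : ℝ), (0 : B)) y)
      have hsymm : IsSymmSndFDerivAt ℝ F (0, y) := hFd.isSymmSndFDerivAt (by simpa using (WithTop.coe_le_coe.2 le_top : ((2 : ℕ∞) : WithTop ℕ∞) ≤ ∞))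
      refine (h3.congr_of_eventuallyEq ?_).congr_fderiv ?_
      · filter_upwards [hU.mem_nhds hy] with x hx using h.deriv_eq hx
      · ext v
        simp [hsymm.eq (0, v) (1, 0)]
    simp only [hf'.fderiv]
    exact key.congr_of_eventuallyEq hslice

end Families

/-! ## The spaces of forms are finite dimensional -/

instance finiteDimensional_cform (k : ℕ) : FiniteDimensional ℝ (CForm k) := by
  have : FiniteDimensional ℝ (MultilinearMap ℝ (fun _ : Fin k => C3) ℂ) := inferInstance
  refine FiniteDimensional.of_injective (V₂ := MultilinearMap ℝ (fun _ : Fin k => C3) ℂ)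
    ({ toFun := fun α => α.toContinuousMultilinearMap.toMultilinearMap
       map_add' := fun _ _ => rfl
       map_smul' := fun _ _ => rfl }) ?_
  intro α β h
  ext v
  exact congrArg (fun m : MultilinearMap ℝ (fun _ : Fin k => C3) ℂ => m v) h

theorem tensor_add_left {p q : ℕ} (α α' : CForm p) (β : CForm q) :
    tensor (α + α') β = tensor α β + tensor α' β := by
  ext v; exact add_mul _ _ _

theorem tensor_add_right {p q : ℕ} (α : CForm p) (β β' : CForm q) :
    tensor α (β + β') = tensor α β + tensor α β' := by
  ext v; exact mul_add _ _ _

theorem wedge_apply {p q : ℕ} (α : CForm p) (β : CForm q) (v : Fin (p + q) → C3) :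
    wedge α β v = ((p.factorial * q.factorial : ℕ) : ℂ)⁻¹ *
      ∑ σ : Equiv.Perm (Fin (p + q)), Equiv.Perm.sign σ •
        (α (fun i => v (σ (Fin.castAdd q i))) * β (fun j => v (σ (Fin.natAdd p j)))) := by
  simp only [wedge, ContinuousAlternatingMap.smul_apply,
    ContinuousMultilinearMap.alternatization_apply_apply, smul_eq_mul]
  rfl

theorem wedge_add_left {p q : ℕ} (α α' : CForm p) (β : CForm q) :
    wedge (α + α') β = wedge α β + wedge α' β := by
  simp only [wedge, tensor_add_left, map_add, smul_add]

theorem wedge_add_right {p q : ℕ} (α : CForm p) (β β' : CForm q) :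
    wedge α (β + β') = wedge α β + wedge α β' := by
  simp only [wedge, tensor_add_right, map_add, smul_add]

theorem wedge_smul_left {p q : ℕ} (c : ℂ) (α : CForm p) (β : CForm q) :
    wedge (c • α) β = c • wedge α β := by
  ext v
  simp only [wedge_apply, ContinuousAlternatingMap.smul_apply, smul_eq_mul, mul_assoc,
    mul_smul_comm, Finset.mul_sum, mul_left_comm]

theorem wedge_smul_right {p q : ℕ} (c : ℂ) (α : CForm p) (β : CForm q) :
    wedge α (c • β) = c • wedge α β := by
  ext v
  simp only [wedge_apply, ContinuousAlternatingMap.smul_apply, smul_eq_mul,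
    mul_smul_comm, Finset.mul_sum, mul_left_comm]

theorem coe_smul_cform {k : ℕ} (c : ℝ) (α : CForm k) : (c : ℂ) • α = c • α := by
  ext v
  simp [Complex.real_smul]

/-- The wedge product as a continuous bilinear map. -/
def wedgeL (p q : ℕ) : CForm p →L[ℝ] CForm q →L[ℝ] CForm (p + q) :=
  LinearMap.toContinuousLinearMap
    { toFun := fun α => LinearMap.toContinuousLinearMap
        { toFun := fun β => wedge α β
          map_add' := wedge_add_right α
          map_smul' := fun c β => by
            simp only [← coe_smul_cform, wedge_smul_right, RingHom.id_apply] }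
      map_add' := fun α α' => by ext1 β; exact wedge_add_left α α' β
      map_smul' := fun c α => by
        ext1 β
        change wedge (c • α) β = c • wedge α β
        simp only [← coe_smul_cform, wedge_smul_left] }

end Strominger

end

noncomputable section

namespace Strominger

/-! ## Openness of positivity -/

theorem isOpen_forall_pos {T V : Type*} [TopologicalSpace T] [NormedAddCommGroup V]
    [NormedSpace ℝ V] [FiniteDimensional ℝ V] {Q : T → V → ℝ}
    (hQ : Continuous (Function.uncurry Q)) (hhom : ∀ q (c : ℝ) u, Q q (c • u) = c ^ 2 * Q q u) :
    IsOpen {q | ∀ u, u ≠ 0 → 0 < Q q u} := by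
  have hK : IsCompact (Metric.sphere (0 : V) 1) := isCompact_sphere 0 1
  have hset : {q | ∀ u, u ≠ 0 → 0 < Q q u} = {q | ∀ u ∈ Metric.sphere (0 : V) 1, 0 < Q q u} := by
    ext q
    refine ⟨fun h u hu => h u ?_, fun h u hu => ?_⟩
    · rintro rfl
      simp at hu
    · have hn : 0 < ‖u‖ := norm_pos_iff.2 hu
      have h1 := h (‖u‖⁻¹ • u) (by simp [norm_smul, hn.ne'])
      rw [hhom] at h1
      exact pos_of_mul_pos_right h1 (sq_nonneg _)
  rw [hset, isOpen_iff_mem_nhds]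
  intro q hq
  refine hK.eventually_forall_of_forall_eventually fun u hu => ?_
  exact (isOpen_lt continuous_const hQ).mem_nhds (hq u hu)

/-! ## Matrices -/

open Matrix
open scoped ComplexOrder

section Matrices

variable {n : Type*} [Fintype n] [DecidableEq n]

/-- The real part of `x* A x` is positive for `x ≠ 0`. -/
def RePos (A : Matrix n n ℂ) : Prop := ∀ x : n → ℂ, x ≠ 0 → 0 < (Star.star x ⬝ᵥ (A *ᵥ x)).re

omit [DecidableEq n] in
theorem rePos_of_posDef {A : Matrix n n ℂ} (h : A.PosDef) : RePos A := fun x hx => by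
  have := h.dotProduct_mulVec_pos hx
  exact (Complex.pos_iff.1 this).1

theorem RePos.congruence {A D : Matrix n n ℂ} (h : RePos A) (hD : IsUnit D) :
    RePos (Dᴴ * A * D) := by
  intro x hx
  have h1 : D *ᵥ x ≠ 0 := by
    intro h0
    apply hx
    have := mulVec_injective_iff_isUnit.2 hD
    exact this (by simpa using h0)
  have := h _ h1
  rw [star_mulVec, ← dotProduct_mulVec] at this
  simpa [mulVec_mulVec, Matrix.mul_assoc] using this

theorem eq_zero_of_sylvester_one {A B X : Matrix n n ℂ} (hA : RePos A) (hB : RePos B)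
    (h : A * X + X * B = 0) : X = 0 := by
  by_contra hX
  have htr : (Xᴴ * A * X).trace + (X * B * Xᴴ).trace = 0 := by
    rw [Matrix.trace_mul_comm (X * B), ← trace_add, Matrix.mul_assoc, ← Matrix.mul_add, h]
    simp
  have h1 : (Xᴴ * A * X).trace = ∑ j, Star.star (fun i => X i j) ⬝ᵥ (A *ᵥ fun i => X i j) := by
    rw [Matrix.mul_assoc]
    simp only [Matrix.trace, Matrix.diag, Matrix.mul_apply, dotProduct, mulVec,
      conjTranspose_apply, Pi.star_apply]
  have h2 : (X * B * Xᴴ).trace = ∑ i, Star.star (Star.star (X i)) ⬝ᵥ (B *ᵥ Star.star (X i)) := by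
    rw [Matrix.mul_assoc]
    simp only [Matrix.trace, Matrix.diag, Matrix.mul_apply, dotProduct, mulVec,
      conjTranspose_apply, Pi.star_apply, star_star]
  have nn : ∀ {C : Matrix n n ℂ} (_ : RePos C) x, 0 ≤ (Star.star x ⬝ᵥ (C *ᵥ x)).re := by
    intro C hC x
    by_cases hx : x = 0
    · simp [hx]
    · exact (hC x hx).le
  obtain ⟨i, j, hij⟩ : ∃ i j, X i j ≠ 0 := by
    by_contra! h0
    exact hX (by ext i j; exact h0 i j)
  have p1 : 0 < ((Xᴴ * A * X).trace).re := by
    rw [h1, Complex.re_sum]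
    refine Finset.sum_pos' (fun _ _ => nn hA _) ⟨j, Finset.mem_univ _, hA _ ?_⟩
    exact fun h0 => hij (congrFun h0 i)
  have p2 : 0 ≤ ((X * B * Xᴴ).trace).re := by
    rw [h2, Complex.re_sum]
    exact Finset.sum_nonneg fun _ _ => nn hB _
  have := congrArg Complex.re htr
  simp only [Complex.add_re, Complex.zero_re] at this
  linarith

theorem exists_factor_of_posDef {G : Matrix n n ℂ} (hG : G.PosDef) :
    ∃ D : Matrix n n ℂ, IsUnit D ∧ G = D * Dᴴ := by
  open scoped MatrixOrder in
  obtain ⟨y, hy, rfl⟩ := CStarAlgebra.isStrictlyPositive_iff_eq_star_mul_self.mp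
    hG.isStrictlyPositive
  exact ⟨yᴴ, (isUnit_conjTranspose y).2 hy, by rw [conjTranspose_conjTranspose]; rfl⟩

theorem conj_factor {G D A : Matrix n n ℂ} (hD : IsUnit D) (hG : G = D * Dᴴ) :
    D⁻¹ * A * D = D⁻¹ * (A * G) * (D⁻¹)ᴴ := by
  have h2 : Dᴴ * (D⁻¹)ᴴ = 1 := by
    rw [← conjTranspose_mul, nonsing_inv_mul _ ((isUnit_iff_isUnit_det _).1 hD),
      conjTranspose_one]
  rw [hG]
  simp only [Matrix.mul_assoc, h2, Matrix.mul_one]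

/-- Sylvester's equation `A X + X B = 0` has no nontrivial solution if `A` and `B` have positive
real part with respect to the hermitian form `G`. -/
theorem eq_zero_of_sylvester {A B X G : Matrix n n ℂ} (hG : G.PosDef) (hA : RePos (A * G))
    (hB : RePos (B * G)) (h : A * X + X * B = 0) : X = 0 := by
  obtain ⟨D, hD, hGD⟩ := exists_factor_of_posDef hG
  have hdet := (isUnit_iff_isUnit_det _).1 hD
  have hDi : IsUnit (D⁻¹)ᴴ := (isUnit_nonsing_inv_iff.2 hD).star
  have hA' : RePos (D⁻¹ * A * D) := by
    rw [conj_factor hD hGD]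
    simpa using hA.congruence hDi
  have hB' : RePos (D⁻¹ * B * D) := by
    rw [conj_factor hD hGD]
    simpa using hB.congruence hDi
  have h0 : (D⁻¹ * A * D) * (D⁻¹ * X * D) + (D⁻¹ * X * D) * (D⁻¹ * B * D)
      = D⁻¹ * (A * X + X * B) * D := by
    have e : ∀ Y Z : Matrix n n ℂ, (D⁻¹ * Y * D) * (D⁻¹ * Z * D) = D⁻¹ * (Y * Z) * D := by
      intro Y Z
      simp only [Matrix.mul_assoc]
      rw [Matrix.mul_nonsing_inv_cancel_left _ _ hdet]
    rw [e, e, ← Matrix.add_mul, ← Matrix.mul_add]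
  rw [h, Matrix.mul_zero, Matrix.zero_mul] at h0
  have h1 := eq_zero_of_sylvester_one hA' hB' h0
  have h2 : X = D * (D⁻¹ * X * D) * D⁻¹ := by
    simp only [Matrix.mul_assoc, Matrix.mul_nonsing_inv _ hdet, Matrix.mul_one]
    rw [Matrix.mul_nonsing_inv_cancel_left _ _ hdet]
  rw [h2, h1, Matrix.mul_zero, Matrix.zero_mul]

/-- A matrix which is positive definite with respect to `G` has a square root which is so. -/
theorem exists_sqrt_of_posDef_mul {M G : Matrix n n ℂ} (hG : G.PosDef) (hM : (M * G).PosDef) :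
    ∃ S : Matrix n n ℂ, S * S = M ∧ (S * G).PosDef := by
  obtain ⟨D, hD, hGD⟩ := exists_factor_of_posDef hG
  have hdet := (isUnit_iff_isUnit_det _).1 hD
  have hP : (D⁻¹ * M * D).PosDef := by
    rw [conj_factor hD hGD]
    refine hM.mul_mul_conjTranspose_same ?_
    rw [vecMul_injective_iff_isUnit]
    exact isUnit_nonsing_inv_iff.2 hD
  open scoped MatrixOrder in
  have hR0 : (CFC.sqrt (D⁻¹ * M * D)).PosSemidef := (CFC.sqrt_nonneg _).posSemidef
  have hRR : CFC.sqrt (D⁻¹ * M * D) * CFC.sqrt (D⁻¹ * M * D) = D⁻¹ * M * D :=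
    CFC.sqrt_mul_sqrt_self _ hP.posSemidef.nonneg
  set R := CFC.sqrt (D⁻¹ * M * D) with hRdef
  have hR : R.PosDef := by
    rw [hR0.posDef_iff_isUnit]
    exact isUnit_of_mul_isUnit_left (hRR ▸ hP.isUnit)
  refine ⟨D * R * D⁻¹, ?_, ?_⟩
  · calc D * R * D⁻¹ * (D * R * D⁻¹) = D * (R * R) * D⁻¹ := by
          simp only [Matrix.mul_assoc]
          rw [Matrix.nonsing_inv_mul_cancel_left _ _ hdet]
      _ = M := by
          rw [hRR]
          simp only [Matrix.mul_assoc, Matrix.mul_nonsing_inv _ hdet, Matrix.mul_one]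
          rw [Matrix.mul_nonsing_inv_cancel_left _ _ hdet]
  · have : D * R * D⁻¹ * G = D * R * Dᴴ := by
      rw [hGD]
      simp only [Matrix.mul_assoc]
      rw [Matrix.nonsing_inv_mul_cancel_left _ _ hdet]
    rw [this]
    refine hR.mul_mul_conjTranspose_same ?_
    rw [vecMul_injective_iff_isUnit]
    exact hD

open scoped Matrix.Norms.Operator

omit [DecidableEq n] in
theorem isOpen_setOf_rePos : IsOpen {A : Matrix n n ℂ | RePos A} := by
  refine isOpen_forall_pos (Q := fun (A : Matrix n n ℂ) (x : n → ℂ) => (Star.star x ⬝ᵥ (A *ᵥ x)).re) ?_ ?_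
  · refine Complex.continuous_re.comp ?_
    have h1 : Continuous fun p : Matrix n n ℂ × (n → ℂ) => p.1 *ᵥ p.2 :=
      Continuous.matrix_mulVec continuous_fst continuous_snd
    exact Continuous.dotProduct (continuous_snd.star) h1
  · intro A c x
    have : (c • x) = (c : ℂ) • x := (Complex.coe_smul c x).symm
    rw [this, mulVec_smul, star_smul, smul_dotProduct, dotProduct_smul]
    simp only [Complex.star_def, Complex.conj_ofReal, smul_eq_mul, Complex.re_ofReal_mul]
    ring

section Entries

variable {V : Type*} [NormedAddCommGroup V] [NormedSpace ℝ V]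

omit [DecidableEq n] in
/-- An entry of a matrix, as a continuous linear map. -/
def entryL (i j : n) : Matrix n n ℂ →L[ℝ] ℂ :=
  LinearMap.toContinuousLinearMap (Matrix.entryLinearMap ℝ ℂ i j)

omit [DecidableEq n] in
/-- Assembling a matrix of its entries, as a continuous linear map. -/
def ofL : (n → n → ℂ) →L[ℝ] Matrix n n ℂ :=
  LinearMap.toContinuousLinearMap
    (Matrix.ofLinearEquiv ℝ : (n → n → ℂ) ≃ₗ[ℝ] Matrix n n ℂ).toLinearMap

omit [DecidableEq n] in
theorem contDiffAt_matrix {m : WithTop ℕ∞} {f : V → Matrix n n ℂ} {x : V} :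
    ContDiffAt ℝ m f x ↔ ∀ i j, ContDiffAt ℝ m (fun y => f y i j) x := by
  refine ⟨fun h i j => (entryL i j).contDiff.contDiffAt.comp x h, fun h => ?_⟩
  have h1 : ContDiffAt ℝ m (fun y => fun i j => f y i j) x :=
    contDiffAt_pi.2 fun i => contDiffAt_pi.2 fun j => h i j
  exact (ofL (n := n)).contDiff.contDiffAt.comp x h1

omit [DecidableEq n] in
theorem hasDerivAt_matrix {f : ℝ → Matrix n n ℂ} {f' : Matrix n n ℂ} {x : ℝ} :
    HasDerivAt f f' x ↔ ∀ i j, HasDerivAt (fun t => f t i j) (f' i j) x := by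
  refine ⟨fun h i j => (entryL i j).hasFDerivAt.comp_hasDerivAt x h, fun h => ?_⟩
  have h1 : HasDerivAt (fun t => fun i j => f t i j) (fun i j => f' i j) x :=
    hasDerivAt_pi.2 fun i => hasDerivAt_pi.2 fun j => h i j
  exact (ofL (n := n)).hasFDerivAt.comp_hasDerivAt x h1

omit [DecidableEq n] in
theorem smoothFamily_matrix {U : Set V} {f : ℝ → V → Matrix n n ℂ} {f' : V → Matrix n n ℂ} :
    SmoothFamily U f f' ↔ ∀ i j, SmoothFamily U (fun t y => f t y i j) (fun y => f' y i j) :=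
  ⟨fun h i j y hy => ⟨contDiffAt_matrix.1 (h y hy).1 i j, hasDerivAt_matrix.1 (h y hy).2 i j⟩,
    fun h y hy => ⟨contDiffAt_matrix.2 fun i j => (h i j y hy).1,
      hasDerivAt_matrix.2 fun i j => (h i j y hy).2⟩⟩

/-- A square root which is positive with respect to a smooth hermitian form is smooth. -/
theorem contDiffAt_sqrt {m : WithTop ℕ∞} (hm : m ≠ 0) {M S G : V → Matrix n n ℂ} {x : V}
    (hM : ContDiffAt ℝ m M x) (hGc : ContinuousAt G x)
    (hG : ∀ᶠ y in nhds x, (G y).PosDef) (hS : ∀ᶠ y in nhds x, (S y * G y).PosDef)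
    (hSS : ∀ᶠ y in nhds x, S y * S y = M y) : ContDiffAt ℝ m S x := by
  set S₀ := S x with hS₀
  have hG0 := hG.self_of_nhds
  have hS0 := hS.self_of_nhds
  let T : Matrix n n ℂ →ₗ[ℝ] Matrix n n ℂ :=
    LinearMap.mulLeft ℝ S₀ + LinearMap.mulRight ℝ S₀
  have hT : Function.Injective T := by
    rw [← LinearMap.ker_eq_bot, LinearMap.ker_eq_bot']
    intro X hX
    exact eq_zero_of_sylvester hG0 (rePos_of_posDef hS0) (rePos_of_posDef hS0) hX
  let T' : Matrix n n ℂ ≃L[ℝ] Matrix n n ℂ :=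
    (LinearEquiv.ofInjectiveEndo T hT).toContinuousLinearEquiv
  have hsq : ContDiffAt ℝ m (fun X : Matrix n n ℂ => X * X) S₀ := contDiffAt_id.mul contDiffAt_id
  have hsq' : HasFDerivAt (fun X : Matrix n n ℂ => X * X)
      (T' : Matrix n n ℂ →L[ℝ] Matrix n n ℂ) S₀ := by
    have h1 := (hasFDerivAt_id (𝕜 := ℝ) S₀).mul' (hasFDerivAt_id (𝕜 := ℝ) S₀)
    refine h1.congr_fderiv ?_
    ext1 X
    rfl
  set σ := hsq.localInverse hsq' hm with hσ
  have hσc : ContDiffAt ℝ m σ (S₀ * S₀) := hsq.to_localInverse hsq' hm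
  have hx : S₀ * S₀ = M x := hSS.self_of_nhds
  have hσ0 : σ (M x) = S₀ := by
    rw [← hx]
    exact hsq.localInverse_apply_image hsq' hm
  have hcomp : ContDiffAt ℝ m (fun y => σ (M y)) x := by
    rw [hx] at hσc
    exact ContDiffAt.comp (g := σ) x hσc hM
  have hright : ∀ᶠ Y in nhds (M x), σ Y * σ Y = Y := by
    have := (hsq.hasStrictFDerivAt' hsq' hm).eventually_right_inverse
    rw [← hx]
    exact this
  have hpos : ∀ᶠ y in nhds x, RePos (σ (M y) * G y) := by
    have hc : ContinuousAt (fun y => σ (M y) * G y) x := hcomp.continuousAt.mul hGc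
    refine hc.eventually (isOpen_setOf_rePos.mem_nhds ?_)
    change RePos (σ (M x) * G x)
    simp only [hσ0]
    exact rePos_of_posDef hS0
  refine hcomp.congr_of_eventuallyEq ?_
  filter_upwards [hpos, hG, hS, hSS, hM.continuousAt.eventually hright] with y h1 h2 h3 h4 h5
  have h6 : σ (M y) * (σ (M y) - S y) + (σ (M y) - S y) * S y = 0 := by
    rw [mul_sub, sub_mul, h5, h4]
    abel
  exact (sub_eq_zero.1 (eq_zero_of_sylvester h2 h1 (rePos_of_posDef h3) h6)).symm

end Entries

/-! ### The exponential -/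

theorem det_exp_of_isHermitian {A : Matrix n n ℂ}
    (hA : A.IsHermitian) : (NormedSpace.exp A).det = Complex.exp A.trace := by
  have h := hA.spectral_theorem
  rw [Unitary.conjStarAlgAut_apply] at h
  set U : Matrix n n ℂ := (hA.eigenvectorUnitary : Matrix n n ℂ) with hU
  have hUU : U * Star.star U = 1 := Unitary.mul_star_self_of_mem hA.eigenvectorUnitary.2
  have hinv : Star.star U = U⁻¹ := (Matrix.inv_eq_right_inv hUU).symm
  have hunit : IsUnit U := IsUnit.of_mul_eq_one _ hUU
  have hdet := (isUnit_iff_isUnit_det _).1 hunit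
  have h' : A = U * diagonal (fun i => (hA.eigenvalues i : ℂ)) * U⁻¹ := by
    rw [← hinv]; exact h
  have htr : A.trace = ∑ i, (hA.eigenvalues i : ℂ) := hA.trace_eq_sum_eigenvalues
  have hexp : NormedSpace.exp A
      = U * diagonal (fun i => Complex.exp (hA.eigenvalues i : ℂ)) * U⁻¹ := by
    conv_lhs => rw [h']
    rw [Matrix.exp_conj _ _ hunit, Matrix.exp_diagonal]
    congr 3
    funext i
    rw [Pi.coe_exp, Complex.exp_eq_exp_ℂ]
  rw [hexp, htr, Complex.exp_sum, det_mul, det_mul, det_diagonal, mul_right_comm, ← det_mul,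
    Matrix.mul_nonsing_inv _ hdet, det_one, one_mul]

/-- `det (exp A) = exp (tr A)` if `A` is hermitian with respect to `G`. -/
theorem det_exp_of_isHermitian_mul {A G : Matrix n n ℂ} (hG : G.PosDef)
    (hA : (A * G).IsHermitian) : (NormedSpace.exp A).det = Complex.exp A.trace := by
  obtain ⟨D, hD, hGD⟩ := exists_factor_of_posDef hG
  have hdet := (isUnit_iff_isUnit_det _).1 hD
  have hP : (D⁻¹ * A * D).IsHermitian := by
    rw [conj_factor hD hGD]
    exact isHermitian_mul_mul_conjTranspose _ hA
  have h1 := det_exp_of_isHermitian hP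
  rw [Matrix.exp_conj' _ _ hD, det_mul, det_mul, mul_right_comm, ← det_mul,
    Matrix.nonsing_inv_mul _ hdet, det_one, one_mul, trace_mul_comm, ← Matrix.mul_assoc,
    Matrix.mul_nonsing_inv _ hdet, Matrix.one_mul] at h1
  exact h1

theorem exp_mul_of_isHermitian_mul {A G : Matrix n n ℂ} (hG : G.PosDef)
    (hA : (A * G).IsHermitian) : NormedSpace.exp A * G = G * (NormedSpace.exp A)ᴴ := by
  have hdet := (isUnit_iff_isUnit_det _).1 hG.isUnit
  have h1 : Aᴴ = G⁻¹ * A * G := by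
    have h2 : G * Aᴴ = A * G := by
      have := hA.eq
      rwa [conjTranspose_mul, hG.isHermitian.eq] at this
    rw [Matrix.mul_assoc, ← h2, Matrix.nonsing_inv_mul_cancel_left _ _ hdet]
  rw [← Matrix.exp_conjTranspose, h1, Matrix.exp_conj' _ _ hG.isUnit, ← Matrix.mul_assoc,
    ← Matrix.mul_assoc, Matrix.mul_nonsing_inv _ hdet, Matrix.one_mul]

end Matrices

end Strominger

end

noncomputable section

namespace Strominger

/-! ## Forms of low degree and their derivatives -/

theorem cform_one_ext {α β : CForm 1} (h : ∀ v, α (fun _ => v) = β (fun _ => v)) : α = β := by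
  ext v
  have : v = fun _ => v 0 := by
    funext i
    rw [Subsingleton.elim i 0]
  rw [this]
  exact h _

theorem cform_two_ext {α β : CForm 2} (h : ∀ u v, α ![u, v] = β ![u, v]) : α = β := by
  ext v
  have : v = ![v 0, v 1] := by
    funext i
    fin_cases i <;> rfl
  rw [this]
  exact h _ _

/-- One-forms as linear maps. -/
def oneFormL (α : CForm 1) : C3 →ₗ[ℝ] ℂ where
  toFun v := α (fun _ => v)
  map_add' x y := by
    have h : ∀ x : C3, Function.update (fun _ : Fin 1 => (0 : C3)) 0 x = fun _ => x := by
      intro x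
      funext i
      rw [Subsingleton.elim i 0, Function.update_self]
    have := α.map_update_add (fun _ => (0 : C3)) 0 x y
    rwa [h, h, h] at this
  map_smul' c x := by
    have h : ∀ x : C3, Function.update (fun _ : Fin 1 => (0 : C3)) 0 x = fun _ => x := by
      intro x
      funext i
      rw [Subsingleton.elim i 0, Function.update_self]
    have := α.map_update_smul (fun _ => (0 : C3)) 0 c x
    rwa [h, h] at this

theorem univ_perm_two : (Finset.univ : Finset (Equiv.Perm (Fin 2))) = {1, Equiv.swap 0 1} := by
  decide

theorem wedge_one_one (α β : CForm 1) (u v : C3) :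
    wedge α β ![u, v] = α (fun _ => u) * β (fun _ => v) - α (fun _ => v) * β (fun _ => u) := by
  have h : ∀ (w : Fin 2 → C3), wedge α β w =
      ∑ σ : Equiv.Perm (Fin 2), Equiv.Perm.sign σ •
        (α (fun _ => w (σ 0)) * β (fun _ => w (σ 1))) := by
    intro w
    refine (wedge_apply α β w).trans ?_
    rw [show ((Nat.factorial 1 * Nat.factorial 1 : ℕ) : ℂ)⁻¹ = 1 by simp, one_mul]
    refine Finset.sum_congr rfl fun σ _ => congrArg (Equiv.Perm.sign σ • ·) ?_
    congr 2 <;> (funext i; rw [Subsingleton.elim i 0]; rfl)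
  rw [h, univ_perm_two, Finset.sum_pair (by decide)]
  simp [sub_eq_add_neg]

/-- Antisymmetrization of the derivative of a form. -/
def extL (k : ℕ) : (C3 →L[ℝ] CForm k) →L[ℝ] CForm (k + 1) :=
  ContinuousAlternatingMap.alternatizeUncurryFinCLM ℝ C3 ℂ

/-- `∂` of a form in terms of its derivative. -/
def delL (k : ℕ) : (C3 →L[ℝ] CForm k) →L[ℝ] CForm (k + 1) :=
  LinearMap.toContinuousLinearMap
    { toFun := fun f : C3 →L[ℝ] CForm k => ContinuousAlternatingMap.alternatizeUncurryFin
        ((2 : ℝ)⁻¹ • (f - Complex.I • f.comp mulI))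
      map_add' := fun f g => by
        rw [← ContinuousAlternatingMap.alternatizeUncurryFin_add]
        congr 1
        ext v w
        simp
        ring
      map_smul' := fun c f => by
        rw [RingHom.id_apply, ← ContinuousAlternatingMap.alternatizeUncurryFin_smul]
        congr 1
        ext v w
        simp
        ring }

/-- `∂̄` of a form in terms of its derivative. -/
def delbarL (k : ℕ) : (C3 →L[ℝ] CForm k) →L[ℝ] CForm (k + 1) :=
  LinearMap.toContinuousLinearMap
    { toFun := fun f : C3 →L[ℝ] CForm k => ContinuousAlternatingMap.alternatizeUncurryFin
        ((2 : ℝ)⁻¹ • (f + Complex.I • f.comp mulI))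
      map_add' := fun f g => by
        rw [← ContinuousAlternatingMap.alternatizeUncurryFin_add]
        congr 1
        ext v w
        simp
        ring
      map_smul' := fun c f => by
        rw [RingHom.id_apply, ← ContinuousAlternatingMap.alternatizeUncurryFin_smul]
        congr 1
        ext v w
        simp
        ring }

theorem extDeriv_eq {k : ℕ} (α : C3 → CForm k) (z : C3) :
    extDeriv α z = extL k (fderiv ℝ α z) := rfl

theorem extDeriv_eq_add {k : ℕ} (α : C3 → CForm k) (z : C3) :
    extDeriv α z = del α z + delbar α z := by
  rw [del, delbar, extDeriv, ← ContinuousAlternatingMap.alternatizeUncurryFin_add]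
  congr 1
  ext v w
  simp
  ring

section FormFamilies

variable {U : Set C3} {k : ℕ} {f : ℝ → C3 → CForm k} {f' : C3 → CForm k}

theorem SmoothFamily.del (hU : IsOpen U) (h : SmoothFamily U f f') :
    SmoothFamily U (fun t => Strominger.del (f t)) (Strominger.del f') :=
  (h.spaceDeriv hU).clm (delL k)

theorem SmoothFamily.delbar (hU : IsOpen U) (h : SmoothFamily U f f') :
    SmoothFamily U (fun t => Strominger.delbar (f t)) (Strominger.delbar f') :=
  (h.spaceDeriv hU).clm (delbarL k)

theorem SmoothFamily.extDeriv (hU : IsOpen U) (h : SmoothFamily U f f') :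
    SmoothFamily U (fun t => _root_.extDeriv (f t)) (_root_.extDeriv f') :=
  (h.spaceDeriv hU).clm (extL k)

/-- Multiplication of forms by complex numbers, as a continuous bilinear map. -/
def smulL (k : ℕ) : ℂ →L[ℝ] CForm k →L[ℝ] CForm k := ContinuousLinearMap.lsmul ℝ ℂ

theorem SmoothFamily.dc (hU : IsOpen U) (h : SmoothFamily U f f') :
    SmoothFamily U (fun t => Strominger.dc (f t)) (Strominger.dc f') :=
  ((h.delbar hU).sub (h.del hU)).clm (smulL _ Complex.I)

theorem SmoothFamily.const_smul (c : ℂ) (h : SmoothFamily U f f') :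
    SmoothFamily U (fun t y => c • f t y) (fun y => c • f' y) := h.clm (smulL _ c)

theorem SmoothFamily.smul {g : ℝ → C3 → ℂ} {g' : C3 → ℂ} (hg : SmoothFamily U g g')
    (h : SmoothFamily U f f') : SmoothFamily U (fun t y => g t y • f t y)
      (fun y => g 0 y • f' y + g' y • f 0 y) := hg.bilin (smulL k) h

theorem SmoothFamily.wedge {l : ℕ} {g : ℝ → C3 → CForm l} {g' : C3 → CForm l}
    (h : SmoothFamily U f f') (hg : SmoothFamily U g g') :
    SmoothFamily U (fun t y => Strominger.wedge (f t y) (g t y))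
      (fun y => Strominger.wedge (f 0 y) (g' y) + Strominger.wedge (f' y) (g 0 y)) :=
  h.bilin (wedgeL k l) hg

end FormFamilies

/-- Functions as 0-forms, as a continuous linear map. -/
def zeroFormL : ℂ →L[ℝ] CForm 0 :=
  LinearMap.toContinuousLinearMap
    { toFun := fun c => ContinuousAlternatingMap.constOfIsEmpty ℝ C3 (Fin 0) c
      map_add' := fun _ _ => rfl
      map_smul' := fun _ _ => rfl }

@[simp] theorem zeroFormL_apply (c : ℂ) (v : Fin 0 → C3) : zeroFormL c v = c := rfl

/-! ## Matrix valued functions -/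

open Matrix
open scoped Matrix.Norms.Operator

section MatrixFunctions

variable {r : ℕ} {A B G : C3 → Matrix (Fin r) (Fin r) ℂ} {z : C3}

/-- The matrix of values of a matrix of forms. -/
def mval {k : ℕ} (T : MForm r k) (v : Fin k → C3) : Matrix (Fin r) (Fin r) ℂ := fun i j => T i j v

@[simp] theorem mval_lmul {k : ℕ} (A : Matrix (Fin r) (Fin r) ℂ) (T : MForm r k) (v : Fin k → C3) :
    mval (lmul A T) v = A * mval T v := by
  ext i j
  simp [mval, lmul, Matrix.mul_apply]

@[simp] theorem mval_rmul {k : ℕ} (A : Matrix (Fin r) (Fin r) ℂ) (T : MForm r k) (v : Fin k → C3) :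
    mval (rmul T A) v = mval T v * A := by
  ext i j
  simp [mval, rmul, Matrix.mul_apply, mul_comm]

@[simp] theorem mval_add {k : ℕ} (S T : MForm r k) (v : Fin k → C3) :
    mval (S + T) v = mval S v + mval T v := rfl

@[simp] theorem mval_sub {k : ℕ} (S T : MForm r k) (v : Fin k → C3) :
    mval (S - T) v = mval S v - mval T v := rfl

theorem mval_mwedge (S T : MForm r 1) (u v : C3) : mval (mwedge S T) ![u, v] =
    mval S (fun _ => u) * mval T (fun _ => v) - mval S (fun _ => v) * mval T (fun _ => u) := by
  ext i j
  simp [mval, mwedge, Matrix.mul_apply, wedge_one_one]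

theorem mform_one_ext {S T : MForm r 1} (h : ∀ v, mval S (fun _ => v) = mval T (fun _ => v)) :
    S = T := by
  ext1 i j
  exact cform_one_ext fun v => congrFun (congrFun (h v) i) j

theorem mform_two_ext {S T : MForm r 2} (h : ∀ u v, mval S ![u, v] = mval T ![u, v]) :
    S = T := by
  ext1 i j
  exact cform_two_ext fun u v => congrFun (congrFun (h u v) i) j

/-- The complex linear part of the derivative. -/
def pdel (A : C3 → Matrix (Fin r) (Fin r) ℂ) (z v : C3) : Matrix (Fin r) (Fin r) ℂ :=
  (2 : ℂ)⁻¹ • (fderiv ℝ A z v - Complex.I • fderiv ℝ A z (Complex.I • v))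

/-- The complex antilinear part of the derivative. -/
def pdelbar (A : C3 → Matrix (Fin r) (Fin r) ℂ) (z v : C3) : Matrix (Fin r) (Fin r) ℂ :=
  (2 : ℂ)⁻¹ • (fderiv ℝ A z v + Complex.I • fderiv ℝ A z (Complex.I • v))

theorem fderiv_matrix_apply (hA : DifferentiableAt ℝ A z) (v : C3) (i j : Fin r) :
    fderiv ℝ A z v i j = fderiv ℝ (fun y => A y i j) z v := by
  have : HasFDerivAt (fun y => A y i j) ((entryL i j).comp (fderiv ℝ A z)) z :=
    (entryL i j).hasFDerivAt.comp z hA.hasFDerivAt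
  rw [this.fderiv]
  rfl

theorem mval_mdel (hA : DifferentiableAt ℝ A z) (v : C3) :
    mval (mdel A z) (fun _ => v) = pdel A z v := by
  ext i j
  have hd : DifferentiableAt ℝ (fun y => A y i j) z :=
    (entryL i j).differentiableAt.comp z hA
  have : HasFDerivAt (zeroForm fun y => A y i j)
      (zeroFormL.comp (fderiv ℝ (fun y => A y i j) z)) z :=
    zeroFormL.hasFDerivAt.comp z hd.hasFDerivAt
  simp only [mval, mdel, del, this.fderiv, pdel, Matrix.smul_apply, Matrix.sub_apply,
    fderiv_matrix_apply hA, ContinuousAlternatingMap.alternatizeUncurryFin_apply]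
  simp [mulI]

theorem mval_mdelbarZero (hA : DifferentiableAt ℝ A z) (v : C3) :
    mval (mdelbarZero A z) (fun _ => v) = pdelbar A z v := by
  ext i j
  have hd : DifferentiableAt ℝ (fun y => A y i j) z :=
    (entryL i j).differentiableAt.comp z hA
  have : HasFDerivAt (zeroForm fun y => A y i j)
      (zeroFormL.comp (fderiv ℝ (fun y => A y i j) z)) z :=
    zeroFormL.hasFDerivAt.comp z hd.hasFDerivAt
  simp only [mval, mdelbarZero, delbar, this.fderiv, pdelbar, Matrix.smul_apply, Matrix.add_apply,
    fderiv_matrix_apply hA, ContinuousAlternatingMap.alternatizeUncurryFin_apply]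
  simp [mulI, mul_add]

theorem fderiv_matrix_mul (hA : DifferentiableAt ℝ A z) (hB : DifferentiableAt ℝ B z) (v : C3) :
    fderiv ℝ (fun y => A y * B y) z v = fderiv ℝ A z v * B z + A z * fderiv ℝ B z v := by
  have h : HasFDerivAt (fun y => A y * B y) _ z := hA.hasFDerivAt.mul' hB.hasFDerivAt
  rw [h.fderiv, add_comm]
  rfl

theorem pdel_mul (hA : DifferentiableAt ℝ A z) (hB : DifferentiableAt ℝ B z) (v : C3) :
    pdel (fun y => A y * B y) z v = pdel A z v * B z + A z * pdel B z v := by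
  simp only [pdel, fderiv_matrix_mul hA hB, Matrix.smul_mul, Matrix.mul_smul, Matrix.sub_mul,
    Matrix.mul_sub, smul_add, smul_sub]
  abel

theorem pdelbar_mul (hA : DifferentiableAt ℝ A z) (hB : DifferentiableAt ℝ B z) (v : C3) :
    pdelbar (fun y => A y * B y) z v = pdelbar A z v * B z + A z * pdelbar B z v := by
  simp only [pdelbar, fderiv_matrix_mul hA hB, Matrix.smul_mul, Matrix.mul_smul, Matrix.add_mul,
    Matrix.mul_add, smul_add]
  abel

theorem contDiffAt_matrix_inv {n : Type*} [Fintype n] [DecidableEq n] {V : Type*} [NormedAddCommGroup V] [NormedSpace ℝ V]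
    {m : WithTop ℕ∞} {A : V → Matrix n n ℂ} {z : V}
    (hA : ContDiffAt ℝ m A z) (hu : IsUnit (A z)) : ContDiffAt ℝ m (fun y => (A y)⁻¹) z := by
  simp only [Matrix.nonsing_inv_eq_ringInverse]
  obtain ⟨x, hx⟩ := hu
  have := contDiffAt_ringInverse ℝ (n := m) x
  rw [hx] at this
  exact ContDiffAt.comp (g := Ring.inverse) z this hA

theorem eventually_isUnit {n : Type*} [Fintype n] [DecidableEq n] {V : Type*} [TopologicalSpace V] {A : V → Matrix n n ℂ}
    {z : V} (hA : ContinuousAt A z) (hu : IsUnit (A z)) : ∀ᶠ y in nhds z, IsUnit (A y) :=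
  hA.eventually (Units.isOpen.mem_nhds hu)

theorem pdel_congr (h : A =ᶠ[nhds z] B) (v : C3) : pdel A z v = pdel B z v := by
  simp only [pdel, h.fderiv_eq]

theorem pdelbar_congr (h : A =ᶠ[nhds z] B) (v : C3) : pdelbar A z v = pdelbar B z v := by
  simp only [pdelbar, h.fderiv_eq]

theorem pdel_const (C : Matrix (Fin r) (Fin r) ℂ) (v : C3) : pdel (fun _ => C) z v = 0 := by
  simp [pdel]

theorem pdelbar_const (C : Matrix (Fin r) (Fin r) ℂ) (v : C3) : pdelbar (fun _ => C) z v = 0 := by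
  simp [pdelbar]

theorem inv_mul_eventually_eq_one (hA : ContinuousAt A z) (hu : IsUnit (A z)) :
    (fun y => (A y)⁻¹ * A y) =ᶠ[nhds z] fun _ => 1 := by
  filter_upwards [eventually_isUnit hA hu] with y hy
  exact Matrix.nonsing_inv_mul _ ((isUnit_iff_isUnit_det _).1 hy)

theorem eq_neg_of_derivation {n : Type*} [Fintype n] [DecidableEq n] {P Q A : Matrix n n ℂ} (hu : IsUnit A)
    (h : P * A + A⁻¹ * Q = 0) : P = -(A⁻¹ * Q * A⁻¹) := by
  have hd := (isUnit_iff_isUnit_det _).1 hu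
  have h1 : P * A = -(A⁻¹ * Q) := eq_neg_of_add_eq_zero_left h
  calc P = P * A * A⁻¹ := by rw [Matrix.mul_assoc, Matrix.mul_nonsing_inv _ hd, Matrix.mul_one]
    _ = _ := by rw [h1, Matrix.neg_mul]

theorem pdel_inv (hA : ContDiffAt ℝ 1 A z) (hu : IsUnit (A z)) (v : C3) :
    pdel (fun y => (A y)⁻¹) z v = -((A z)⁻¹ * pdel A z v * (A z)⁻¹) := by
  refine eq_neg_of_derivation hu ?_
  have h := pdel_mul ((contDiffAt_matrix_inv hA hu).differentiableAt (by simp))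
    (hA.differentiableAt (by simp)) v
  rw [← h, pdel_congr (inv_mul_eventually_eq_one hA.continuousAt hu), pdel_const]

theorem pdelbar_inv (hA : ContDiffAt ℝ 1 A z) (hu : IsUnit (A z)) (v : C3) :
    pdelbar (fun y => (A y)⁻¹) z v = -((A z)⁻¹ * pdelbar A z v * (A z)⁻¹) := by
  refine eq_neg_of_derivation hu ?_
  have h := pdelbar_mul ((contDiffAt_matrix_inv hA hu).differentiableAt (by simp))
    (hA.differentiableAt (by simp)) v
  rw [← h, pdelbar_congr (inv_mul_eventually_eq_one hA.continuousAt hu), pdelbar_const]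

/-! ### The Chern connection -/

theorem mval_chernConn (hG : DifferentiableAt ℝ G z) (v : C3) :
    mval (chernConn G z) (fun _ => v) = pdel G z v * (G z)⁻¹ := by
  rw [chernConn, mval_rmul, mval_mdel hG]

theorem mval_dprime (hG : DifferentiableAt ℝ G z) (hA : DifferentiableAt ℝ A z) (v : C3) :
    mval (dprime G A z) (fun _ => v)
      = pdel A z v + A z * (pdel G z v * (G z)⁻¹) - pdel G z v * (G z)⁻¹ * A z := by
  rw [dprime, mval_sub, mval_add, mval_lmul, mval_rmul, mval_mdel hA, mval_chernConn hG]

/-- A matrix of one-forms is smooth if its values are. -/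
theorem contDiffAt_mform_one {m : WithTop ℕ∞} {T : C3 → MForm r 1} {z : C3}
    (h : ∀ v, ContDiffAt ℝ m (fun y => mval (T y) (fun _ => v)) z) (i j : Fin r) :
    ContDiffAt ℝ m (fun y => T y i j) z := by
  let e : CForm 1 →ₗ[ℝ] ((Fin 3 × Fin 2) → ℂ) :=
    { toFun := fun α a => α (fun _ => realBasis a)
      map_add' := fun _ _ => rfl
      map_smul' := fun _ _ => rfl }
  have he : Function.Injective e := by
    intro α β hαβ
    refine cform_one_ext fun v => ?_
    have hv : v = ∑ a : Fin 3, ((v a).re • realBasis (a, 0) + (v a).im • realBasis (a, 1)) := by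
      funext b
      simp [realBasis, Finset.sum_apply, Pi.single_apply, Finset.sum_add_distrib, Complex.re_add_im]
    have key : ∀ γ : CForm 1, oneFormL γ v =
        ∑ a : Fin 3, ((v a).re • e γ (a, 0) + (v a).im • e γ (a, 1)) := by
      intro γ
      conv_lhs => rw [hv]
      simp only [map_sum, map_add, map_smul]
      rfl
    exact (key α).trans (hαβ ▸ (key β).symm)
  obtain ⟨g, hg⟩ := LinearMap.exists_leftInverse_of_injective e (LinearMap.ker_eq_bot.2 he)
  have h1 : (fun y => T y i j) = fun y =>
      LinearMap.toContinuousLinearMap g (fun a => mval (T y) (fun _ => realBasis a) i j) := by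
    funext y
    exact (LinearMap.congr_fun hg (T y i j)).symm
  rw [h1]
  refine ContDiffAt.comp z (LinearMap.toContinuousLinearMap g).contDiff.contDiffAt ?_
  exact contDiffAt_pi.2 fun a => contDiffAt_matrix.1 (h (realBasis a)) i j

end MatrixFunctions

end Strominger

end

noncomputable section

namespace Strominger

open Matrix
open scoped Matrix.Norms.Operator

section Curvature

variable {r : ℕ} {G : C3 → Matrix (Fin r) (Fin r) ℂ} {z : C3}

/-! ### Curvature -/

/-- Evaluation of one-forms, as a continuous linear map. -/
def evalOne (v : C3) : CForm 1 →L[ℝ] ℂ :=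
  LinearMap.toContinuousLinearMap
    { toFun := fun α => α (fun _ => v)
      map_add' := fun _ _ => rfl
      map_smul' := fun _ _ => rfl }

theorem fderiv_one_apply {α : C3 → CForm 1} (hα : DifferentiableAt ℝ α z) (u v : C3) :
    fderiv ℝ α z u (fun _ => v) = fderiv ℝ (fun y => α y (fun _ => v)) z u := by
  have : HasFDerivAt (fun y => α y (fun _ => v)) ((evalOne v).comp (fderiv ℝ α z)) z :=
    (evalOne v).hasFDerivAt.comp z hα.hasFDerivAt
  rw [this.fderiv]
  rfl

theorem removeNth_zero_two (u v : C3) : Fin.removeNth 0 ![u, v] = fun _ => v := by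
  funext i
  rw [Subsingleton.elim i 0]
  rfl

theorem removeNth_one_two (u v : C3) : Fin.removeNth 1 ![u, v] = fun _ => u := by
  funext i
  rw [Subsingleton.elim i 0]
  rfl

theorem alternatize_two (f : C3 →L[ℝ] CForm 1) (u v : C3) :
    ContinuousAlternatingMap.alternatizeUncurryFin f ![u, v]
      = f u (fun _ => v) - f v (fun _ => u) := by
  rw [ContinuousAlternatingMap.alternatizeUncurryFin_apply, Fin.sum_univ_two, removeNth_zero_two,
    removeNth_one_two]
  simp [sub_eq_add_neg]

/-- `∂` of a matrix of forms. -/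
def mdelForm {k : ℕ} (T : C3 → MForm r k) (z : C3) : MForm r (k + 1) :=
  fun i j => del (fun y => T y i j) z

theorem mval_mdelForm {T : C3 → MForm r 1} (hT : ∀ i j, DifferentiableAt ℝ (fun y => T y i j) z)
    (hT' : ∀ v, DifferentiableAt ℝ (fun y => mval (T y) (fun _ => v)) z) (u v : C3) :
    mval (k := 2) (mdelForm T z) ![u, v]
      = pdel (fun y => mval (T y) (fun _ => v)) z u
        - pdel (fun y => mval (T y) (fun _ => u)) z v := by
  ext i j
  have h1 : ∀ u v : C3, fderiv ℝ (fun y => T y i j) z u (fun _ => v)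
      = fderiv ℝ (fun y => mval (T y) (fun _ => v)) z u i j := by
    intro u v
    rw [fderiv_one_apply (hT i j), fderiv_matrix_apply (hT' v)]
    rfl
  simp only [mval, mdelForm, del]
  rw [alternatize_two]
  simp only [_root_.smul_apply, _root_.sub_apply,
    ContinuousLinearMap.comp_apply, ContinuousAlternatingMap.smul_apply,
    ContinuousAlternatingMap.sub_apply, h1, pdel, Matrix.sub_apply, Matrix.smul_apply]
  simp [mulI]

theorem mval_mdelbar {T : C3 → MForm r 1} (hT : ∀ i j, DifferentiableAt ℝ (fun y => T y i j) z)
    (hT' : ∀ v, DifferentiableAt ℝ (fun y => mval (T y) (fun _ => v)) z) (u v : C3) :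
    mval (k := 2) (mdelbar T z) ![u, v]
      = pdelbar (fun y => mval (T y) (fun _ => v)) z u
        - pdelbar (fun y => mval (T y) (fun _ => u)) z v := by
  ext i j
  have h1 : ∀ u v : C3, fderiv ℝ (fun y => T y i j) z u (fun _ => v)
      = fderiv ℝ (fun y => mval (T y) (fun _ => v)) z u i j := by
    intro u v
    rw [fderiv_one_apply (hT i j), fderiv_matrix_apply (hT' v)]
    rfl
  simp only [mval, mdelbar, delbar]
  rw [alternatize_two]
  simp only [_root_.smul_apply, _root_.add_apply,
    ContinuousLinearMap.comp_apply, ContinuousAlternatingMap.smul_apply,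
    ContinuousAlternatingMap.add_apply, h1, pdelbar, Matrix.sub_apply, Matrix.smul_apply,
    Matrix.add_apply]
  simp [mulI, mul_add]

theorem contDiffAt_pdel {m m' : WithTop ℕ∞} (hm : m + 1 ≤ m') (hG : ContDiffAt ℝ m' G z)
    (v : C3) : ContDiffAt ℝ m (fun y => pdel G y v) z := by
  have h := hG.fderiv_right hm
  exact ((h.clm_apply contDiffAt_const).sub
    ((h.clm_apply contDiffAt_const).const_smul Complex.I)).const_smul _

theorem pdel_pdel_symm (hG : ContDiffAt ℝ 2 G z) (u v : C3) :
    pdel (fun y => pdel G y v) z u = pdel (fun y => pdel G y u) z v := by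
  have hd : DifferentiableAt ℝ (fderiv ℝ G) z :=
    (hG.fderiv_right (m := 1) (by norm_num)).differentiableAt (by simp)
  have hs : IsSymmSndFDerivAt ℝ G z := hG.isSymmSndFDerivAt (by simp)
  have h1 : ∀ v u : C3, fderiv ℝ (fun y => pdel G y v) z u
      = (2 : ℂ)⁻¹ • (fderiv ℝ (fderiv ℝ G) z u v
        - Complex.I • fderiv ℝ (fderiv ℝ G) z u (Complex.I • v)) := by
    intro v u
    have h2 : ∀ v : C3, HasFDerivAt (fun y => fderiv ℝ G y v)
        ((fderiv ℝ (fderiv ℝ G) z).flip v) z := fun v => by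
      have := hd.hasFDerivAt.clm_apply (hasFDerivAt_const v z)
      refine this.congr_fderiv ?_
      ext1 w
      exact (congrArg (· + _) (map_zero (fderiv ℝ G z))).trans (zero_add _)
    have h3 : HasFDerivAt (fun y => pdel G y v) ((2 : ℂ)⁻¹ • (((fderiv ℝ (fderiv ℝ G) z).flip v)
        - Complex.I • ((fderiv ℝ (fderiv ℝ G) z).flip (Complex.I • v)))) z :=
      ((h2 v).sub ((h2 (Complex.I • v)).const_smul Complex.I)).const_smul (2 : ℂ)⁻¹
    exact DFunLike.congr_fun h3.fderiv u
  simp only [pdel] at h1 ⊢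
  have h2 : ∀ u v, fderiv ℝ (fderiv ℝ G) z u v = fderiv ℝ (fderiv ℝ G) z v u := fun u v => hs.eq u v
  rw [h1, h1, h1, h1, h2 v u, h2 v (Complex.I • u), h2 (Complex.I • v) u,
    h2 (Complex.I • v) (Complex.I • u)]
  simp only [smul_sub, smul_smul]
  abel_nf
  simp only [mul_comm, mul_left_comm]
  abel

theorem contDiffAt_chernConn {m m' : WithTop ℕ∞} (hm : m + 1 ≤ m') (hm' : m' ≠ ∞)
    (hG : ContDiffAt ℝ m' G z) (hu : IsUnit (G z)) (i j : Fin r) :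
    ContDiffAt ℝ m (fun y => chernConn G y i j) z := by
  refine contDiffAt_mform_one (fun v => ?_) i j
  have h1 : (1 : WithTop ℕ∞) ≤ m' := le_trans (by simp) hm
  have : (fun y => mval (chernConn G y) (fun _ => v)) =ᶠ[nhds z]
      fun y => pdel G y v * (G y)⁻¹ := by
    filter_upwards [hG.eventually hm'] with y hy
    exact mval_chernConn (hy.differentiableAt (by
      rintro rfl
      simp at h1)) v
  exact ((contDiffAt_pdel hm hG v).mul
    (contDiffAt_matrix_inv (hG.of_le (le_trans (by simp) hm)) hu)).congr_of_eventuallyEq this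

theorem eventually_mval_chernConn (hG : ContDiffAt ℝ 1 G z) (v : C3) :
    (fun y => mval (chernConn G y) (fun _ => v)) =ᶠ[nhds z] fun y => pdel G y v * (G y)⁻¹ := by
  filter_upwards [hG.eventually (by simp)] with y hy
  exact mval_chernConn (hy.differentiableAt (by simp)) v

/-- The curvature of the hermitian connection is `∂̄θ`. -/
theorem curvature_eq_mdelbar (hG : ContDiffAt ℝ 2 G z) (hu : IsUnit (G z)) :
    curvature G z = mdelbar (chernConn G) z := by
  have hG1 : ContDiffAt ℝ 1 G z := hG.of_le (by norm_num)
  have hθ : ∀ i j, DifferentiableAt ℝ (fun y => chernConn G y i j) z := fun i j =>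
    (contDiffAt_chernConn (m := 1) (m' := 2) (by norm_num) (by simp) hG hu i j).differentiableAt
      (by simp)
  have hp : ∀ v, DifferentiableAt ℝ (fun y => pdel G y v) z := fun v =>
    (contDiffAt_pdel (m := 1) (by norm_num) hG v).differentiableAt (by simp)
  have hi : DifferentiableAt ℝ (fun y => (G y)⁻¹) z :=
    (contDiffAt_matrix_inv hG1 hu).differentiableAt (by simp)
  have hθ' : ∀ v, DifferentiableAt ℝ (fun y => mval (chernConn G y) (fun _ => v)) z := fun v =>
    ((hp v).mul hi).congr_of_eventuallyEq (eventually_mval_chernConn hG1 v)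
  have hsum : curvature G z = mdelbar (chernConn G) z
      + (mdelForm (chernConn G) z - mwedge (chernConn G z) (chernConn G z)) := by
    ext1 i j
    change extDeriv _ z - _ = delbar _ z + (del _ z - _)
    rw [extDeriv_eq_add]
    abel
  have hdel : mdelForm (chernConn G) z = mwedge (chernConn G z) (chernConn G z) := by
    refine mform_two_ext fun u v => ?_
    rw [mval_mdelForm hθ hθ', mval_mwedge, pdel_congr (eventually_mval_chernConn hG1 v),
      pdel_congr (eventually_mval_chernConn hG1 u), pdel_mul (hp v) hi, pdel_mul (hp u) hi,
      pdel_pdel_symm hG u v, pdel_inv hG1 hu, pdel_inv hG1 hu,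
      mval_chernConn (hG1.differentiableAt (by simp)),
      mval_chernConn (hG1.differentiableAt (by simp))]
    simp only [Matrix.mul_neg, Matrix.mul_assoc]
    abel
  rw [hsum, hdel, sub_self, add_zero]

/-! ### Families of connections -/

variable {U : Set C3} {Gt : ℝ → C3 → Matrix (Fin r) (Fin r) ℂ}
  {G' : C3 → Matrix (Fin r) (Fin r) ℂ}

theorem SmoothFamily.matrix_inv {n : Type*} [Fintype n] [DecidableEq n]
    {Gt : ℝ → C3 → Matrix n n ℂ} {G' : C3 → Matrix n n ℂ} (h : SmoothFamily U Gt G') (hu : ∀ y ∈ U, IsUnit (Gt 0 y)) :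
    SmoothFamily U (fun t y => (Gt t y)⁻¹) (fun y => -((Gt 0 y)⁻¹ * G' y * (Gt 0 y)⁻¹)) := by
  intro y hy
  have h1 : ContDiffAt ℝ ∞ (fun p : ℝ × C3 => (Function.uncurry Gt p)⁻¹) (0, y) :=
    contDiffAt_matrix_inv (h.contDiffAt hy) (hu y hy)
  refine ⟨h1, ?_⟩
  have h2 : HasDerivAt (fun t => (Gt t y)⁻¹) _ 0 :=
    hasDerivAt_slice (h1.differentiableAt (by simp))
  have h3 := h2.mul (h.hasDerivAt hy)
  have hc : ContinuousAt (fun t => Gt t y) 0 := (h.hasDerivAt hy).continuousAt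
  have h4 : HasDerivAt (fun t => (Gt t y)⁻¹ * Gt t y) 0 0 := by
    refine (hasDerivAt_const (0 : ℝ) (1 : Matrix n n ℂ)).congr_of_eventuallyEq ?_
    filter_upwards [eventually_isUnit hc (hu y hy)] with t ht
    exact Matrix.nonsing_inv_mul _ ((isUnit_iff_isUnit_det _).1 ht)
  have h5 := eq_neg_of_derivation (hu y hy) (h3.unique h4)
  rw [h5] at h2
  exact h2

theorem SmoothFamily.mdel (hU : IsOpen U) (h : SmoothFamily U Gt G') (i j : Fin r) :
    SmoothFamily U (fun t y => Strominger.mdel (Gt t) y i j)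
      (fun y => Strominger.mdel G' y i j) :=
  SmoothFamily.del (f := fun t => zeroForm fun y => Gt t y i j) hU
    ((smoothFamily_matrix.1 h i j).clm zeroFormL)

theorem SmoothFamily.chernConn (hU : IsOpen U) (h : SmoothFamily U Gt G')
    (hu : ∀ y ∈ U, IsUnit (Gt 0 y)) (i j : Fin r) :
    SmoothFamily U (fun t y => Strominger.chernConn (Gt t) y i j)
      (fun y => dprime (Gt 0) (fun y => G' y * (Gt 0 y)⁻¹) y i j) := by
  have h1 : SmoothFamily U (fun t y => Strominger.chernConn (Gt t) y i j) _ :=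
    SmoothFamily.sum (s := Finset.univ) fun l _ =>
      ((smoothFamily_matrix.1 (h.matrix_inv hu) l j).smul (h.mdel hU i l))
  refine h1.congr_deriv fun y hy => ?_
  have hG := h.contDiffAt_base hy
  have hG1 : ContDiffAt ℝ 1 (Gt 0) y := hG.of_le (by simp)
  have hGd : DifferentiableAt ℝ (Gt 0) y := hG.differentiableAt (by simp)
  have hG'd : DifferentiableAt ℝ G' y := (h.contDiffAt_deriv hU hy).differentiableAt (by simp)
  have hi : DifferentiableAt ℝ (fun y => (Gt 0 y)⁻¹) y :=
    (contDiffAt_matrix_inv hG1 (hu y hy)).differentiableAt (by simp)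
  have ha : DifferentiableAt ℝ (fun y => G' y * (Gt 0 y)⁻¹) y := hG'd.mul hi
  have h2 : rmul (Strominger.mdel G' y) (Gt 0 y)⁻¹
      + rmul (Strominger.mdel (Gt 0) y) (-((Gt 0 y)⁻¹ * G' y * (Gt 0 y)⁻¹))
      = dprime (Gt 0) (fun y => G' y * (Gt 0 y)⁻¹) y := by
    refine mform_one_ext fun v => ?_
    rw [mval_add, mval_rmul, mval_rmul, mval_mdel hG'd, mval_mdel hGd,
      mval_dprime hGd ha, pdel_mul hG'd hi, pdel_inv hG1 (hu y hy)]
    simp only [Matrix.mul_neg, Matrix.mul_assoc]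
    abel
  rw [← h2]
  change _ = rmul (Strominger.mdel G' y) (Gt 0 y)⁻¹ i j + rmul _ _ i j
  simp only [rmul]
  rw [← Finset.sum_add_distrib]

theorem SmoothFamily.mdelbar {k : ℕ} {T : ℝ → C3 → MForm r k} {T' : C3 → MForm r k}
    (hU : IsOpen U) (h : ∀ i j, SmoothFamily U (fun t y => T t y i j) (fun y => T' y i j))
    (i j : Fin r) : SmoothFamily U (fun t y => Strominger.mdelbar (T t) y i j)
      (fun y => Strominger.mdelbar T' y i j) := (h i j).delbar hU

/-- The first variation of the curvature is `∂̄ ∂_G (G' G⁻¹)`. -/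
theorem SmoothFamily.hasDerivAt_curvature (hU : IsOpen U) (h : SmoothFamily U Gt G')
    (hu : ∀ y ∈ U, IsUnit (Gt 0 y)) {z : C3} (hz : z ∈ U) (i j : Fin r) :
    HasDerivAt (fun t => curvature (Gt t) z i j)
      (Strominger.mdelbar (dprime (Gt 0) (fun y => G' y * (Gt 0 y)⁻¹)) z i j) 0 := by
  have h1 := (SmoothFamily.mdelbar hU (h.chernConn hU hu) i j).hasDerivAt hz
  refine h1.congr_of_eventuallyEq ?_
  have h2 : ∀ᶠ p in nhds ((0 : ℝ), z), ContDiffAt ℝ 2 (Function.uncurry Gt) p :=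
    ((h.contDiffAt hz).of_le (m := 2)
      (WithTop.coe_le_coe.2 le_top : ((2 : ℕ∞) : WithTop ℕ∞) ≤ ∞)).eventually (by simp)
  have h3 : Filter.Tendsto (fun t : ℝ => (t, z)) (nhds 0) (nhds (0, z)) :=
    (Continuous.prodMk_left z).tendsto 0
  filter_upwards [h3.eventually h2,
    eventually_isUnit (h.hasDerivAt hz).continuousAt (hu z hz)] with t ht ht'
  have h4 : ContDiffAt ℝ 2 (Gt t) z :=
    ContDiffAt.comp (g := Function.uncurry Gt) (f := fun y : C3 => (t, y)) z ht
      (contDiffAt_const.prodMk contDiffAt_id)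
  rw [curvature_eq_mdelbar h4 ht']

end Curvature

end Strominger

end

noncomputable section

namespace Strominger

/-! ## Wedge products of two-forms -/

/-- The permutation of `Fin (n + 1)` mapping `0` to `i` and the rest by `τ`. -/
def consPerm {n : ℕ} (p : Fin (n + 1) × Equiv.Perm (Fin n)) : Equiv.Perm (Fin (n + 1)) :=
  (Fin.cycleRange p.1).symm * Equiv.Perm.decomposeFin.symm (0, p.2)

theorem consPerm_zero {n : ℕ} (p : Fin (n + 1) × Equiv.Perm (Fin n)) : consPerm p 0 = p.1 := by
  simp [consPerm, Equiv.Perm.mul_apply]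

theorem consPerm_succ {n : ℕ} (p : Fin (n + 1) × Equiv.Perm (Fin n)) (j : Fin n) :
    consPerm p j.succ = p.1.succAbove (p.2 j) := by
  simp [consPerm, Equiv.Perm.mul_apply]

theorem sign_consPerm {n : ℕ} (p : Fin (n + 1) × Equiv.Perm (Fin n)) :
    Equiv.Perm.sign (consPerm p) = (-1) ^ (p.1 : ℕ) * Equiv.Perm.sign p.2 := by
  simp [consPerm, Fin.sign_cycleRange]

theorem consPerm_bijective {n : ℕ} : Function.Bijective (consPerm (n := n)) := by
  rw [Fintype.bijective_iff_injective_and_card]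
  refine ⟨fun p q h => ?_, ?_⟩
  · have h0 : p.1 = q.1 := by rw [← consPerm_zero p, h, consPerm_zero]
    refine Prod.ext h0 (Equiv.ext fun j => ?_)
    have := congrArg (fun σ => σ j.succ) h
    simp only [consPerm_succ, h0] at this
    exact Fin.succAbove_right_injective this
  · simp [Fintype.card_perm, Nat.factorial_succ]

theorem sum_perm_succ {n : ℕ} (F : (Fin (n + 1) → Fin (n + 1)) → ℂ) :
    ∑ σ : Equiv.Perm (Fin (n + 1)), Equiv.Perm.sign σ • F σ =
      ∑ i : Fin (n + 1), (-1) ^ (i : ℕ) * ∑ τ : Equiv.Perm (Fin n),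
        Equiv.Perm.sign τ • F (Fin.cons i fun j => i.succAbove (τ j)) := by
  rw [← consPerm_bijective.sum_comp, Fintype.sum_prod_type]
  refine Finset.sum_congr rfl fun i _ => ?_
  rw [Finset.mul_sum]
  refine Finset.sum_congr rfl fun τ _ => ?_
  have h : ⇑(consPerm (i, τ)) = Fin.cons i fun j => i.succAbove (τ j) := by
    funext j
    induction j using Fin.cases with
    | zero => rw [consPerm_zero, Fin.cons_zero]
    | succ j => rw [consPerm_succ, Fin.cons_succ]
  rw [h, sign_consPerm]
  simp only [Units.smul_def, Units.val_mul, Units.val_pow_eq_pow_val, Units.val_neg, Units.val_one,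
    zsmul_eq_mul]
  push_cast
  ring

theorem cform_two_swap (α : CForm 2) (u v : C3) : α ![u, v] = -α ![v, u] := by
  have h := α.toAlternatingMap.map_swap ![u, v] (i := 0) (j := 1) (by decide)
  have e : ![u, v] ∘ Equiv.swap (0 : Fin 2) 1 = ![v, u] := by
    funext i
    fin_cases i <;> simp
  rw [e] at h
  change α ![v, u] = -α ![u, v] at h
  rw [h, neg_neg]

/-- Antisymmetrizing a form multiplies it by `k!`. -/
theorem sum_perm_cform {k : ℕ} (γ : CForm k) (v : Fin k → C3) :
    ∑ σ : Equiv.Perm (Fin k), Equiv.Perm.sign σ • γ (fun i => v (σ i)) = (k.factorial : ℂ) * γ v := by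
  have h : ∀ σ : Equiv.Perm (Fin k), Equiv.Perm.sign σ • γ (fun i => v (σ i)) = γ v := by
    intro σ
    have : γ (fun i => v (σ i)) = Equiv.Perm.sign σ • γ v := γ.toAlternatingMap.map_perm v σ
    rw [this, smul_smul, Int.units_mul_self, one_smul]
  rw [Finset.sum_congr rfl fun σ _ => h σ, Finset.sum_const, Finset.card_univ, Fintype.card_perm,
    Fintype.card_fin, nsmul_eq_mul]

/-- The product of a two-form with a form, the two-form in the first place. -/
theorem wedge_two_left {q : ℕ} (α : CForm 2) (β : CForm q) (v : Fin (q + 2) → C3) :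
    ∑ σ : Equiv.Perm (Fin (q + 2)), Equiv.Perm.sign σ •
      (α ![v (σ 0), v (σ 1)] * β (fun i => v (σ i.succ.succ))) =
    (q.factorial : ℂ) * ∑ i : Fin (q + 2), ∑ j : Fin (q + 1), (-1) ^ (i : ℕ) * (-1) ^ (j : ℕ) *
      (α ![v i, v (i.succAbove j)] * β (fun l => v (i.succAbove (j.succAbove l)))) := by
  rw [sum_perm_succ fun s => α ![v (s 0), v (s 1)] * β (fun i => v (s i.succ.succ)),
    Finset.mul_sum]
  refine Finset.sum_congr rfl fun i _ => ?_
  simp only [Fin.cons_zero, Fin.cons_succ, ← Fin.succ_zero_eq_one]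
  rw [sum_perm_succ fun s => α ![v i, v (i.succAbove (s 0))] *
    β (fun l => v (i.succAbove (s l.succ))), Finset.mul_sum, Finset.mul_sum]
  refine Finset.sum_congr rfl fun j _ => ?_
  simp only [Fin.cons_zero, Fin.cons_succ]
  have := sum_perm_cform β (fun l => v (i.succAbove (j.succAbove l)))
  rw [Finset.sum_congr rfl fun τ _ => (mul_smul_comm (Equiv.Perm.sign τ)
    (α ![v i, v (i.succAbove j)]) _).symm, ← Finset.mul_sum, this]
  ring

theorem sum_perm_comp {n : ℕ} (ρ : Equiv.Perm (Fin n)) (hρ : Equiv.Perm.sign ρ = 1)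
    (F : (Fin n → Fin n) → ℂ) :
    ∑ σ : Equiv.Perm (Fin n), Equiv.Perm.sign σ • F σ =
      ∑ σ : Equiv.Perm (Fin n), Equiv.Perm.sign σ • F (fun i => σ (ρ i)) := by
  rw [← Equiv.sum_comp (Equiv.mulRight ρ)]
  refine Finset.sum_congr rfl fun σ _ => ?_
  simp only [Equiv.coe_mulRight, map_mul, hρ, mul_one]
  rfl

theorem wedge_two_two (α β : CForm 2) (a b c d : C3) : wedge α β ![a, b, c, d] =
    α ![a, b] * β ![c, d] - α ![a, c] * β ![b, d] + α ![a, d] * β ![b, c]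
      + α ![b, c] * β ![a, d] - α ![b, d] * β ![a, c] + α ![c, d] * β ![a, b] := by
  set v : Fin 4 → C3 := ![a, b, c, d] with hv
  have h1 : wedge α β v = ((2 * 2 : ℕ) : ℂ)⁻¹ *
      ∑ σ : Equiv.Perm (Fin 4), Equiv.Perm.sign σ •
      (α ![v (σ 0), v (σ 1)] * β (fun i => v (σ i.succ.succ))) := by
    refine (wedge_apply α β _).trans ?_
    congr 1
    refine Finset.sum_congr rfl fun σ _ => congrArg (Equiv.Perm.sign σ • ·) ?_
    congr 2 <;> (funext i; fin_cases i <;> rfl)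
  have h2 : (∑ σ : Equiv.Perm (Fin 4), Equiv.Perm.sign σ •
      (α ![v (σ 0), v (σ 1)] * β (fun i => v (σ i.succ.succ)))) =
    2 * ∑ i : Fin 4, ∑ j : Fin 3, (-1) ^ (i : ℕ) * (-1) ^ (j : ℕ) *
      (α ![v i, v (i.succAbove j)] * β ![v (i.succAbove (j.succAbove 0)),
        v (i.succAbove (j.succAbove 1))]) := by
    refine (wedge_two_left α β v).trans ?_
    congr 1
    refine Finset.sum_congr rfl fun i _ => Finset.sum_congr rfl fun j _ => ?_
    congr 3
    funext i
    fin_cases i <;> rfl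
  rw [h1, h2]
  simp only [Fin.sum_univ_four, Fin.sum_univ_three]
  simp [Fin.succAbove, hv]
  rw [cform_two_swap α b a, cform_two_swap α c a, cform_two_swap α c b, cform_two_swap α d a,
    cform_two_swap α d b, cform_two_swap α d c]
  ring

theorem wedge_two_comm (α β : CForm 2) : wedge α β = wedge β α := by
  ext v
  have hv : v = ![v 0, v 1, v 2, v 3] := by
    funext i
    fin_cases i <;> rfl
  rw [hv, wedge_two_two, wedge_two_two]
  ring

theorem wedge_four_two (γ : CForm 4) (w : CForm 2) (v : Fin 6 → C3) :
    wedge γ w v = 2⁻¹ * ∑ i : Fin 6, ∑ j : Fin 5, (-1) ^ (i : ℕ) * (-1) ^ (j : ℕ) *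
      (w ![v i, v (i.succAbove j)] * γ ![v (i.succAbove (j.succAbove 0)),
        v (i.succAbove (j.succAbove 1)), v (i.succAbove (j.succAbove 2)),
        v (i.succAbove (j.succAbove 3))]) := by
  let ρ : Equiv.Perm (Fin 6) := finRotate 6 ^ 2
  have hρ : Equiv.Perm.sign ρ = 1 := by
    simp only [ρ, map_pow]
    exact Int.units_sq _
  let F : (Fin 6 → Fin 6) → ℂ := fun s =>
    γ (fun i => v (s (Fin.castAdd 2 i))) * w (fun j => v (s (Fin.natAdd 4 j)))
  have h0 : wedge γ w v = ((Nat.factorial 4 * Nat.factorial 2 : ℕ) : ℂ)⁻¹ *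
      ∑ σ : Equiv.Perm (Fin 6), Equiv.Perm.sign σ • F σ := wedge_apply γ w v
  have hF : ∀ σ : Equiv.Perm (Fin 6), F (fun i => σ (ρ i))
      = w ![v (σ 0), v (σ 1)] * γ (fun i => v (σ i.succ.succ)) := by
    intro σ
    refine (mul_comm _ _).trans ?_
    congr 2 <;> (funext i; fin_cases i <;> rfl)
  have h2 : (∑ σ : Equiv.Perm (Fin 6), Equiv.Perm.sign σ •
      (w ![v (σ 0), v (σ 1)] * γ (fun i => v (σ i.succ.succ)))) =
    (Nat.factorial 4 : ℂ) * ∑ i : Fin 6, ∑ j : Fin 5, (-1) ^ (i : ℕ) * (-1) ^ (j : ℕ) *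
      (w ![v i, v (i.succAbove j)] * γ ![v (i.succAbove (j.succAbove 0)),
        v (i.succAbove (j.succAbove 1)), v (i.succAbove (j.succAbove 2)),
        v (i.succAbove (j.succAbove 3))]) := by
    refine (wedge_two_left w γ v).trans ?_
    congr 1
    refine Finset.sum_congr rfl fun i _ => Finset.sum_congr rfl fun j _ => ?_
    congr 3
    funext i
    fin_cases i <;> rfl
  rw [h0, sum_perm_comp ρ hρ F]
  simp only [hF]
  rw [h2, ← mul_assoc]
  congr 1
  simp [Nat.factorial]
  norm_num

/-- The value of `w³ / 3!` is the Pfaffian of the matrix of values of `w`. -/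
theorem vol_apply (w : CForm 2) (x y a b c d : C3) : vol w ![x, y, a, b, c, d] =
    w ![x, y] * (w ![a, b] * w ![c, d] - w ![a, c] * w ![b, d] + w ![a, d] * w ![b, c])
    - w ![x, a] * (w ![y, b] * w ![c, d] - w ![y, c] * w ![b, d] + w ![y, d] * w ![b, c])
    + w ![x, b] * (w ![y, a] * w ![c, d] - w ![y, c] * w ![a, d] + w ![y, d] * w ![a, c])
    - w ![x, c] * (w ![y, a] * w ![b, d] - w ![y, b] * w ![a, d] + w ![y, d] * w ![a, b])
    + w ![x, d] * (w ![y, a] * w ![b, c] - w ![y, b] * w ![a, c] + w ![y, c] * w ![a, b]) := by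
  have h3 : ∀ a b c d : C3, wedge w w ![a, b, c, d] =
      2 * (w ![a, b] * w ![c, d] - w ![a, c] * w ![b, d] + w ![a, d] * w ![b, c]) := by
    intro a b c d
    rw [wedge_two_two w w a b c d]
    ring
  have h4 : ∀ v : Fin 6 → C3, vol w v = (6 : ℂ)⁻¹ * wedge (wedge w w) w v := fun v => rfl
  rw [h4, wedge_four_two (wedge w w) w]
  simp only [h3, Fin.sum_univ_six, Fin.sum_univ_five]
  simp only [Fin.succAbove, Fin.lt_def]
  simp
  rw [cform_two_swap w a x, cform_two_swap w b x, cform_two_swap w c x, cform_two_swap w d x,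
    cform_two_swap w a y, cform_two_swap w b y, cform_two_swap w c y, cform_two_swap w d y,
    cform_two_swap w y x, cform_two_swap w b a, cform_two_swap w c a, cform_two_swap w d a,
    cform_two_swap w c b, cform_two_swap w d b, cform_two_swap w d c]
  ring

end Strominger

end

noncomputable section
namespace Strominger

/-- The coordinates of a vector in the basis `realBasis`. -/
def realCoord (p : C3) (a : Fin 3 × Fin 2) : ℝ := if a.2 = 0 then (p a.1).re else (p a.1).im

theorem sum_realCoord (p : C3) : ∑ a, realCoord p a • realBasis a = p := by
  funext i
  rw [Fintype.sum_prod_type]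
  simp only [Fin.sum_univ_two, realCoord, realBasis, Finset.sum_apply, Pi.add_apply, Pi.smul_apply]
  fin_cases i <;> simp [Fin.sum_univ_three, Pi.single_apply]

theorem sum_realCoord_smul {M : Type*} [AddCommGroup M] [Module ℝ M] (L : C3 →ₗ[ℝ] M) (p : C3) :
    ∑ a, realCoord p a • L (realBasis a) = L p := by
  conv_rhs => rw [← sum_realCoord p]
  simp

/-- A two-form as a bilinear map. -/
def bilinOfTwo (β : CForm 2) : C3 →ₗ[ℝ] C3 →ₗ[ℝ] ℂ :=
  LinearMap.mk₂ ℝ (fun u v => β ![u, v])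
    (fun u u' v => by
      have h := β.map_update_add ![u, v] 0 u u'
      have e : ∀ x, Function.update ![u, v] 0 x = ![x, v] := fun x => by
        funext i; fin_cases i <;> rfl
      rwa [e, e, e] at h)
    (fun c u v => by
      have h := β.map_update_smul ![u, v] 0 c u
      have e : ∀ x, Function.update ![u, v] 0 x = ![x, v] := fun x => by
        funext i; fin_cases i <;> rfl
      rwa [e, e] at h)
    (fun u v v' => by
      have h := β.map_update_add ![u, v] 1 v v'
      have e : ∀ x, Function.update ![u, v] 1 x = ![u, x] := fun x => by
        funext i; fin_cases i <;> rfl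
      rwa [e, e, e] at h)
    (fun c u v => by
      have h := β.map_update_smul ![u, v] 1 c v
      have e : ∀ x, Function.update ![u, v] 1 x = ![u, x] := fun x => by
        funext i; fin_cases i <;> rfl
      rwa [e, e] at h)

theorem bilinOfTwo_apply (β : CForm 2) (u v : C3) : bilinOfTwo β u v = β ![u, v] := rfl

theorem two_neg_right (β : CForm 2) (u v : C3) : β ![u, -v] = -β ![u, v] := by
  rw [← bilinOfTwo_apply, ← bilinOfTwo_apply, map_neg]

theorem I_smul_I_smul (p : C3) : Complex.I • Complex.I • p = -p := by
  rw [smul_smul, Complex.I_mul_I, neg_one_smul]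

theorem IsReal11.apply_I_left {w : CForm 2} (hw : IsReal11 w) (u v : C3) :
    w ![Complex.I • u, v] = -w ![u, Complex.I • v] := by
  rw [← hw.1 u, I_smul_I_smul, two_neg_right, neg_neg]

theorem gramReal_symm {w : CForm 2} (hw : IsReal11 w) (a b : Fin 3 × Fin 2) :
    gramReal w a b = gramReal w b a := by
  unfold gramReal
  rw [cform_two_swap, hw.apply_I_left, neg_neg]

theorem gramReal_transpose {w : CForm 2} (hw : IsReal11 w) : (gramReal w).transpose = gramReal w := by
  ext a b
  exact gramReal_symm hw b a

theorem IsReal11.ofReal_re {w : CForm 2} (hw : IsReal11 w) (v : Fin 2 → C3) :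
    (((w v).re : ℝ) : ℂ) = w v :=
  Complex.ext (by simp) (by simp [hw.2 v])

theorem gramReal_mulVec (w : CForm 2) (p : C3) (a : Fin 3 × Fin 2) :
    ∑ b, gramReal w a b * (realCoord p b : ℂ) = w ![realBasis a, Complex.I • p] := by
  have h := sum_realCoord_smul ((bilinOfTwo w (realBasis a)).comp (mulI : C3 →ₗ[ℝ] C3)) p
  refine (Finset.sum_congr rfl fun b _ => ?_).trans h
  rw [Complex.real_smul, mul_comm]
  rfl

theorem isUnit_gramReal {w : CForm 2} (hw : IsReal11 w) (hp : IsPositive w) :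
    IsUnit (gramReal w) := by
  set g : Matrix (Fin 3 × Fin 2) (Fin 3 × Fin 2) ℝ := fun a b => (gramReal w a b).re with hg
  have hgw : gramReal w = g.map Complex.ofRealHom := by
    ext a b
    exact (hw.ofReal_re _).symm
  have hd : g.det ≠ 0 := by
    intro h0
    obtain ⟨x, hx, hgx⟩ := Matrix.exists_mulVec_eq_zero_iff.2 h0
    set u : C3 := ∑ a, x a • realBasis a with hu
    have hwu : (w ![u, Complex.I • u]).re = 0 := by
      have h1 : w ![u, Complex.I • u] = ∑ a, ∑ b, (x a : ℂ) * ((x b : ℂ) * gramReal w a b) := by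
        change bilinOfTwo w u (mulI u) = _
        rw [hu]
        simp only [map_sum, map_smul, LinearMap.sum_apply, LinearMap.smul_apply, Complex.real_smul,
          Finset.mul_sum]
        refine (Finset.sum_comm).trans (Finset.sum_congr rfl fun a _ => Finset.sum_congr rfl fun b _ => ?_)
        rw [mul_left_comm]
        rfl
      rw [h1]
      simp only [Complex.re_sum, Complex.re_ofReal_mul]
      refine Finset.sum_eq_zero fun a _ => ?_
      have := congrFun hgx a
      simp only [Matrix.mulVec, dotProduct, Pi.zero_apply] at this
      rw [← Finset.mul_sum, ← mul_zero (x a), ← this]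
      exact congrArg _ (Finset.sum_congr rfl fun b _ => mul_comm _ _)
    have hu0 : u = 0 := by
      by_contra hne
      exact (hp u hne).ne' hwu
    apply hx
    funext a
    have hc : realCoord u a = x a := by
      rw [hu]
      simp only [realCoord, Finset.sum_apply, Pi.smul_apply, realBasis, Fintype.sum_prod_type,
        Fin.sum_univ_two]
      obtain ⟨i, j⟩ := a
      fin_cases i <;> fin_cases j <;> simp [Fin.sum_univ_three, Pi.single_apply]
    rw [← hc, hu0]
    simp [realCoord]
  rw [Matrix.isUnit_iff_isUnit_det, hgw, ← RingHom.mapMatrix_apply, ← RingHom.map_det]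
  exact (Ne.isUnit hd).map _

theorem gramReal_inv_raise {w : CForm 2} (hw : IsReal11 w) (hp : IsPositive w) (p : C3)
    (a : Fin 3 × Fin 2) :
    ∑ b, (gramReal w)⁻¹ a b * w ![realBasis b, p] = (realCoord (-(Complex.I • p)) a : ℂ) := by
  have h : ∀ b, w ![realBasis b, p] =
      (gramReal w).mulVec (fun c => (realCoord (-(Complex.I • p)) c : ℂ)) b := by
    intro b
    rw [Matrix.mulVec, dotProduct, gramReal_mulVec, smul_neg, I_smul_I_smul, neg_neg]
  have hdet : IsUnit (gramReal w).det := (Matrix.isUnit_iff_isUnit_det _).1 (isUnit_gramReal hw hp)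
  calc _ = ((gramReal w)⁻¹.mulVec ((gramReal w).mulVec
      (fun c => (realCoord (-(Complex.I • p)) c : ℂ)))) a :=
        Finset.sum_congr rfl fun b _ => congrArg _ (h b)
    _ = _ := by rw [Matrix.mulVec_mulVec, Matrix.nonsing_inv_mul _ hdet, Matrix.one_mulVec]

/-- `∑ g^{ac} L(e_a) w(e_c, p) = -L(√-1 p)` -/
theorem sum_gramReal_inv_mul {w : CForm 2} (hw : IsReal11 w) (hp : IsPositive w)
    (L : C3 →ₗ[ℝ] ℂ) (p : C3) :
    ∑ a, ∑ b, (gramReal w)⁻¹ a b * L (realBasis a) * w ![realBasis b, p] = -L (Complex.I • p) := by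
  rw [← map_neg, ← sum_realCoord_smul L (-(Complex.I • p))]
  refine Finset.sum_congr rfl fun a _ => ?_
  rw [Complex.real_smul, ← gramReal_inv_raise hw hp, Finset.sum_mul]
  exact Finset.sum_congr rfl fun b _ => by ring

/-- The contraction of a two-form with a function of two vectors, with indices raised. -/
def contrTwo (w β : CForm 2) (f : C3 → C3 → ℂ) : ℂ :=
  ∑ a : Fin 2 → Fin 3 × Fin 2, ∑ b : Fin 2 → Fin 3 × Fin 2,
    (∏ i, (gramReal w)⁻¹ (a i) (b i)) * β (fun i => realBasis (a i)) *
      f (realBasis (b 0)) (realBasis (b 1))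

theorem sum_fin_two {I : Type*} [Fintype I] (F : (Fin 2 → I) → ℂ) :
    ∑ a, F a = ∑ a₀, ∑ a₁, F ![a₀, a₁] := by
  rw [← (finTwoArrowEquiv I).symm.sum_comp, Fintype.sum_prod_type]
  rfl

theorem contrTwo_eq (w β : CForm 2) (f : C3 → C3 → ℂ) : contrTwo w β f =
    ∑ a₁, ∑ b₁, (gramReal w)⁻¹ a₁ b₁ * ∑ a₀, ∑ b₀, (gramReal w)⁻¹ a₀ b₀ *
      β ![realBasis a₀, realBasis a₁] * f (realBasis b₀) (realBasis b₁) := by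
  unfold contrTwo
  simp only [sum_fin_two, Fin.prod_univ_two, Matrix.cons_val_zero, Matrix.cons_val_one]
  rw [Finset.sum_comm]
  refine Finset.sum_congr rfl fun a₁ _ => ?_
  simp only [Finset.mul_sum]
  have : ∀ a₀ a₁, (fun i => realBasis (![a₀, a₁] i)) = ![realBasis a₀, realBasis a₁] := by
    intro a₀ a₁
    funext i
    fin_cases i <;> rfl
  simp only [this]
  conv_lhs => enter [2, a₀]; rw [Finset.sum_comm]
  rw [Finset.sum_comm]
  refine Finset.sum_congr rfl fun b₁ _ => Finset.sum_congr rfl fun a₀ _ =>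
    Finset.sum_congr rfl fun b₀ _ => by ring

theorem contrTwo_add (w β : CForm 2) (f g : C3 → C3 → ℂ) :
    contrTwo w β (fun x y => f x y + g x y) = contrTwo w β f + contrTwo w β g := by
  simp only [contrTwo, mul_add, Finset.sum_add_distrib]

theorem contrTwo_mul (w β : CForm 2) (f : C3 → C3 → ℂ) (c : ℂ) :
    contrTwo w β (fun x y => f x y * c) = contrTwo w β f * c := by
  simp only [contrTwo, ← mul_assoc, Finset.sum_mul]

theorem contrTwo_mul_mul {w β : CForm 2} (hw : IsReal11 w) (hp : IsPositive w) (hβ : IsReal11 β)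
    (p q : C3) : contrTwo w β (fun x y => w ![x, p] * w ![y, q]) = β ![p, q] := by
  rw [contrTwo_eq]
  have h : ∀ a₁ b₁, ∑ a₀, ∑ b₀, (gramReal w)⁻¹ a₀ b₀ * β ![realBasis a₀, realBasis a₁] *
      (w ![realBasis b₀, p] * w ![realBasis b₁, q]) =
        -β ![Complex.I • p, realBasis a₁] * w ![realBasis b₁, q] := by
    intro a₁ b₁
    rw [← bilinOfTwo_apply β, ← (bilinOfTwo β).flip_apply,
      ← sum_gramReal_inv_mul hw hp ((bilinOfTwo β).flip (realBasis a₁)) p, Finset.sum_mul]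
    refine Finset.sum_congr rfl fun a₀ _ => ?_
    rw [Finset.sum_mul]
    exact Finset.sum_congr rfl fun b₀ _ => by rw [LinearMap.flip_apply, bilinOfTwo_apply]; ring
  simp only [h]
  have h2 := sum_gramReal_inv_mul hw hp (bilinOfTwo β (Complex.I • p)) q
  rw [bilinOfTwo_apply, hβ.1] at h2
  rw [← neg_neg (β ![p, q]), ← h2, ← Finset.sum_neg_distrib]
  refine Finset.sum_congr rfl fun a₁ _ => ?_
  rw [← Finset.sum_neg_distrib]
  exact Finset.sum_congr rfl fun b₁ _ => by rw [bilinOfTwo_apply]; ring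

theorem contrTwo_self {w β : CForm 2} (hw : IsReal11 w) :
    contrTwo w β (fun x y => w ![x, y]) = 2 * formInner w β w := by
  unfold contrTwo formInner
  rw [← mul_assoc]
  norm_num
  refine Finset.sum_congr rfl fun a _ => Finset.sum_congr rfl fun b _ => ?_
  rw [Complex.conj_eq_iff_im.2 (hw.2 _)]
  congr 1
  congr 1
  funext i
  fin_cases i <;> rfl

theorem two_mul_formInner {w β : CForm 2} (hw : IsReal11 w) (hp : IsPositive w)
    (hβ : IsReal11 β) :
    2 * formInner w β w = ∑ a, ∑ b, (gramReal w)⁻¹ a b * gramReal β a b := by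
  rw [← contrTwo_self hw, contrTwo_eq]
  refine Finset.sum_congr rfl fun a _ => Finset.sum_congr rfl fun b _ => ?_
  congr 1
  rw [gramReal_symm hβ, gramReal, ← neg_neg (β ![realBasis b, _]), ← hβ.apply_I_left,
    ← bilinOfTwo_apply, ← LinearMap.flip_apply,
    ← sum_gramReal_inv_mul hw hp ((bilinOfTwo β).flip (realBasis a))]
  rfl

theorem formInner_self {w : CForm 2} (hw : IsReal11 w) (hp : IsPositive w) :
    formInner w w w = 3 := by
  have h := two_mul_formInner hw hp hw
  have h2 : ∑ a, ∑ b, (gramReal w)⁻¹ a b * gramReal w a b = 6 := by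
    have hdet : IsUnit (gramReal w).det :=
      (Matrix.isUnit_iff_isUnit_det _).1 (isUnit_gramReal hw hp)
    have := congrArg Matrix.trace (Matrix.nonsing_inv_mul _ hdet)
    rw [Matrix.trace_one, Matrix.trace] at this
    have hc : (Fintype.card (Fin 3 × Fin 2) : ℂ) = 6 := by simp
    rw [← hc, ← this]
    refine Finset.sum_congr rfl fun a _ => ?_
    exact Finset.sum_congr rfl fun b _ => congrArg _ (gramReal_symm hw a b)
  rw [h2] at h
  linear_combination h / 2

theorem star_two_apply {w β : CForm 2} (v : Fin 4 → C3) :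
    star (k := 2) (l := 4) rfl w β v =
      2⁻¹ * contrTwo w β (fun x y => vol w ![x, y, v 0, v 1, v 2, v 3]) := by
  unfold star contrTwo
  have h : ∀ b : Fin 2 → Fin 3 × Fin 2,
      contract 2 (l := 4) (vol w : CForm (4 + 2)) (fun i => realBasis (b i)) v =
        vol w ![realBasis (b 0), realBasis (b 1), v 0, v 1, v 2, v 3] := by
    intro b
    change vol w _ = _
    congr 1
    funext i
    fin_cases i <;> rfl
  rw [ContinuousAlternatingMap.smul_apply, ContinuousAlternatingMap.sum_apply]
  simp only [ContinuousAlternatingMap.sum_apply, ContinuousAlternatingMap.smul_apply, h,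
    smul_eq_mul]
  norm_num

theorem star_two {w β : CForm 2} (hw : IsReal11 w) (hp : IsPositive w) (hβ : IsReal11 β) :
    star (k := 2) (l := 4) rfl w β =
      ((2 : ℂ)⁻¹ * formInner w β w) • wedge w w - wedge β w := by
  ext v
  have hv : v = ![v 0, v 1, v 2, v 3] := by
    funext i
    fin_cases i <;> rfl
  have hb : (((2 : ℂ)⁻¹ * formInner w β w) • wedge w w - wedge β w) v =
      (2 : ℂ)⁻¹ * formInner w β w * wedge w w v - wedge β w v := rfl
  rw [star_two_apply, hb]
  generalize v 0 = a at hv ⊢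
  generalize v 1 = b at hv ⊢
  generalize v 2 = c at hv ⊢
  generalize v 3 = d at hv ⊢
  have h4 : ∀ α : CForm 2, wedge α w v = wedge α w ![a, b, c, d] := fun α => congrArg _ hv
  rw [h4, h4, wedge_two_two, wedge_two_two]
  have key : ∀ x y, vol w ![x, y, a, b, c, d] =
    w ![x, y] * (w ![a, b] * w ![c, d] - w ![a, c] * w ![b, d] + w ![a, d] * w ![b, c])
    + w ![x, a] * w ![y, b] * (-w ![c, d]) + w ![x, a] * w ![y, c] * w ![b, d]
    + w ![x, a] * w ![y, d] * (-w ![b, c])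
    + w ![x, b] * w ![y, a] * w ![c, d] + w ![x, b] * w ![y, c] * (-w ![a, d])
    + w ![x, b] * w ![y, d] * w ![a, c]
    + w ![x, c] * w ![y, a] * (-w ![b, d]) + w ![x, c] * w ![y, b] * (w ![a, d])
    + w ![x, c] * w ![y, d] * (-w ![a, b])
    + w ![x, d] * w ![y, a] * w ![b, c] + w ![x, d] * w ![y, b] * (-w ![a, c])
    + w ![x, d] * w ![y, c] * w ![a, b] := by
    intro x y
    rw [vol_apply]
    ring
  simp only [key, contrTwo_add, contrTwo_mul, contrTwo_mul_mul hw hp hβ, contrTwo_self hw]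
  rw [cform_two_swap β b a, cform_two_swap β c a, cform_two_swap β d a, cform_two_swap β c b,
    cform_two_swap β d b, cform_two_swap β d c]
  ring

theorem star_two_self {w : CForm 2} (hw : IsReal11 w) (hp : IsPositive w) :
    star (k := 2) (l := 4) rfl w w = (2 : ℂ)⁻¹ • wedge w w := by
  rw [star_two hw hp hw, formInner_self hw hp]
  ext v
  change (2 : ℂ)⁻¹ * 3 * wedge w w v - wedge w w v = (2 : ℂ)⁻¹ * wedge w w v
  ring

end Strominger
end

noncomputable section
namespace Strominger

/-! ### The operator `g⁻¹δg` -/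

theorem complex_smul_eq (c : ℂ) (u : C3) : c • u = c.re • u + c.im • (Complex.I • u) := by
  funext i
  apply Complex.ext <;> simp [sub_eq_add_neg]


/-- The endomorphism which represents `β` with respect to the metric of `w`. -/
theorem exists_represent {w : CForm 2} (hw : IsReal11 w) (hp : IsPositive w) {β : CForm 2}
    (hβ : IsReal11 β) : ∃ A : C3 →ₗ[ℂ] C3,
      ∀ p q, w ![A p, Complex.I • q] = β ![q, Complex.I • p] := by
  let g : LinearMap.BilinForm ℝ C3 := LinearMap.mk₂ ℝ (fun u v => (w ![u, Complex.I • v]).re)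
    (fun u u' v => by
      change (bilinOfTwo w (u + u') (mulI v)).re = _
      rw [map_add]; rfl)
    (fun c u v => by
      change (bilinOfTwo w (c • u) (mulI v)).re = _
      rw [map_smul]; simp [bilinOfTwo_apply, mulI])
    (fun u v v' => by
      change (bilinOfTwo w u (mulI (v + v'))).re = _
      rw [map_add, map_add]; rfl)
    (fun c u v => by
      change (bilinOfTwo w u (mulI (c • v))).re = _
      rw [map_smul, map_smul]; simp [bilinOfTwo_apply, mulI])
  have hg : ∀ u v, g u v = (w ![u, Complex.I • v]).re := fun _ _ => rfl
  have hinj : Function.Injective g := by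
    rw [← LinearMap.ker_eq_bot, LinearMap.ker_eq_bot']
    intro u hu
    by_contra hne
    exact (hp u hne).ne' (by rw [← hg, hu]; rfl)
  let L : C3 →ₗ[ℝ] Module.Dual ℝ C3 := LinearMap.mk₂ ℝ (fun p q => (β ![q, Complex.I • p]).re)
    (fun v v' u => by
      change (bilinOfTwo β u (mulI (v + v'))).re = _
      rw [map_add, map_add]; rfl)
    (fun c v u => by
      change (bilinOfTwo β u (mulI (c • v))).re = _
      rw [map_smul, map_smul]; simp [bilinOfTwo_apply, mulI])
    (fun v u u' => by
      change (bilinOfTwo β (u + u') (mulI v)).re = _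
      rw [map_add]; rfl)
    (fun c v u => by
      change (bilinOfTwo β (c • u) (mulI v)).re = _
      rw [map_smul]; simp [bilinOfTwo_apply, mulI])
  have hfin : Module.finrank ℝ C3 = Module.finrank ℝ (Module.Dual ℝ C3) :=
    (Subspace.dual_finrank_eq).symm
  let G : C3 ≃ₗ[ℝ] Module.Dual ℝ C3 := LinearEquiv.ofInjectiveOfFinrankEq g hinj hfin
  let A : C3 →ₗ[ℝ] C3 := (G.symm : Module.Dual ℝ C3 →ₗ[ℝ] C3).comp L
  have hA : ∀ p q, w ![A p, Complex.I • q] = β ![q, Complex.I • p] := by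
    intro p q
    have h1 : g (A p) = L p := G.apply_symm_apply (L p)
    rw [← hw.ofReal_re, ← hβ.ofReal_re]
    exact congrArg _ (congrFun (congrArg DFunLike.coe h1) q)
  have hI : ∀ p, A (Complex.I • p) = Complex.I • A p := by
    intro p
    apply hinj
    refine LinearMap.ext fun q => ?_
    have h1 : w ![A (Complex.I • p), Complex.I • q] = w ![Complex.I • A p, Complex.I • q] := by
      rw [hA, hw.1, I_smul_I_smul, two_neg_right, ← hβ.1, ← hA, I_smul_I_smul, two_neg_right,
        neg_neg]
    exact congrArg Complex.re h1
  refine ⟨⟨A.toAddHom, fun c p => ?_⟩, hA⟩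
  change A (c • p) = c • A p
  rw [complex_smul_eq, map_add, map_smul, map_smul, hI, ← complex_smul_eq]

theorem sum_gramReal_inv_represent {w : CForm 2} (hw : IsReal11 w) (hp : IsPositive w)
    {β : CForm 2} {A : C3 →ₗ[ℂ] C3}
    (hA : ∀ p q, w ![A p, Complex.I • q] = β ![q, Complex.I • p]) (L : C3 →ₗ[ℝ] ℂ) (p : C3) :
    ∑ a, ∑ b, (gramReal w)⁻¹ a b * L (realBasis a) * β ![realBasis b, Complex.I • p] =
      L (A p) := by
  rw [← neg_neg (L (A p)), ← map_neg, ← I_smul_I_smul, ← sum_gramReal_inv_mul hw hp]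
  refine Finset.sum_congr rfl fun a _ => Finset.sum_congr rfl fun b _ => ?_
  rw [← hA, cform_two_swap, hw.apply_I_left, neg_neg]

theorem trace_re_eq (A : C3 →ₗ[ℂ] C3) :
    ∑ b, realCoord (A (realBasis b)) b = 2 * (LinearMap.trace ℂ C3 A).re := by
  have h : ∀ j, A (Pi.single j Complex.I) = Complex.I • A (Pi.single j 1) := fun j => by
    rw [← map_smul, ← Pi.single_smul, smul_eq_mul, mul_one]
  rw [LinearMap.trace_eq_matrix_trace ℂ (Pi.basisFun ℂ (Fin 3)), Matrix.trace,
    Fintype.sum_prod_type]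
  simp only [Fin.sum_univ_two, realCoord, realBasis, Fin.sum_univ_three, Matrix.diag]
  simp [h]
  ring

theorem trace_im_eq (A : C3 →ₗ[ℂ] C3) :
    ∑ b, realCoord (-(Complex.I • A (realBasis b))) b = 2 * (LinearMap.trace ℂ C3 A).im := by
  have h : ∀ j, A (Pi.single j Complex.I) = Complex.I • A (Pi.single j 1) := fun j => by
    rw [← map_smul, ← Pi.single_smul, smul_eq_mul, mul_one]
  rw [LinearMap.trace_eq_matrix_trace ℂ (Pi.basisFun ℂ (Fin 3)), Matrix.trace,
    Fintype.sum_prod_type]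
  simp only [Fin.sum_univ_two, realCoord, realBasis, Fin.sum_univ_three, Matrix.diag]
  simp [h]
  ring

theorem gramReal_inv_symm {w : CForm 2} (hw : IsReal11 w) (a b : Fin 3 × Fin 2) :
    (gramReal w)⁻¹ a b = (gramReal w)⁻¹ b a := by
  conv_lhs => rw [← gramReal_transpose hw, ← Matrix.transpose_nonsing_inv]
  rfl

theorem re_trace_represent {w : CForm 2} (hw : IsReal11 w) (hp : IsPositive w)
    {β : CForm 2} (hβ : IsReal11 β) {A : C3 →ₗ[ℂ] C3}
    (hA : ∀ p q, w ![A p, Complex.I • q] = β ![q, Complex.I • p]) :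
    ((LinearMap.trace ℂ C3 A).re : ℂ) = formInner w β w := by
  have hre : (2 : ℂ) * ((LinearMap.trace ℂ C3 A).re : ℂ) = 2 * formInner w β w := by
    rw [two_mul_formInner hw hp hβ]
    have h := congrArg (Complex.ofReal) (trace_re_eq A)
    push_cast at h
    rw [← h, Finset.sum_comm]
    refine Finset.sum_congr rfl fun b _ => ?_
    have h2 := gramReal_inv_raise hw hp (Complex.I • A (realBasis b)) b
    rw [I_smul_I_smul, neg_neg] at h2
    rw [← h2]
    refine Finset.sum_congr rfl fun a _ => ?_
    rw [gramReal_inv_symm hw, gramReal, ← hA, cform_two_swap, hw.apply_I_left, neg_neg]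
  exact mul_left_cancel₀ two_ne_zero hre

theorem formInner_im {w : CForm 2} (hw : IsReal11 w) (hp : IsPositive w)
    {β : CForm 2} (hβ : IsReal11 β) : (formInner w β w).im = 0 := by
  obtain ⟨A, hA⟩ := exists_represent hw hp hβ
  rw [← re_trace_represent hw hp hβ hA, Complex.ofReal_im]

theorem trace_represent {w : CForm 2} (hw : IsReal11 w) (hp : IsPositive w)
    {β : CForm 2} (hβ : IsReal11 β) {A : C3 →ₗ[ℂ] C3}
    (hA : ∀ p q, w ![A p, Complex.I • q] = β ![q, Complex.I • p]) :
    LinearMap.trace ℂ C3 A = formInner w β w := by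
  have hre := re_trace_represent hw hp hβ hA
  have him : (2 : ℂ) * ((LinearMap.trace ℂ C3 A).im : ℂ) = 0 := by
    have h := congrArg (Complex.ofReal) (trace_im_eq A)
    push_cast at h
    rw [← h]
    have h2 : ∀ b, (realCoord (-(Complex.I • A (realBasis b))) b : ℂ) =
        ∑ a, (gramReal w)⁻¹ b a * β ![realBasis a, realBasis b] := by
      intro b
      rw [← gramReal_inv_raise hw hp]
      refine Finset.sum_congr rfl fun a _ => ?_
      rw [cform_two_swap, ← neg_neg (w ![A (realBasis b), realBasis a]), ← two_neg_right,
        ← I_smul_I_smul, hA, hβ.1, neg_neg]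
    have h3 : ∑ b, ∑ a, (gramReal w)⁻¹ b a * β ![realBasis a, realBasis b] =
        -∑ b, ∑ a, (gramReal w)⁻¹ b a * β ![realBasis a, realBasis b] := by
      conv_lhs => rw [Finset.sum_comm]
      simp only [← Finset.sum_neg_distrib]
      refine Finset.sum_congr rfl fun a _ => Finset.sum_congr rfl fun b _ => ?_
      rw [gramReal_inv_symm hw, cform_two_swap]
      ring
    simp only [h2]
    linear_combination h3 / 2
  have h1 := Complex.re_add_im (LinearMap.trace ℂ C3 A)
  linear_combination -h1 + hre + Complex.I / 2 * him

/-! ### Complex trilinear forms -/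

/-- A form of type (3,0), as a complex alternating map. -/
def complexThree (O : CForm 3) (hO : ∀ u v w, O ![Complex.I • u, v, w] = Complex.I * O ![u, v, w]) :
    C3 [⋀^Fin 3]→ₗ[ℂ] ℂ :=
  have hI : ∀ (i : Fin 3) (v : Fin 3 → C3) (x : C3),
      O (Function.update v i (Complex.I • x)) = Complex.I * O (Function.update v i x) := by
    intro i v x
    have h0 : ∀ (v : Fin 3 → C3) (x : C3),
      O (Function.update v 0 (Complex.I • x)) = Complex.I * O (Function.update v 0 x) := by
      intro v x
      have e : ∀ y, Function.update v 0 y = ![y, v 1, v 2] := fun y => by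
        funext i; fin_cases i <;> rfl
      rw [e, e, hO]
    by_cases hi : i = 0
    · subst hi
      exact h0 v x
    · have hs : ∀ y, O (Function.update v i y) =
          -O (Function.update (v ∘ Equiv.swap i 0) 0 y) := by
        intro y
        have h := O.toAlternatingMap.map_swap (Function.update v i y) hi
        have e : Function.update v i y ∘ Equiv.swap i 0 =
            Function.update (v ∘ Equiv.swap i 0) 0 y := by
          rw [Function.update_comp_equiv]
          simp
        rw [e] at h
        exact (neg_eq_iff_eq_neg.2 h).symm
      rw [hs, hs, h0, mul_neg]
  { O with
    map_update_add' := by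
      intro inst v i x y
      obtain rfl : inst = instDecidableEqFin 3 := Subsingleton.elim _ _
      exact O.map_update_add v i x y
    map_update_smul' := by
      intro inst v i c x
      obtain rfl : inst = instDecidableEqFin 3 := Subsingleton.elim _ _
      change O (Function.update v i (c • x)) = c • O (Function.update v i x)
      rw [complex_smul_eq, O.map_update_add, O.map_update_smul, O.map_update_smul, hI]
      apply Complex.ext <;> simp [sub_eq_add_neg] }

theorem threeForm_eq_det {O : CForm 3}
    (hO : ∀ u v w, O ![Complex.I • u, v, w] = Complex.I * O ![u, v, w]) :
    ∃ K : ℂ, ∀ u v w, O ![u, v, w] = K * Matrix.det (Matrix.of ![u, v, w]) := by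
  refine ⟨complexThree O hO (Pi.basisFun ℂ (Fin 3)), fun u v w => ?_⟩
  have h := AlternatingMap.eq_smul_basis_det (Pi.basisFun ℂ (Fin 3)) (complexThree O hO)
  have h2 := congrArg (fun f : C3 [⋀^Fin 3]→ₗ[ℂ] ℂ => f ![u, v, w]) h
  rw [Pi.basisFun_det] at h2
  exact h2

theorem threeForm_derivation {O : CForm 3}
    (hO : ∀ u v w, O ![Complex.I • u, v, w] = Complex.I * O ![u, v, w]) (A : C3 →ₗ[ℂ] C3)
    (u v w : C3) : O ![A u, v, w] + O ![u, A v, w] + O ![u, v, A w] =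
      LinearMap.trace ℂ C3 A * O ![u, v, w] := by
  obtain ⟨K, hK⟩ := threeForm_eq_det hO
  have hA : ∀ u j, A u j = ∑ i, u i * A (Pi.single i 1) j := by
    intro u j
    conv_lhs => rw [← Finset.univ_sum_single u, map_sum, Finset.sum_apply]
    refine Finset.sum_congr rfl fun i _ => ?_
    rw [← mul_one (u i), ← smul_eq_mul, Pi.single_smul, map_smul, smul_eq_mul, mul_one]
    rfl
  rw [LinearMap.trace_eq_matrix_trace ℂ (Pi.basisFun ℂ (Fin 3)), Matrix.trace]
  simp only [hK, Matrix.det_fin_three, Fin.sum_univ_three, Matrix.diag, LinearMap.toMatrix_apply,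
    Pi.basisFun_apply, Pi.basisFun_repr, Matrix.of_apply]
  simp only [Matrix.cons_val_zero, Matrix.cons_val_one, Matrix.cons_val]
  simp only [hA u, hA v, hA w, Fin.sum_univ_three]
  ring

end Strominger
end

noncomputable section
namespace Strominger

open scoped Matrix.Norms.Operator

/-- Evaluation of forms on given vectors. -/
def evalL {k : ℕ} (v : Fin k → C3) : CForm k →L[ℝ] ℂ :=
  LinearMap.toContinuousLinearMap
    { toFun := fun α => α v, map_add' := fun _ _ => rfl, map_smul' := fun _ _ => rfl }

theorem sum_fin_three {I : Type*} [Fintype I] (F : (Fin 3 → I) → ℂ) :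
    ∑ a, F a = ∑ a₀, ∑ a₁, ∑ a₂, F ![a₀, a₁, a₂] := by
  let e : I × I × I ≃ (Fin 3 → I) :=
    { toFun := fun p => ![p.1, p.2.1, p.2.2]
      invFun := fun a => (a 0, a 1, a 2)
      left_inv := fun p => rfl
      right_inv := fun a => by funext i; fin_cases i <;> rfl }
  rw [← e.sum_comp, Fintype.sum_prod_type]
  simp only [Fintype.sum_prod_type]
  rfl

theorem three_eval (O : CForm 3) (v : Fin 3 → C3) (i : Fin 3) :
    ∃ L : C3 →ₗ[ℝ] ℂ, ∀ x, L x = O (Function.update v i x) :=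
  ⟨O.toMultilinearMap.toLinearMap v i, fun _ => rfl⟩

section NormVariation

variable {w β : CForm 2} {O : CForm 3}

theorem sum_gramReal_variation (hw : IsReal11 w) (hp : IsPositive w) {A : C3 →ₗ[ℂ] C3}
    (hA : ∀ p q, w ![A p, Complex.I • q] = β ![q, Complex.I • p]) (L : C3 →ₗ[ℝ] ℂ)
    (b : Fin 3 × Fin 2) :
    ∑ a, (-((gramReal w)⁻¹ * gramReal β * (gramReal w)⁻¹)) a b * L (realBasis a) =
      -∑ c, (gramReal w)⁻¹ c b * L (A (realBasis c)) := by
  simp only [← sum_gramReal_inv_represent hw hp hA, Matrix.neg_apply, Matrix.mul_apply, neg_mul,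
    Finset.sum_neg_distrib, Finset.mul_sum, Finset.sum_mul]
  congr 1
  rw [Finset.sum_comm]
  refine Finset.sum_congr rfl fun c _ => Finset.sum_congr rfl fun a _ =>
    Finset.sum_congr rfl fun d _ => ?_
  rw [gramReal]
  ring

theorem formInner_three_variation (hw : IsReal11 w) (hp : IsPositive w) (hβ : IsReal11 β)
    (hO : ∀ u v w, O ![Complex.I • u, v, w] = Complex.I * O ![u, v, w])
    (b : Fin 3 → Fin 3 × Fin 2) :
    (∑ a : Fin 3 → Fin 3 × Fin 2,
      ((gramReal w)⁻¹ (a 0) (b 0) * (gramReal w)⁻¹ (a 1) (b 1) *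
          (-((gramReal w)⁻¹ * gramReal β * (gramReal w)⁻¹)) (a 2) (b 2) +
        ((gramReal w)⁻¹ (a 0) (b 0) *
            (-((gramReal w)⁻¹ * gramReal β * (gramReal w)⁻¹)) (a 1) (b 1) +
          (-((gramReal w)⁻¹ * gramReal β * (gramReal w)⁻¹)) (a 0) (b 0) *
            (gramReal w)⁻¹ (a 1) (b 1)) * (gramReal w)⁻¹ (a 2) (b 2)) *
        O (fun i => realBasis (a i))) =
      -formInner w β w * ∑ a : Fin 3 → Fin 3 × Fin 2, (∏ i, (gramReal w)⁻¹ (a i) (b i)) *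
        O (fun i => realBasis (a i)) := by
  obtain ⟨A, hA⟩ := exists_represent hw hp hβ
  set p := (gramReal w)⁻¹ with hpdef
  set n := -(p * gramReal β * p) with hn
  have hslot : ∀ (L : C3 →ₗ[ℝ] ℂ) b, ∑ a, n a b * L (realBasis a) =
      -∑ c, p c b * L (A (realBasis c)) := fun L b => sum_gramReal_variation hw hp hA L b
  have hb : ∀ a₀ a₁ a₂, (fun i => realBasis (![a₀, a₁, a₂] i)) =
      ![realBasis a₀, realBasis a₁, realBasis a₂] := fun a₀ a₁ a₂ => by
    funext i; fin_cases i <;> rfl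
  simp only [sum_fin_three, Fin.prod_univ_three, Matrix.cons_val_zero, Matrix.cons_val_one,
    Matrix.cons_val, hb]
  have h0 : ∀ u v b, ∑ a, n a b * O ![realBasis a, u, v] =
      -∑ a, p a b * O ![A (realBasis a), u, v] := by
    intro u v b
    obtain ⟨L, hL⟩ := three_eval O ![0, u, v] 0
    have e : ∀ x, L x = O ![x, u, v] := fun x => (hL x).trans (congrArg O (by
      funext i; fin_cases i <;> rfl))
    simpa only [e] using hslot L b
  have h1 : ∀ u v b, ∑ a, n a b * O ![u, realBasis a, v] =
      -∑ a, p a b * O ![u, A (realBasis a), v] := by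
    intro u v b
    obtain ⟨L, hL⟩ := three_eval O ![u, 0, v] 1
    have e : ∀ x, L x = O ![u, x, v] := fun x => (hL x).trans (congrArg O (by
      funext i; fin_cases i <;> rfl))
    simpa only [e] using hslot L b
  have h2 : ∀ u v b, ∑ a, n a b * O ![u, v, realBasis a] =
      -∑ a, p a b * O ![u, v, A (realBasis a)] := by
    intro u v b
    obtain ⟨L, hL⟩ := three_eval O ![u, v, 0] 2
    have e : ∀ x, L x = O ![u, v, x] := fun x => (hL x).trans (congrArg O (by
      funext i; fin_cases i <;> rfl))
    simpa only [e] using hslot L b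
  have t2 : ∑ a₀, ∑ a₁, ∑ a₂, p a₀ (b 0) * p a₁ (b 1) * n a₂ (b 2) *
      O ![realBasis a₀, realBasis a₁, realBasis a₂] =
      -∑ a₀, ∑ a₁, ∑ a₂, p a₀ (b 0) * p a₁ (b 1) * p a₂ (b 2) *
      O ![realBasis a₀, realBasis a₁, A (realBasis a₂)] := by
    simp only [mul_assoc, ← Finset.mul_sum, h2, mul_neg, Finset.sum_neg_distrib]
  have t1 : ∑ a₀, ∑ a₁, ∑ a₂, p a₀ (b 0) * n a₁ (b 1) * p a₂ (b 2) *
      O ![realBasis a₀, realBasis a₁, realBasis a₂] =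
      -∑ a₀, ∑ a₁, ∑ a₂, p a₀ (b 0) * p a₁ (b 1) * p a₂ (b 2) *
      O ![realBasis a₀, A (realBasis a₁), realBasis a₂] := by
    rw [← Finset.sum_neg_distrib]
    refine Finset.sum_congr rfl fun a₀ _ => ?_
    rw [Finset.sum_comm]
    conv_rhs => rw [Finset.sum_comm]
    rw [← Finset.sum_neg_distrib]
    refine Finset.sum_congr rfl fun a₂ _ => ?_
    have e : ∀ a₁, p a₀ (b 0) * n a₁ (b 1) * p a₂ (b 2) *
        O ![realBasis a₀, realBasis a₁, realBasis a₂] = p a₀ (b 0) * p a₂ (b 2) *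
        (n a₁ (b 1) * O ![realBasis a₀, realBasis a₁, realBasis a₂]) := fun a₁ => by ring
    simp only [e, ← Finset.mul_sum, h1]
    rw [mul_neg, Finset.mul_sum]
    congr 1
    exact Finset.sum_congr rfl fun a₁ _ => by ring
  have t0 : ∑ a₀, ∑ a₁, ∑ a₂, n a₀ (b 0) * p a₁ (b 1) * p a₂ (b 2) *
      O ![realBasis a₀, realBasis a₁, realBasis a₂] =
      -∑ a₀, ∑ a₁, ∑ a₂, p a₀ (b 0) * p a₁ (b 1) * p a₂ (b 2) *
      O ![A (realBasis a₀), realBasis a₁, realBasis a₂] := by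
    rw [Finset.sum_comm]
    conv_rhs => rw [Finset.sum_comm]
    rw [← Finset.sum_neg_distrib]
    refine Finset.sum_congr rfl fun a₁ _ => ?_
    rw [Finset.sum_comm]
    conv_rhs => rw [Finset.sum_comm]
    rw [← Finset.sum_neg_distrib]
    refine Finset.sum_congr rfl fun a₂ _ => ?_
    have e : ∀ a₀, n a₀ (b 0) * p a₁ (b 1) * p a₂ (b 2) *
        O ![realBasis a₀, realBasis a₁, realBasis a₂] = p a₁ (b 1) * p a₂ (b 2) *
        (n a₀ (b 0) * O ![realBasis a₀, realBasis a₁, realBasis a₂]) := fun a₀ => by ring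
    simp only [e, ← Finset.mul_sum, h0]
    rw [mul_neg, Finset.mul_sum]
    congr 1
    exact Finset.sum_congr rfl fun a₁ _ => by ring
  simp only [add_mul, Finset.sum_add_distrib]
  rw [t0, t1, t2]
  have hT : ∀ a₀ a₁ a₂, formInner w β w * O ![realBasis a₀, realBasis a₁, realBasis a₂] =
      O ![A (realBasis a₀), realBasis a₁, realBasis a₂] +
      O ![realBasis a₀, A (realBasis a₁), realBasis a₂] +
      O ![realBasis a₀, realBasis a₁, A (realBasis a₂)] := fun a₀ a₁ a₂ => by
    rw [← trace_represent hw hp hβ hA, threeForm_derivation hO]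
  rw [neg_mul, ← neg_eq_iff_eq_neg]
  simp only [Finset.mul_sum]
  have e : ∀ a₀ a₁ a₂, formInner w β w * (p a₀ (b 0) * p a₁ (b 1) * p a₂ (b 2) *
      O ![realBasis a₀, realBasis a₁, realBasis a₂]) = p a₀ (b 0) * p a₁ (b 1) * p a₂ (b 2) *
      (formInner w β w * O ![realBasis a₀, realBasis a₁, realBasis a₂]) := fun a₀ a₁ a₂ => by ring
  simp only [e, hT, mul_add, Finset.sum_add_distrib]
  ring

end NormVariation

section Families

variable {U : Set C3} {wt : ℝ → C3 → CForm 2} {δw : C3 → CForm 2} {O : C3 → CForm 3}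

theorem SmoothFamily.mul {f g : ℝ → C3 → ℂ} {f' g' : C3 → ℂ} (hf : SmoothFamily U f f')
    (hg : SmoothFamily U g g') :
    SmoothFamily U (fun t y => f t y * g t y) (fun y => f 0 y * g' y + f' y * g 0 y) :=
  hf.bilin (ContinuousLinearMap.mul ℝ ℂ) hg

theorem SmoothFamily.gramReal (h : SmoothFamily U wt δw) :
    SmoothFamily U (fun t y => Strominger.gramReal (wt t y))
      (fun y => Strominger.gramReal (δw y)) :=
  smoothFamily_matrix.2 fun a b => h.clm (evalL ![realBasis a, Complex.I • realBasis b])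

theorem SmoothFamily.formInner_three (h : SmoothFamily U wt δw)
    (hw : ∀ y ∈ U, IsReal11 (wt 0 y)) (hp : ∀ y ∈ U, IsPositive (wt 0 y))
    (hδ : ∀ y ∈ U, IsReal11 (δw y)) (hOs : ∀ y ∈ U, ContDiffAt ℝ ∞ O y)
    (hO : ∀ y ∈ U, ∀ u v w, O y ![Complex.I • u, v, w] = Complex.I * O y ![u, v, w]) :
    SmoothFamily U (fun t y => formInner (wt t y) (O y) (O y))
      (fun y => -formInner (wt 0 y) (δw y) (wt 0 y) * formInner (wt 0 y) (O y) (O y)) := by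
  have hg := smoothFamily_matrix.1
    (h.gramReal.matrix_inv fun y hy => isUnit_gramReal (hw y hy) (hp y hy))
  have hc : ∀ v v' : Fin 3 → C3, SmoothFamily U (fun _ y => O y v * conj (O y v')) (fun _ => 0) := by
    intro v v'
    refine smoothFamily_const fun y hy => ?_
    exact ((evalL v).contDiff.contDiffAt.comp y (hOs y hy)).mul
      (Complex.conjCLE.contDiff.contDiffAt.comp y
        ((evalL v').contDiff.contDiffAt.comp y (hOs y hy)))
  have hs : SmoothFamily U (fun t y => (6 : ℂ)⁻¹ * ∑ b : Fin 3 → Fin 3 × Fin 2,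
      ∑ a : Fin 3 → Fin 3 × Fin 2,
      ((Strominger.gramReal (wt t y))⁻¹ (a 0) (b 0) * (Strominger.gramReal (wt t y))⁻¹ (a 1) (b 1) *
        (Strominger.gramReal (wt t y))⁻¹ (a 2) (b 2)) *
      (O y (fun i => realBasis (a i)) * conj (O y (fun i => realBasis (b i))))) _ :=
    (SmoothFamily.sum (s := Finset.univ) fun b _ => SmoothFamily.sum (s := Finset.univ) fun a _ =>
      (((hg (a 0) (b 0)).mul (hg (a 1) (b 1))).mul (hg (a 2) (b 2))).mul
        (hc (fun i => realBasis (a i)) (fun i => realBasis (b i)))).clm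
      (ContinuousLinearMap.mul ℝ ℂ (6 : ℂ)⁻¹)
  have he : ∀ w : CForm 2, ∀ α : CForm 3, formInner w α α = (6 : ℂ)⁻¹ *
      ∑ b : Fin 3 → Fin 3 × Fin 2, ∑ a : Fin 3 → Fin 3 × Fin 2,
      ((Strominger.gramReal w)⁻¹ (a 0) (b 0) * (Strominger.gramReal w)⁻¹ (a 1) (b 1) *
        (Strominger.gramReal w)⁻¹ (a 2) (b 2)) *
      (α (fun i => realBasis (a i)) * conj (α (fun i => realBasis (b i)))) := by
    intro w α
    unfold formInner
    rw [Finset.sum_comm]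
    have : ((Nat.factorial 3 : ℕ) : ℂ) = 6 := by norm_num [Nat.factorial]
    rw [this]
    congr 1
    refine Finset.sum_congr rfl fun b _ => Finset.sum_congr rfl fun a _ => ?_
    rw [Fin.prod_univ_three, mul_assoc]
  have hs2 : SmoothFamily U (fun t y => formInner (wt t y) (O y) (O y)) _ :=
    hs.congr fun y hy => Filter.Eventually.of_forall fun p => he (wt p.1 p.2) (O p.2)
  refine hs2.congr_deriv fun y hy => ?_
  rw [he, ContinuousLinearMap.mul_apply', mul_left_comm]
  congr 1
  rw [Finset.mul_sum]
  refine Finset.sum_congr rfl fun b _ => ?_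
  have key := congrArg (fun x => x * conj (O y (fun i => realBasis (b i))))
    (formInner_three_variation (hw y hy) (hp y hy) (hδ y hy) (hO y hy) b)
  simp only [Fin.prod_univ_three, mul_assoc _ (Finset.sum _ _), Finset.sum_mul] at key
  simp only [mul_zero, zero_add]
  simpa only [mul_assoc] using key

theorem SmoothFamily.formNorm_three (h : SmoothFamily U wt δw)
    (hw : ∀ y ∈ U, IsReal11 (wt 0 y)) (hp : ∀ y ∈ U, IsPositive (wt 0 y))
    (hδ : ∀ y ∈ U, IsReal11 (δw y)) (hOs : ∀ y ∈ U, ContDiffAt ℝ ∞ O y)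
    (hO : ∀ y ∈ U, ∀ u v w, O y ![Complex.I • u, v, w] = Complex.I * O y ![u, v, w])
    (hn : ∀ y ∈ U, formNorm (wt 0 y) (O y) = 1) :
    SmoothFamily U (fun t y => (formNorm (wt t y) (O y) : ℂ))
      (fun y => -(2 : ℂ)⁻¹ * formInner (wt 0 y) (δw y) (wt 0 y)) := by
  have h1 : ∀ y ∈ U, (formInner (wt 0 y) (O y) (O y)).re = 1 := by
    intro y hy
    have := hn y hy
    unfold formNorm at this
    exact Real.sqrt_eq_one.1 this
  have him : ∀ y ∈ U, (formInner (wt 0 y) (δw y) (wt 0 y)).im = 0 :=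
    fun y hy => formInner_im (hw y hy) (hp y hy) (hδ y hy)
  have hs := (h.formInner_three hw hp hδ hOs hO).clm Complex.reCLM
  have hs2 := (hs.comp (Φ := Real.sqrt) fun y hy =>
    Real.contDiffAt_sqrt (by rw [Complex.reCLM_apply, h1 y hy]; exact one_ne_zero)).clm
    Complex.ofRealCLM
  refine hs2.congr_deriv fun y hy => ?_
  have hd : HasFDerivAt Real.sqrt _ (1 : ℝ) := (Real.hasDerivAt_sqrt one_ne_zero).hasFDerivAt
  have e1 : Complex.reCLM (formInner (wt 0 y) (O y) (O y)) = 1 := h1 y hy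
  rw [e1, hd.fderiv]
  apply Complex.ext
  · simp [h1 y hy, him y hy]
    ring
  · simp [him y hy]

end Families

end Strominger
end

noncomputable section
namespace Strominger

/-- The star operator, as a linear map. -/
def starL {k l : ℕ} (h : 6 = l + k) (w : CForm 2) : CForm k →L[ℝ] CForm l :=
  LinearMap.toContinuousLinearMap
    { toFun := star h w
      map_add' := fun α β => by
        unfold star
        refine Eq.trans ?_ (smul_add ((k.factorial : ℂ)⁻¹) _ _)
        refine congrArg ((k.factorial : ℂ)⁻¹ • ·) ?_
        refine (Finset.sum_congr rfl fun a _ => ?_).trans Finset.sum_add_distrib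
        refine (Finset.sum_congr rfl fun b _ => ?_).trans Finset.sum_add_distrib
        rw [ContinuousAlternatingMap.add_apply, mul_add]
        exact add_smul (R := ℂ) (M := CForm l) _ _ _
      map_smul' := fun c α => by
        simp only [star, ContinuousAlternatingMap.smul_apply, Complex.real_smul, RingHom.id_apply,
          mul_left_comm _ (c : ℂ), mul_smul, Finset.smul_sum]
        refine Finset.sum_congr rfl fun a _ => Finset.sum_congr rfl fun b _ => ?_
        rw [coe_smul_cform, smul_comm] }

theorem exists_clm_star {k l : ℕ} (h : 6 = l + k) (w : CForm 2) :
    ∃ T : CForm k →L[ℝ] CForm l, ∀ β, T β = star h w β := ⟨starL h w, fun _ => rfl⟩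

theorem star_smul {k l : ℕ} (h : 6 = l + k) (w : CForm 2) (c : ℂ) (β : CForm k) :
    star h w (c • β) = c • star h w β := by
  simp only [star, ContinuousAlternatingMap.smul_apply, smul_eq_mul,
    mul_left_comm _ c, mul_smul, Finset.smul_sum]
  refine Finset.sum_congr rfl fun a _ => Finset.sum_congr rfl fun b _ => ?_
  rw [smul_comm]

theorem extDeriv_congr_eventually {k : ℕ} {f g : C3 → CForm k} {z : C3}
    (h : f =ᶠ[nhds z] g) : extDeriv f z = extDeriv g z := by
  unfold extDeriv
  rw [h.fderiv_eq]

variable {U : Set C3} {wt : ℝ → C3 → CForm 2} {δw : C3 → CForm 2} {O : C3 → CForm 3}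

/-- `Λ_w β · w²/2` -/
def traceSquare (w β : C3 → CForm 2) (y : C3) : CForm 4 :=
  ((2 : ℂ)⁻¹ * formInner (w y) (β y) (w y)) • wedge (w y) (w y)

theorem _root_.ContDiffAt.strominger_wedge {k l : ℕ} {α : C3 → CForm k} {β : C3 → CForm l} {z : C3}
    (hα : ContDiffAt ℝ ∞ α z) (hβ : ContDiffAt ℝ ∞ β z) :
    ContDiffAt ℝ ∞ (fun y => wedge (α y) (β y)) z := by
  have h := (smoothFamily_const (U := {z}) (by simpa using hα)).wedge
    (smoothFamily_const (U := {z}) (by simpa using hβ))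
  exact h.contDiffAt_base rfl

variable (U wt δw O) in
/-- A family of metric forms, at whose initial metric the (3,0)-form `O` has norm one. -/
structure UnitFamily : Prop where
  isOpen : IsOpen U
  family : SmoothFamily U wt δw
  real : ∀ y ∈ U, IsReal11 (wt 0 y)
  pos : ∀ y ∈ U, IsPositive (wt 0 y)
  real_deriv : ∀ y ∈ U, IsReal11 (δw y)
  smooth : ∀ y ∈ U, ContDiffAt ℝ ∞ O y
  type : ∀ y ∈ U, ∀ u v w, O y ![Complex.I • u, v, w] = Complex.I * O y ![u, v, w]
  norm : ∀ y ∈ U, formNorm (wt 0 y) (O y) = 1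

section

variable {z : C3}

theorem UnitFamily.formNorm (h : UnitFamily U wt δw O) :
    SmoothFamily U (fun t y => (Strominger.formNorm (wt t y) (O y) : ℂ))
      (fun y => -(2 : ℂ)⁻¹ * formInner (wt 0 y) (δw y) (wt 0 y)) :=
  h.family.formNorm_three h.real h.pos h.real_deriv h.smooth h.type h.norm

theorem UnitFamily.contDiffAt_traceSquare (h : UnitFamily U wt δw O) (hz : z ∈ U) :
    ContDiffAt ℝ ∞ (traceSquare (wt 0) δw) z := by
  have hN := h.formNorm
  have hΛ : ContDiffAt ℝ ∞ (fun y => (2 : ℂ)⁻¹ * formInner (wt 0 y) (δw y) (wt 0 y)) z := by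
    have h1 := (hN.contDiffAt_deriv h.isOpen hz).neg
    refine h1.congr_of_eventuallyEq (Filter.Eventually.of_forall fun y => ?_)
    ring
  have hws : ContDiffAt ℝ ∞ (wt 0) z := h.family.contDiffAt_base hz
  exact ((smulL 4).contDiff.contDiffAt.comp z hΛ).clm_apply
      (((wedgeL 2 2).contDiff.contDiffAt.comp z hws).clm_apply hws)

theorem UnitFamily.hasDerivAt_extDeriv (h : UnitFamily U wt δw O) (hz : z ∈ U) :
    HasDerivAt (fun t => _root_.extDeriv (fun y => (Strominger.formNorm (wt t y) (O y) : ℂ) •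
          Strominger.wedge (wt t y) (wt t y)) z)
      ((2 : ℂ) • extDeriv (fun y => wedge (δw y) (wt 0 y)) z - extDeriv (traceSquare (wt 0) δw) z)
      0 := by
  have hN := h.formNorm
  have hf : SmoothFamily U (fun t y => (Strominger.formNorm (wt t y) (O y) : ℂ) •
      Strominger.wedge (wt t y) (wt t y))
      (fun y => (2 : ℝ) • wedge (δw y) (wt 0 y) - traceSquare (wt 0) δw y) := by
    refine (hN.smul (h.family.wedge h.family)).congr_deriv fun y hy => ?_
    rw [h.norm y hy, wedge_two_comm (wt 0 y) (δw y), traceSquare]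
    ext v
    simp only [ContinuousAlternatingMap.add_apply, ContinuousAlternatingMap.smul_apply,
      ContinuousAlternatingMap.sub_apply, smul_eq_mul, Complex.real_smul]
    push_cast
    ring
  refine ((hf.extDeriv h.isOpen).hasDerivAt hz).congr_deriv ?_
  have hws : ContDiffAt ℝ ∞ (wt 0) z := h.family.contDiffAt_base hz
  have hA := (h.contDiffAt_traceSquare hz).differentiableAt (by simp)
  have hB : DifferentiableAt ℝ (fun y => wedge (δw y) (wt 0 y)) z :=
    ((h.family.contDiffAt_deriv h.isOpen hz).strominger_wedge hws).differentiableAt (by simp)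
  have h2 : ∀ α : CForm 5, (2 : ℂ) • α = (2 : ℝ) • α := fun α => by
    rw [← coe_smul_cform]; push_cast; rfl
  refine Eq.trans ?_ (congrArg (· - extDeriv (traceSquare (wt 0) δw) z) (h2 _).symm)
  rw [extDeriv_eq, extDeriv_eq, extDeriv_eq, ← map_smul, ← map_sub]
  refine congrArg _ ((fderiv_fun_sub (hB.const_smul (2 : ℝ)) hA).trans ?_)
  exact congrArg (· - _) (fderiv_fun_const_smul hB (2 : ℝ))

theorem UnitFamily.extDeriv_star_two (h : UnitFamily U wt δw O) (hz : z ∈ U) :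
    extDeriv (fun y => star (k := 2) (l := 4) rfl (wt 0 y) (δw y)) z =
      extDeriv (traceSquare (wt 0) δw) z - extDeriv (fun y => wedge (δw y) (wt 0 y)) z := by
  have hws : ContDiffAt ℝ ∞ (wt 0) z := h.family.contDiffAt_base hz
  have hA := (h.contDiffAt_traceSquare hz).differentiableAt (by simp)
  have hB : DifferentiableAt ℝ (fun y => wedge (δw y) (wt 0 y)) z :=
    ((h.family.contDiffAt_deriv h.isOpen hz).strominger_wedge hws).differentiableAt (by simp)
  have : (fun y => star (k := 2) (l := 4) rfl (wt 0 y) (δw y)) =ᶠ[nhds z]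
      fun y => traceSquare (wt 0) δw y - wedge (δw y) (wt 0 y) := by
    filter_upwards [h.isOpen.mem_nhds hz] with y hy
    exact star_two (h.real y hy) (h.pos y hy) (h.real_deriv y hy)
  rw [extDeriv_congr_eventually this, extDeriv_eq, extDeriv_eq, extDeriv_eq, ← map_sub]
  exact congrArg _ (fderiv_fun_sub hA hB)

theorem extDeriv_star_trace (hU : IsOpen U) {w : C3 → CForm 2}
    (hw : ∀ y ∈ U, IsReal11 (w y)) (hp : ∀ y ∈ U, IsPositive (w y)) {z : C3} (hz : z ∈ U) :
    extDeriv (fun y => star (k := 2) (l := 4) rfl (w y)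
      (formInner (w y) (δw y) (w y) • w y)) z = extDeriv (traceSquare w δw) z := by
  refine extDeriv_congr_eventually ?_
  filter_upwards [hU.mem_nhds hz] with y hy
  rw [star_smul, star_two_self (hw y hy) (hp y hy), smul_smul, mul_comm]
  rfl

theorem clm_codiff_identity (T : CForm 5 →L[ℝ] CForm 1) (a b : CForm 5) :
    T ((2 : ℂ) • b - a) = (2 : ℂ) • -T (a - b) - -T a := by
  have h2 : ∀ k, ∀ α : CForm k, (2 : ℂ) • α = (2 : ℝ) • α := fun k α => by
    rw [← coe_smul_cform]; push_cast; rfl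
  rw [h2, h2, map_sub, map_sub, map_smul]
  module

theorem UnitFamily.hasDerivAt_clm_extDeriv (h : UnitFamily U wt δw O) (hz : z ∈ U)
    (T : CForm 5 →L[ℝ] CForm 1) :
    HasDerivAt (fun t => T (extDeriv (fun y => (Strominger.formNorm (wt t y) (O y) : ℂ) •
          wedge (wt t y) (wt t y)) z))
      ((2 : ℂ) • -T (extDeriv (fun y => star (k := 2) (l := 4) rfl (wt 0 y) (δw y)) z) -
        -T (extDeriv (fun y => star (k := 2) (l := 4) rfl (wt 0 y)
          (formInner (wt 0 y) (δw y) (wt 0 y) • wt 0 y)) z)) 0 := by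
  rw [h.extDeriv_star_two hz, extDeriv_star_trace h.isOpen h.real h.pos hz, ← clm_codiff_identity]
  exact T.hasFDerivAt.comp_hasDerivAt 0 (h.hasDerivAt_extDeriv hz)

theorem UnitFamily.hasDerivAt_star_extDeriv (h : UnitFamily U wt δw O) (hz : z ∈ U)
    {w : C3 → CForm 2} (h0 : wt 0 = w) {f : ℝ → CForm 1}
    (hf : ∀ t, f t = star (k := 5) (l := 1) rfl (w z)
        (extDeriv (fun y => (Strominger.formNorm (wt t y) (O y) : ℂ) •
          wedge (wt t y) (wt t y)) z)) :
    HasDerivAt f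
      ((2 : ℂ) • codiff w δw z
        - codiff w (fun y => formInner (w y) (δw y) (w y) • w y) z) 0 := by
  subst h0
  obtain ⟨T, hT⟩ := exists_clm_star (k := 5) (l := 1) rfl (wt 0 z)
  have h1 := h.hasDerivAt_clm_extDeriv hz T
  have e : ∀ α : C3 → CForm 2, codiff (wt 0) α z =
      -T (extDeriv (fun y => star (k := 2) (l := 4) rfl (wt 0 y) (α y)) z) := by
    intro α
    unfold codiff
    exact congrArg Neg.neg (hT _).symm
  have e2 : ∀ t, star (k := 5) (l := 1) rfl (wt 0 z)
        (extDeriv (fun y => (Strominger.formNorm (wt t y) (O y) : ℂ) •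
          wedge (wt t y) (wt t y)) z) = T (extDeriv (fun y => (Strominger.formNorm (wt t y) (O y) : ℂ) •
          wedge (wt t y) (wt t y)) z) := by
    intro t
    exact (hT _).symm
  rw [e, e]
  simp only [← e2, ← hf] at h1
  exact h1

end

end Strominger
end

noncomputable section
namespace Strominger

open scoped ComplexOrder

/-! ### Derivatives of the first two components -/

theorem hasDerivAt_wedge {p q : ℕ} {α : ℝ → CForm p} {β : ℝ → CForm q} {α' : CForm p} {β' : CForm q}
    (hα : HasDerivAt α α' 0) (hβ : HasDerivAt β β' 0) :
    HasDerivAt (fun t => wedge (α t) (β t)) (wedge (α 0) β' + wedge α' (β 0)) 0 :=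
  (wedgeL p q).hasDerivAt_of_bilinear (fun _ => hα) (fun _ => hβ)

theorem hasDerivAt_mtrace_mwedge {r : ℕ} {F : ℝ → MForm r 2} {D : MForm r 2}
    (h : ∀ i j, HasDerivAt (fun t => F t i j) (D i j) 0) :
    HasDerivAt (fun t => mtrace (mwedge (F t) (F t))) ((2 : ℂ) • mtrace (mwedge D (F 0))) 0 := by
  have h1 : HasDerivAt (fun t => mtrace (mwedge (F t) (F t)))
      (∑ i, ∑ l, (wedge (F 0 i l) (D l i) + wedge (D i l) (F 0 l i))) 0 :=
    HasDerivAt.fun_sum fun i _ => HasDerivAt.fun_sum fun l _ => hasDerivAt_wedge (h i l) (h l i)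
  refine h1.congr_deriv ?_
  simp only [Finset.sum_add_distrib]
  have h2 : ∑ i, ∑ l, wedge (F 0 i l) (D l i) = ∑ i, ∑ l, wedge (D i l) (F 0 l i) := by
    rw [Finset.sum_comm]
    exact Finset.sum_congr rfl fun i _ => Finset.sum_congr rfl fun l _ => wedge_two_comm _ _
  rw [h2]
  ext v
  change _ + _ = (2 : ℂ) * _
  rw [two_mul]
  rfl

theorem conj_swedge_apply {r p q : ℕ} (A B : Matrix (Fin r) (Fin r) ℂ) (T : MForm r p)
    (β : CForm q) (i j : Fin r) : swedge (rmul (lmul A T) B) β i j =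
      ∑ b, B b j • ∑ a, A i a • wedge (T a b) β := by
  simp only [swedge, rmul, lmul]
  have h : ∀ α : CForm p, wedge α β = (wedgeL p q).flip β α := fun _ => rfl
  have hs : ∀ (c : ℂ) (α : CForm p), (wedgeL p q).flip β (c • α) = c • (wedgeL p q).flip β α := by
    intro c α
    exact wedge_smul_left c α β
  simp only [h, map_sum, hs]

/-- If `F ∧ β = 0` then the derivative of `A⁻¹FB ∧ β` does not involve the derivatives of `A`, `B`. -/
theorem hasDerivAt_conj_swedge {r p q : ℕ} {A B : ℝ → Matrix (Fin r) (Fin r) ℂ}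
    {F : ℝ → MForm r p} {D : MForm r p} {β : ℝ → CForm q} {β' : CForm q}
    (hA : ∀ i j, DifferentiableAt ℝ (fun t => A t i j) 0)
    (hB : ∀ i j, DifferentiableAt ℝ (fun t => B t i j) 0)
    (hF : ∀ i j, HasDerivAt (fun t => F t i j) (D i j) 0) (hβ : HasDerivAt β β' 0)
    (h0 : ∀ i j, wedge (F 0 i j) (β 0) = 0) (i j : Fin r) :
    HasDerivAt (fun t => swedge (rmul (lmul (A t) (F t)) (B t)) (β t) i j)
      ((swedge (rmul (lmul (A 0) D) (B 0)) (β 0) +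
        swedge (rmul (lmul (A 0) (F 0)) (B 0)) β') i j) 0 := by
  simp only [conj_swedge_apply, Matrix.add_apply]
  have hs : ∀ {c : ℝ → ℂ} {α : ℝ → CForm (p + q)} {α' : CForm (p + q)}, DifferentiableAt ℝ c 0 →
      HasDerivAt α α' 0 → α 0 = 0 → HasDerivAt (fun t => c t • α t) (c 0 • α') 0 := by
    intro c α α' hc hα hα0
    have := (smulL (p + q)).hasDerivAt_of_bilinear (fun _ => hc.hasDerivAt) (fun _ => hα)
    refine this.congr_deriv ?_
    rw [hα0, map_zero, add_zero]
    rfl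
  have h1 : ∀ b, HasDerivAt (fun t => ∑ a, A t i a • wedge (F t a b) (β t))
      (∑ a, A 0 i a • (wedge (F 0 a b) β' + wedge (D a b) (β 0))) 0 := fun b =>
    HasDerivAt.fun_sum fun a _ => hs (hA i a) (hasDerivAt_wedge (hF a b) hβ) (h0 a b)
  have h2 : HasDerivAt (fun t => ∑ b, B t b j • ∑ a, A t i a • wedge (F t a b) (β t))
      (∑ b, B 0 b j • ∑ a, A 0 i a • (wedge (F 0 a b) β' + wedge (D a b) (β 0))) 0 :=
    HasDerivAt.fun_sum fun b _ => hs (hB b j) (h1 b)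
      (Finset.sum_eq_zero fun a _ => by
        rw [h0]; ext v; exact mul_zero _)
  refine h2.congr_deriv ?_
  have hadd : ∀ (c : ℂ) (x y : CForm (p + q)), c • (x + y) = c • x + c • y := fun c x y => by
    ext v; exact mul_add _ _ _
  simp only [hadd, Finset.sum_add_distrib]
  exact add_comm _ _

theorem wedge_eq_zero_of_conj {r p q : ℕ} {A B : Matrix (Fin r) (Fin r) ℂ} (hA : IsUnit A)
    (hB : IsUnit B) {F : MForm r p} {β : CForm q} (h : swedge (rmul (lmul A F) B) β = 0)
    (i j : Fin r) : wedge (F i j) β = 0 := by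
  ext v
  have h1 : A * mval (swedge F β) v * B = 0 := by
    ext i j
    have := congrArg (fun T : MForm r (p + q) => T i j v) h
    simp only [conj_swedge_apply] at this
    refine Eq.trans ?_ this
    simp only [Matrix.mul_apply, ContinuousAlternatingMap.sum_apply,
      ContinuousAlternatingMap.smul_apply, smul_eq_mul, Finset.sum_mul, Finset.mul_sum]
    refine Finset.sum_congr rfl fun b _ => Finset.sum_congr rfl fun a _ => ?_
    rw [mul_comm (B b j)]
    rfl
  have h2 : mval (swedge F β) v = 0 := by
    have h3 := (hB.mul_left_eq_zero).1 h1
    exact (hA.mul_right_eq_zero).1 h3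
  exact congrFun (congrFun h2 i) j

/-! ### Endomorphisms and pairings in a basis -/

section Basis

variable {r : ℕ} {W : Type*} [AddCommGroup W] [Module ℂ W] (b : Module.Basis (Fin r) ℂ W)

/-- The matrix of an endomorphism acting on the right. -/
def matOf (A : W →ₗ[ℂ] W) : Matrix (Fin r) (Fin r) ℂ := (LinearMap.toMatrix b b A).transpose

/-- The Gram matrix of a pairing. -/
def gramOf (k : W → W → ℂ) : Matrix (Fin r) (Fin r) ℂ := fun i j => k (b i) (b j)

theorem matOf_apply (A : W →ₗ[ℂ] W) (i j : Fin r) : matOf b A i j = b.repr (A (b i)) j := by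
  rw [matOf, Matrix.transpose_apply, LinearMap.toMatrix_apply]

theorem matOf_comp (A B : W →ₗ[ℂ] W) : matOf b (A ∘ₗ B) = matOf b B * matOf b A := by
  rw [matOf, LinearMap.toMatrix_comp b b b, Matrix.transpose_mul]; rfl

theorem matOf_injective : Function.Injective (matOf b) := fun _ _ h =>
  (LinearMap.toMatrix b b).injective (Matrix.transpose_injective h)

theorem det_matOf (A : W →ₗ[ℂ] W) : (matOf b A).det = LinearMap.det A := by
  rw [matOf, Matrix.det_transpose, LinearMap.det_toMatrix]

theorem trace_matOf (A : W →ₗ[ℂ] W) : (matOf b A).trace = LinearMap.trace ℂ W A := by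
  rw [matOf, Matrix.trace_transpose, LinearMap.trace_eq_matrix_trace ℂ b]

/-- The endomorphism with a given matrix. -/
def ofMat (M : Matrix (Fin r) (Fin r) ℂ) : W →ₗ[ℂ] W := Matrix.toLin b b M.transpose

@[simp] theorem matOf_ofMat (M : Matrix (Fin r) (Fin r) ℂ) : matOf b (ofMat b M) = M := by
  rw [matOf, ofMat, LinearMap.toMatrix_toLin, Matrix.transpose_transpose]

variable {b} {k : W → W → ℂ}

/-- A pairing which is linear in the first variable and hermitian. -/
structure IsHerm (k : W → W → ℂ) : Prop where
  add_left : ∀ u v w, k (u + v) w = k u w + k v w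
  smul_left : ∀ (c : ℂ) u v, k (c • u) v = c * k u v
  conj_symm : ∀ u v, conj (k u v) = k v u

theorem IsHerm.sum_left (hk : IsHerm k) (x : Fin r → ℂ) (w : W) :
    k (∑ i, x i • b i) w = ∑ i, x i * k (b i) w := by
  let L : W →ₗ[ℂ] ℂ := ⟨⟨fun u => k u w, fun u v => hk.add_left u v w⟩, fun c u => hk.smul_left c u w⟩
  change L _ = ∑ i, x i * L (b i)
  simp

theorem IsHerm.apply (hk : IsHerm k) (x y : Fin r → ℂ) :
    k (∑ i, x i • b i) (∑ i, y i • b i) = x ⬝ᵥ (gramOf b k).mulVec (Star.star y) := by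
  rw [hk.sum_left]
  refine Finset.sum_congr rfl fun i _ => ?_
  rw [← hk.conj_symm, hk.sum_left, map_sum, Matrix.mulVec, dotProduct]
  congr 1
  refine Finset.sum_congr rfl fun j _ => ?_
  rw [map_mul, hk.conj_symm, mul_comm]
  rfl

theorem IsHerm.gram_comp (hk : IsHerm k) (A : W →ₗ[ℂ] W) :
    gramOf b (fun u v => k (A u) v) = matOf b A * gramOf b k := by
  ext i j
  change k (A (b i)) (b j) = _
  conv_lhs => rw [← b.sum_repr (A (b i)), hk.sum_left]
  rw [Matrix.mul_apply]
  exact Finset.sum_congr rfl fun l _ => by rw [matOf_apply]; rfl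

theorem IsHerm.isHermitian (hk : IsHerm k) : (gramOf b k).IsHermitian := by
  ext i j
  exact hk.conj_symm _ _

theorem IsHerm.posDef_iff (hk : IsHerm k) :
    (gramOf b k).PosDef ↔ ∀ u, u ≠ 0 → 0 < (k u u).re := by
  have hval : ∀ x : Fin r → ℂ, k (∑ i, x i • b i) (∑ i, x i • b i) =
      Star.star (Star.star x) ⬝ᵥ (gramOf b k).mulVec (Star.star x) := fun x => by
    rw [hk.apply, star_star]
  have him : ∀ u, (k u u).im = 0 := fun u => Complex.conj_eq_iff_im.1 (hk.conj_symm u u)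
  constructor
  · intro h u hu
    have hx : Star.star (b.equivFun u) ≠ 0 := by
      intro h0
      apply hu
      rw [star_eq_zero] at h0
      exact b.equivFun.map_eq_zero_iff.1 h0
    have := h.dotProduct_mulVec_pos hx
    rw [← hval] at this
    simp only [b.sum_equivFun] at this
    exact (Complex.pos_iff.1 this).1
  · intro h
    refine Matrix.PosDef.of_dotProduct_mulVec_pos hk.isHermitian fun x hx => ?_
    have hu : ∑ i, (Star.star x) i • b i ≠ 0 := by
      intro h0
      apply hx
      have : b.equivFun.symm (Star.star x) = 0 := by rw [b.equivFun_symm_apply]; exact h0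
      rw [LinearEquiv.map_eq_zero_iff, star_eq_zero] at this
      exact this
    have h1 := hval (Star.star x)
    rw [_root_.star_star x] at h1
    rw [← h1]
    exact Complex.pos_iff.2 ⟨h _ hu, (him _).symm⟩

/-- Endomorphisms symmetric with respect to a hermitian pairing give hermitian pairings. -/
theorem IsHerm.comp (hk : IsHerm k) {A : W →ₗ[ℂ] W} (hA : ∀ u v, k (A u) v = k u (A v)) :
    IsHerm fun u v => k (A u) v where
  add_left u v w := by rw [map_add, hk.add_left]
  smul_left c u v := by rw [map_smul, hk.smul_left]
  conj_symm u v := by rw [hk.conj_symm, hA]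

theorem IsHerm.symm_of_isHermitian (hk : IsHerm k) {A : W →ₗ[ℂ] W}
    (hA : (matOf b A * gramOf b k).IsHermitian) (u v : W) : k (A u) v = k u (A v) := by
  have h : ∀ i j, k (A (b i)) (b j) = k (b i) (A (b j)) := by
    intro i j
    have := congrFun (congrFun hA.eq i) j
    rw [← hk.gram_comp] at this
    rw [← hk.conj_symm (A (b j))]
    exact this.symm
  have h1 : ∀ (x : Fin r → ℂ) (w : W), k (A (∑ i, x i • b i)) w = ∑ i, x i * k (A (b i)) w := by
    intro x w
    let L : W →ₗ[ℂ] ℂ := ⟨⟨fun u => k u w, fun u v => hk.add_left u v w⟩,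
      fun c u => hk.smul_left c u w⟩
    change L _ = ∑ i, x i * L (A (b i))
    simp
  rw [← b.sum_repr u, ← b.sum_repr v, h1, hk.sum_left]
  refine Finset.sum_congr rfl fun i _ => ?_
  congr 1
  rw [← hk.conj_symm, ← hk.conj_symm _ (b i), hk.sum_left, h1]
  congr 1
  refine Finset.sum_congr rfl fun j _ => ?_
  rw [← h]

theorem exists_isSqrt (hk : IsHerm k) (hpos : ∀ u, u ≠ 0 → 0 < (k u u).re) {A : W →ₗ[ℂ] W}
    (b : Module.Basis (Fin r) ℂ W)
    (hA : ∀ u v, k (A u) v = k u (A v)) (hAp : ∀ u, u ≠ 0 → 0 < (k (A u) u).re) :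
    ∃ S, IsSqrt k A S := by
  have hG := (hk.posDef_iff (b := b)).2 hpos
  have hM := ((hk.comp hA).posDef_iff (b := b)).2 hAp
  rw [hk.gram_comp] at hM
  obtain ⟨S, hSS, hS⟩ := exists_sqrt_of_posDef_mul hG hM
  have hs : ∀ u v, k (ofMat b S u) v = k u (ofMat b S v) :=
    hk.symm_of_isHermitian (b := b) (by rw [matOf_ofMat]; exact hS.isHermitian)
  refine ⟨ofMat b S, hs, ?_, matOf_injective b ?_⟩
  · rw [← (hk.comp hs).posDef_iff (b := b), hk.gram_comp, matOf_ofMat]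
    exact hS
  · rw [matOf_comp, matOf_ofMat, hSS]

end Basis

end Strominger
end

noncomputable section
namespace Strominger

open Matrix
open scoped Matrix.Norms.Operator
open scoped ComplexOrder

section Parallel

variable {r : ℕ} {G S A B : C3 → Matrix (Fin r) (Fin r) ℂ} {z : C3} {U : Set C3}

/-- The values of `dprime`. -/
def dprimeVal (G A : C3 → Matrix (Fin r) (Fin r) ℂ) (y v : C3) : Matrix (Fin r) (Fin r) ℂ :=
  pdel A y v + A y * (pdel G y v * (G y)⁻¹) - pdel G y v * (G y)⁻¹ * A y

theorem contDiffAt_dprimeVal (hG : ContDiffAt ℝ ∞ G z) (hu : IsUnit (G z))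
    (hA : ContDiffAt ℝ ∞ A z) (v : C3) : ContDiffAt ℝ ∞ (fun y => dprimeVal G A y v) z := by
  have h1 := contDiffAt_pdel (m := ∞) (by rfl) hG v
  have h2 := contDiffAt_pdel (m := ∞) (by rfl) hA v
  have h3 := h1.mul (contDiffAt_matrix_inv hG hu)
  exact (h2.add (hA.mul h3)).sub (h3.mul hA)

theorem eventually_dprime (hU : IsOpen U) (hz : z ∈ U) (hG : ∀ y ∈ U, ContDiffAt ℝ ∞ G y)
    (hA : ∀ y ∈ U, ContDiffAt ℝ ∞ A y) (v : C3) :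
    (fun y => mval (dprime G A y) (fun _ => v)) =ᶠ[nhds z] fun y => dprimeVal G A y v := by
  filter_upwards [hU.mem_nhds hz] with y hy
  exact mval_dprime ((hG y hy).differentiableAt (by simp)) ((hA y hy).differentiableAt (by simp)) v

theorem mval_mdelbar_dprime (hU : IsOpen U) (hz : z ∈ U) (hG : ∀ y ∈ U, ContDiffAt ℝ ∞ G y)
    (hu : IsUnit (G z)) (hA : ∀ y ∈ U, ContDiffAt ℝ ∞ A y) (u v : C3) :
    mval (k := 2) (mdelbar (dprime G A) z) ![u, v] =
      pdelbar (fun y => dprimeVal G A y v) z u - pdelbar (fun y => dprimeVal G A y u) z v := by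
  have hs : ∀ v, ContDiffAt ℝ ∞ (fun y => mval (dprime G A y) (fun _ => v)) z := fun v =>
    (contDiffAt_dprimeVal (hG z hz) hu (hA z hz) v).congr_of_eventuallyEq
      (eventually_dprime hU hz hG hA v)
  rw [mval_mdelbar (fun i j => (contDiffAt_mform_one hs i j).differentiableAt (by simp))
    (fun v => (hs v).differentiableAt (by simp)),
    pdelbar_congr (eventually_dprime hU hz hG hA v),
    pdelbar_congr (eventually_dprime hU hz hG hA u)]

theorem mdel_congr (h : A =ᶠ[nhds z] B) : mdel A z = mdel B z := by
  funext i j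
  unfold mdel del
  have : (zeroForm fun y => A y i j) =ᶠ[nhds z] zeroForm fun y => B y i j := by
    filter_upwards [h] with x hx
    simp only [zeroForm, hx]
  rw [this.fderiv_eq]

theorem mdelbar_dprime_congr (h : A =ᶠ[nhds z] B) :
    mdelbar (dprime G A) z = mdelbar (dprime G B) z := by
  funext i j
  have h1 : ∀ᶠ y in nhds z, dprime G A y = dprime G B y := by
    filter_upwards [h.eventually_nhds] with y hy
    have h2 : mdel A y = mdel B y := mdel_congr hy
    simp only [dprime, h2, hy.self_of_nhds]
  unfold mdelbar delbar
  have h3 : (fun y => dprime G A y i j) =ᶠ[nhds z] fun y => dprime G B y i j := by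
    filter_upwards [h1] with y hy
    rw [hy]
  rw [h3.fderiv_eq]

theorem mdelbar_dprime_congr_gram {G₁ G₂ : C3 → Matrix (Fin r) (Fin r) ℂ} (h : G₁ =ᶠ[nhds z] G₂) :
    mdelbar (dprime G₁ A) z = mdelbar (dprime G₂ A) z := by
  funext i j
  have h1 : ∀ᶠ y in nhds z, dprime G₁ A y = dprime G₂ A y := by
    filter_upwards [h.eventually_nhds] with y hy
    have h2 : mdel G₁ y = mdel G₂ y := mdel_congr hy
    simp only [dprime, chernConn, h2, hy.self_of_nhds]
  unfold mdelbar delbar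
  have h3 : (fun y => dprime G₁ A y i j) =ᶠ[nhds z] fun y => dprime G₂ A y i j := by
    filter_upwards [h1] with y hy
    rw [hy]
  rw [h3.fderiv_eq]

theorem pdel_conjTranspose (hA : DifferentiableAt ℝ A z) (v : C3) :
    pdel (fun y => (A y)ᴴ) z v = (pdelbar A z v)ᴴ := by
  let L : Matrix (Fin r) (Fin r) ℂ →L[ℝ] Matrix (Fin r) (Fin r) ℂ :=
    LinearMap.toContinuousLinearMap
      { toFun := fun M => Mᴴ
        map_add' := fun _ _ => conjTranspose_add _ _
        map_smul' := fun c M => by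
          ext i j
          simp }
  have h : HasFDerivAt (fun y => (A y)ᴴ) (L.comp (fderiv ℝ A z)) z := L.hasFDerivAt.comp z
    hA.hasFDerivAt
  have h1 : ∀ w, fderiv ℝ (fun y => (A y)ᴴ) z w = (fderiv ℝ A z w)ᴴ := fun w =>
    DFunLike.congr_fun h.fderiv w
  rw [pdel, pdelbar, h1, h1]
  ext i j
  simp [sub_eq_add_neg]
  ring

theorem dprimeVal_mul (hA : DifferentiableAt ℝ A z) (hB : DifferentiableAt ℝ B z) (v : C3) :
    dprimeVal G (fun y => A y * B y) z v = dprimeVal G A z v * B z + A z * dprimeVal G B z v := by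
  simp only [dprimeVal, pdel_mul hA hB]
  noncomm_ring

theorem pdelbar_eq_zero_of_sq (hS : DifferentiableAt ℝ S z) (hG : (G z).PosDef)
    (hSG : (S z * G z).PosDef) {v : C3} (h : pdelbar (fun y => S y * S y) z v = 0) :
    pdelbar S z v = 0 := by
  rw [pdelbar_mul hS hS, add_comm] at h
  exact eq_zero_of_sylvester hG (rePos_of_posDef hSG) (rePos_of_posDef hSG) h

theorem mul_eq_of_isHermitian {S G : Matrix (Fin r) (Fin r) ℂ} (hG : G.PosDef)
    (hSG : (S * G).PosDef) : S * G = G * Sᴴ := by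
  have := hSG.isHermitian.eq
  rw [conjTranspose_mul, hG.isHermitian.eq] at this
  exact this.symm

/-- A hermitian square root of a holomorphic metric endomorphism is parallel. -/
theorem dprimeVal_eq_zero (hU : IsOpen U) (hz : z ∈ U) (hG : ∀ y ∈ U, ContDiffAt ℝ ∞ G y)
    (hS : ∀ y ∈ U, ContDiffAt ℝ ∞ S y) (hGp : ∀ y ∈ U, (G y).PosDef)
    (hSG : ∀ y ∈ U, (S y * G y).PosDef) (hSh : ∀ y ∈ U, ∀ v, pdelbar S y v = 0) (v : C3) :
    dprimeVal (fun y => S y * S y * G y) S z v = 0 := by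
  have hSd := (hS z hz).differentiableAt (by simp)
  have hGd := (hG z hz).differentiableAt (by simp)
  have hHd : DifferentiableAt ℝ (fun y => (S y)ᴴ) z := by
    have h1 : DifferentiableAt ℝ (fun y => (G y)⁻¹ * (S y * G y)) z :=
      ((contDiffAt_matrix_inv (hG z hz) (hGp z hz).isUnit).mul
        ((hS z hz).mul (hG z hz))).differentiableAt (by simp)
    refine h1.congr_of_eventuallyEq ?_
    filter_upwards [hU.mem_nhds hz] with y hy
    rw [mul_eq_of_isHermitian (hGp y hy) (hSG y hy),
      Matrix.nonsing_inv_mul_cancel_left _ _ ((isUnit_iff_isUnit_det _).1 (hGp y hy).isUnit)]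
  have hSu : IsUnit (S z) := by
    have h1 := (isUnit_iff_isUnit_det _).1 (hSG z hz).isUnit
    rw [det_mul] at h1
    exact (isUnit_iff_isUnit_det _).2 (isUnit_of_mul_isUnit_left h1)
  have hGdet := (isUnit_iff_isUnit_det _).1 (hGp z hz).isUnit
  have hSdet := (isUnit_iff_isUnit_det _).1 hSu
  have h1 : pdel S z v * G z + S z * pdel G z v = pdel G z v * (S z)ᴴ := by
    have e : (fun y => S y * G y) =ᶠ[nhds z] fun y => G y * (S y)ᴴ := by
      filter_upwards [hU.mem_nhds hz] with y hy
      exact mul_eq_of_isHermitian (hGp y hy) (hSG y hy)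
    have h2 := pdel_congr e v
    rw [pdel_mul hSd hGd, pdel_mul hGd hHd, pdel_conjTranspose hSd, hSh z hz v,
      conjTranspose_zero, Matrix.mul_zero, add_zero] at h2
    exact h2
  have hSH : (S z)ᴴ = (G z)⁻¹ * (S z * G z) := by
    rw [mul_eq_of_isHermitian (hGp z hz) (hSG z hz), Matrix.nonsing_inv_mul_cancel_left _ _ hGdet]
  have h3 : pdel S z v + S z * (pdel G z v * (G z)⁻¹) = pdel G z v * (G z)⁻¹ * S z := by
    have := congrArg (· * (G z)⁻¹) h1
    simp only [hSH, Matrix.add_mul] at this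
    rw [Matrix.mul_nonsing_inv_cancel_right _ _ hGdet] at this
    rw [← Matrix.mul_assoc (S z), this, Matrix.mul_assoc, Matrix.mul_assoc, Matrix.mul_assoc,
      Matrix.mul_nonsing_inv _ hGdet, Matrix.mul_one, Matrix.mul_assoc]
  have h4 : pdel (fun y => S y * S y * G y) z v * (S z * S z * G z)⁻¹ =
      pdel G z v * (G z)⁻¹ := by
    have h5 : pdel (fun y => S y * S y * G y) z v = pdel G z v * (G z)⁻¹ * (S z * S z * G z) := by
      have h6 : pdel G z v = pdel G z v * (G z)⁻¹ * G z := by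
        rw [Matrix.nonsing_inv_mul_cancel_right _ _ hGdet]
      rw [pdel_mul (A := fun y => S y * S y) (hSd.mul hSd) hGd, pdel_mul hSd hSd]
      calc _ = pdel S z v * (S z * G z) + S z * (pdel S z v * G z + S z * pdel G z v) := by
            noncomm_ring
        _ = pdel S z v * (S z * G z) + S z * (pdel G z v * (S z)ᴴ) := by rw [h1]
        _ = (pdel S z v + S z * (pdel G z v * (G z)⁻¹)) * (S z * G z) := by
            rw [hSH]; noncomm_ring
        _ = _ := by rw [h3]; noncomm_ring
    have hu : IsUnit (S z * S z * G z).det := by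
      rw [det_mul, det_mul]
      exact (hSdet.mul hSdet).mul hGdet
    rw [h5, Matrix.mul_nonsing_inv_cancel_right _ _ hu]
  rw [dprimeVal, h4, h3, sub_self]

theorem conj_mdelbar_dprime_of_parallel (hU : IsOpen U) (hz : z ∈ U)
    (hG : ∀ y ∈ U, ContDiffAt ℝ ∞ G y)
    (hS : ∀ y ∈ U, ContDiffAt ℝ ∞ S y) (hA : ∀ y ∈ U, ContDiffAt ℝ ∞ A y)
    (hGp : ∀ y ∈ U, (G y).PosDef) (hSG : ∀ y ∈ U, (S y * G y).PosDef)
    (hpar : ∀ y ∈ U, ∀ v, pdelbar (fun y => S y * S y) y v = 0) :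
    rmul (lmul (S z)⁻¹ (mdelbar (dprime (fun y => S y * S y * G y)
      (fun y => S y * A y * (S y)⁻¹)) z)) (S z) =
      mdelbar (dprime (fun y => S y * S y * G y) A) z := by
  have hSh : ∀ y ∈ U, ∀ v, pdelbar S y v = 0 := fun y hy v =>
    pdelbar_eq_zero_of_sq ((hS y hy).differentiableAt (by simp)) (hGp y hy) (hSG y hy)
      (hpar y hy v)
  have hSu : ∀ y ∈ U, IsUnit (S y) := by
    intro y hy
    have h1 := (isUnit_iff_isUnit_det _).1 (hSG y hy).isUnit
    rw [det_mul] at h1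
    exact (isUnit_iff_isUnit_det _).2 (isUnit_of_mul_isUnit_left h1)
  have hSi : ∀ y ∈ U, ContDiffAt ℝ ∞ (fun y => (S y)⁻¹) y := fun y hy =>
    contDiffAt_matrix_inv (hS y hy) (hSu y hy)
  set G₁ : C3 → Matrix (Fin r) (Fin r) ℂ := fun y => S y * S y * G y with hG₁
  have hG₁s : ∀ y ∈ U, ContDiffAt ℝ ∞ G₁ y := fun y hy =>
    ((hS y hy).mul (hS y hy)).mul (hG y hy)
  have hG₁u : ∀ y ∈ U, IsUnit (G₁ y) := fun y hy =>
    ((hSu y hy).mul (hSu y hy)).mul (hGp y hy).isUnit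
  have hdS : ∀ y ∈ U, ∀ v, dprimeVal G₁ S y v = 0 := fun y hy v =>
    dprimeVal_eq_zero hU hy hG hS hGp hSG hSh v
  have hdSi : ∀ y ∈ U, ∀ v, dprimeVal G₁ (fun y => (S y)⁻¹) y v = 0 := by
    intro y hy v
    have h0 := hdS y hy v
    have hd := (isUnit_iff_isUnit_det _).1 (hSu y hy)
    simp only [dprimeVal] at h0 ⊢
    set θ := pdel G₁ y v * (G₁ y)⁻¹
    rw [pdel_inv ((hS y hy).of_le (by simp)) (hSu y hy)]
    have h2 : pdel S y v = θ * S y - S y * θ := by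
      rw [← sub_eq_zero, ← h0]; noncomm_ring
    rw [h2, Matrix.mul_sub, Matrix.sub_mul, Matrix.nonsing_inv_mul_cancel_left _ _ hd,
      ← Matrix.mul_assoc (S y)⁻¹, Matrix.mul_nonsing_inv_cancel_right _ _ hd]
    abel
  have hval : ∀ y ∈ U, ∀ v, dprimeVal G₁ (fun y => S y * A y * (S y)⁻¹) y v =
      S y * dprimeVal G₁ A y v * (S y)⁻¹ := by
    intro y hy v
    have hSd := (hS y hy).differentiableAt (by simp)
    have hAd := (hA y hy).differentiableAt (by simp)
    rw [dprimeVal_mul (A := fun y => S y * A y) (hSd.mul hAd) ((hSi y hy).differentiableAt (by simp)),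
      dprimeVal_mul hSd hAd, hdS y hy, hdSi y hy]
    simp
  have hBs : ∀ y ∈ U, ContDiffAt ℝ ∞ (fun y => S y * A y * (S y)⁻¹) y := fun y hy =>
    ((hS y hy).mul (hA y hy)).mul (hSi y hy)
  have hd := (isUnit_iff_isUnit_det _).1 (hSu z hz)
  refine mform_two_ext fun u v => ?_
  have hdb : ∀ u v, pdelbar (fun y => dprimeVal G₁ (fun y => S y * A y * (S y)⁻¹) y v) z u =
      S z * pdelbar (fun y => dprimeVal G₁ A y v) z u * (S z)⁻¹ := by
    intro u v
    have e : (fun y => dprimeVal G₁ (fun y => S y * A y * (S y)⁻¹) y v) =ᶠ[nhds z]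
        fun y => S y * dprimeVal G₁ A y v * (S y)⁻¹ := by
      filter_upwards [hU.mem_nhds hz] with y hy
      exact hval y hy v
    have hSd := (hS z hz).differentiableAt (by simp)
    have hTd := (contDiffAt_dprimeVal (hG₁s z hz) (hG₁u z hz) (hA z hz) v).differentiableAt
      (by simp)
    rw [pdelbar_congr e, pdelbar_mul (A := fun y => S y * dprimeVal G₁ A y v) (hSd.mul hTd) ((hSi z hz).differentiableAt (by simp)),
      pdelbar_mul hSd hTd, pdelbar_inv ((hS z hz).of_le (by simp)) (hSu z hz), hSh z hz]
    simp
  rw [mval_rmul, mval_lmul, mval_mdelbar_dprime hU hz hG₁s (hG₁u z hz) hBs,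
    mval_mdelbar_dprime hU hz hG₁s (hG₁u z hz) hA, hdb, hdb, ← Matrix.sub_mul, ← Matrix.mul_sub,
    Matrix.mul_assoc (S z), Matrix.nonsing_inv_mul_cancel_left _ _ hd,
    Matrix.nonsing_inv_mul_cancel_right _ _ hd]

end Parallel

end Strominger
end

noncomputable section
namespace Strominger

open Matrix
open scoped Matrix.Norms.Operator
open scoped ComplexOrder

/-! ### The tangent bundle -/

/-- The hermitian pairing given by a real (1,1)-form. -/
theorem isHerm_tangent {w : CForm 2} (hw : IsReal11 w) :
    IsHerm fun u v : C3 => w ![u, Complex.I • v] - Complex.I * w ![u, v] where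
  add_left u u' v := by
    rw [← bilinOfTwo_apply, ← bilinOfTwo_apply, ← bilinOfTwo_apply, ← bilinOfTwo_apply,
      ← bilinOfTwo_apply, ← bilinOfTwo_apply, map_add]
    simp only [LinearMap.add_apply]
    ring
  smul_left c u v := by
    have h : ∀ v, w ![c • u, v] = c.re * w ![u, v] - c.im * w ![u, Complex.I • v] := by
      intro v
      rw [complex_smul_eq, ← bilinOfTwo_apply, map_add, map_smul, map_smul, LinearMap.add_apply,
        LinearMap.smul_apply, LinearMap.smul_apply, bilinOfTwo_apply, bilinOfTwo_apply,
        hw.apply_I_left, Complex.real_smul, Complex.real_smul]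
      ring
    rw [h, h, I_smul_I_smul, two_neg_right]
    linear_combination (w ![u, Complex.I • v] - Complex.I * w ![u, v]) * (Complex.re_add_im c)
      + c.im * w ![u, v] * Complex.I_sq
  conj_symm u v := by
    rw [map_sub, map_mul, Complex.conj_I, Complex.conj_eq_iff_im.2 (hw.2 _),
      Complex.conj_eq_iff_im.2 (hw.2 _), cform_two_swap w v u, cform_two_swap w v,
      hw.apply_I_left]
    ring

theorem tangentGram_posDef {w : C3 → CForm 2} {z : C3} (hw : IsReal11 (w z))
    (hp : IsPositive (w z)) : (tangentGram w z).PosDef := by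
  have h := ((isHerm_tangent hw).posDef_iff (b := Pi.basisFun ℂ (Fin 3))).2 fun u hu => by
    have h0 : w z ![u, u] = 0 := by
      have := cform_two_swap (w z) u u
      linear_combination this / 2
    rw [h0, mul_zero, sub_zero]
    exact hp u hu
  convert h using 1
  ext i j
  simp [tangentGram, gramOf]

theorem SmoothFamily.tangentGram {U : Set C3} {wt : ℝ → C3 → CForm 2} {δw : C3 → CForm 2}
    (h : SmoothFamily U wt δw) : SmoothFamily U (fun t => Strominger.tangentGram (wt t))
      (Strominger.tangentGram δw) :=
  smoothFamily_matrix.2 fun i j =>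
    (h.clm (evalL ![Pi.single i 1, Complex.I • Pi.single j 1])).sub
      ((h.clm (evalL ![Pi.single i 1, Pi.single j 1])).clm
        (ContinuousLinearMap.mul ℝ ℂ Complex.I))

/-! ### Patches -/

section Manifold

variable {X : Type*} [TopologicalSpace X] [ChartedSpace C3 X]
  {r : ℕ} {E : X → Type*} [∀ x, AddCommGroup (E x)] [∀ x, Module ℂ (E x)]
  [TopologicalSpace (TotalSpace (Fin r → ℂ) E)] [∀ x, TopologicalSpace (E x)]
  [FiberBundle (Fin r → ℂ) E]

omit [∀ x, AddCommGroup (E x)] [∀ x, Module ℂ (E x)] in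
theorem Patch.isOpen_dom (P : Patch r E) : IsOpen P.dom :=
  P.chart.isOpen_inter_preimage_symm P.triv.open_baseSet

variable (E) in
/-- The patch around a point. -/
def patchAt (x : X) : Patch r E where
  chart := chartAt C3 x
  chart_mem := chart_mem_atlas C3 x
  triv := trivializationAt (Fin r → ℂ) E x
  triv_mem := inferInstance

omit [∀ x, AddCommGroup (E x)] [∀ x, Module ℂ (E x)] in
theorem patchAt_mem (x : X) : chartAt C3 x x ∈ (patchAt (r := r) E x).dom := by
  refine ⟨(chartAt C3 x).map_source (mem_chart_source C3 x), ?_⟩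
  change (chartAt C3 x).symm (chartAt C3 x x) ∈ (trivializationAt (Fin r → ℂ) E x).baseSet
  rw [(chartAt C3 x).left_inv (mem_chart_source C3 x)]
  exact mem_baseSet_trivializationAt _ _ x

variable [VectorBundle ℂ (Fin r → ℂ) E]

/-- The frame of a patch, as a basis. -/
def Patch.basis (P : Patch r E) {z : C3} (hz : z ∈ P.dom) :
    Module.Basis (Fin r) ℂ (E (P.chart.symm z)) :=
  haveI := P.triv_mem
  haveI : P.triv.IsLinear ℂ := VectorBundle.trivialization_linear' P.triv
  Module.Basis.ofEquivFun (P.triv.linearEquivAt ℂ _ hz.2)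

theorem Patch.basis_apply (P : Patch r E) {z : C3} (hz : z ∈ P.dom) (i : Fin r) :
    P.basis hz i = P.frame z i := by
  unfold Patch.basis Patch.frame
  rw [Module.Basis.coe_ofEquivFun]
  congr 1

theorem Patch.mat_eq (P : Patch r E) {z : C3} (hz : z ∈ P.dom) (A : EndField E) :
    P.mat A z = matOf (P.basis hz) (A _) := by
  ext i j
  rw [matOf_apply, P.basis_apply hz]
  rfl

theorem Patch.gram_eq (P : Patch r E) {z : C3} (hz : z ∈ P.dom) (k : PairingField E) :
    P.gram k z = gramOf (P.basis hz) (k _) := by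
  ext i j
  rw [gramOf, P.basis_apply hz, P.basis_apply hz]
  rfl

theorem Patch.mat_comp (P : Patch r E) {z : C3} (hz : z ∈ P.dom) (A B : EndField E) :
    P.mat (fun x => A x ∘ₗ B x) z = P.mat B z * P.mat A z := by
  rw [P.mat_eq hz, P.mat_eq hz, P.mat_eq hz, matOf_comp]

theorem Patch.mat_add_smul (P : Patch r E) {z : C3} (hz : z ∈ P.dom) (A B : EndField E) (c : ℂ) :
    P.mat (fun x => A x + c • B x) z = P.mat A z + c • P.mat B z := by
  ext i j
  simp only [P.mat_eq hz, matOf_apply, LinearMap.add_apply, LinearMap.smul_apply, map_add, map_smul,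
    Finsupp.add_apply, Finsupp.smul_apply, Matrix.add_apply, Matrix.smul_apply]

omit [VectorBundle ℂ (Fin r → ℂ) E] in
theorem IsHermitianMetric.isHerm {k : PairingField E} (hk : IsHermitianMetric r k) (x : X) :
    IsHerm (k x) := ⟨hk.add_left x, hk.smul_left x, hk.conj_symm x⟩

variable {k : PairingField E} {H : EndField E}

theorem Patch.gram_posDef (P : Patch r E) {z : C3} (hz : z ∈ P.dom)
    (hk : IsHermitianMetric r k) : (P.gram k z).PosDef := by
  rw [P.gram_eq hz]
  exact (hk.isHerm _).posDef_iff.2 (hk.pos _)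

theorem Patch.gram_metricOf (P : Patch r E) {z : C3} (hz : z ∈ P.dom)
    (hk : IsHermitianMetric r k) (H : EndField E) :
    P.gram (metricOf k H) z = P.mat H z * P.gram k z := by
  rw [P.gram_eq hz, P.gram_eq hz, P.mat_eq hz, ← (hk.isHerm _).gram_comp]
  rfl

theorem Patch.mat_mul_gram_posDef (P : Patch r E) {z : C3} (hz : z ∈ P.dom)
    (hk : IsHermitianMetric r k) {A : EndField E}
    (hs : ∀ x u v, k x (A x u) v = k x u (A x v)) (hp : ∀ x u, u ≠ 0 → 0 < (k x (A x u) u).re) :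
    (P.mat A z * P.gram k z).PosDef := by
  rw [P.gram_eq hz, P.mat_eq hz, ← (hk.isHerm _).gram_comp]
  exact ((hk.isHerm _).comp (hs _)).posDef_iff.2 (hp _)

theorem isSqrt_sqrtEnd (hk : IsHermitianMetric r k) (hH : IsMetricOne r k H) (x : X) :
    IsSqrt (k x) (H x) (sqrtEnd k H x) := by
  have hb : ∃ _ : Module.Basis (Fin r) ℂ (E x), True := by
    have h := (patchAt (r := r) E x).basis (patchAt_mem x)
    have e : (patchAt (r := r) E x).chart.symm (chartAt C3 x x) = x :=
      (chartAt C3 x).left_inv (mem_chart_source C3 x)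
    rw [e] at h
    exact ⟨h, trivial⟩
  obtain ⟨b, -⟩ := hb
  have hex := exists_isSqrt (hk.isHerm x) (hk.pos x) b (hH.symm x) (hH.pos x)
  unfold sqrtEnd
  rw [dif_pos hex]
  exact hex.choose_spec

theorem Patch.sqrt_mul_self (P : Patch r E) {z : C3} (hz : z ∈ P.dom)
    (hk : IsHermitianMetric r k) (hH : IsMetricOne r k H) :
    P.mat (sqrtEnd k H) z * P.mat (sqrtEnd k H) z = P.mat H z := by
  rw [P.mat_eq hz, P.mat_eq hz, ← matOf_comp, (isSqrt_sqrtEnd hk hH _).2.2]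

theorem Patch.sqrt_mul_gram_posDef (P : Patch r E) {z : C3} (hz : z ∈ P.dom)
    (hk : IsHermitianMetric r k) (hH : IsMetricOne r k H) :
    (P.mat (sqrtEnd k H) z * P.gram k z).PosDef :=
  P.mat_mul_gram_posDef hz hk (fun x => (isSqrt_sqrtEnd hk hH x).1)
    (fun x => (isSqrt_sqrtEnd hk hH x).2.1)

theorem Patch.isUnit_sqrt (P : Patch r E) {z : C3} (hz : z ∈ P.dom)
    (hk : IsHermitianMetric r k) (hH : IsMetricOne r k H) : IsUnit (P.mat (sqrtEnd k H) z) := by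
  have h1 := (isUnit_iff_isUnit_det _).1 (P.sqrt_mul_gram_posDef hz hk hH).isUnit
  rw [det_mul] at h1
  exact (isUnit_iff_isUnit_det _).2 (isUnit_of_mul_isUnit_left h1)

omit [VectorBundle ℂ (Fin r → ℂ) E] in
theorem Patch.contDiffAt_gram (P : Patch r E) {z : C3} (hz : z ∈ P.dom)
    (hk : IsHermitianMetric r k) : ContDiffAt ℝ ∞ (P.gram k) z :=
  contDiffAt_matrix.2 fun i j => (hk.smooth P i j).contDiffAt (P.isOpen_dom.mem_nhds hz)

omit [VectorBundle ℂ (Fin r → ℂ) E] in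
theorem Patch.contDiffAt_mat (P : Patch r E) {z : C3} (hz : z ∈ P.dom) {A : EndField E}
    (hA : IsSmoothEnd r A) : ContDiffAt ℝ ∞ (P.mat A) z :=
  contDiffAt_matrix.2 fun i j => (hA P i j).contDiffAt (P.isOpen_dom.mem_nhds hz)

theorem Patch.contDiffAt_sqrt (P : Patch r E) {z : C3} (hz : z ∈ P.dom)
    (hk : IsHermitianMetric r k) (hH : IsMetricOne r k H) :
    ContDiffAt ℝ ∞ (P.mat (sqrtEnd k H)) z := by
  have hU := P.isOpen_dom.mem_nhds hz
  refine Strominger.contDiffAt_sqrt (by simp) (P.contDiffAt_mat hz hH.smooth)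
    (P.contDiffAt_gram hz hk).continuousAt ?_ ?_ ?_ <;> filter_upwards [hU] with y hy
  · exact P.gram_posDef hy hk
  · exact P.sqrt_mul_gram_posDef hy hk hH
  · exact P.sqrt_mul_self hy hk hH

/-- `H^{1/2}` depends smoothly on a parameter. -/
theorem Patch.contDiffAt_sqrt_family (P : Patch r E) {z : C3} (hz : z ∈ P.dom)
    (hk : IsHermitianMetric r k) {Ht : ℝ → EndField E} {ε : ℝ} (hε : 0 < ε)
    (hH : ∀ t ∈ Set.Ioo (-ε) ε, IsMetricOne r k (Ht t))
    (hs : ∀ i j, ContDiffOn ℝ ∞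
      (fun p : ℝ × C3 => P.mat (Ht p.1) p.2 i j) (Set.Ioo (-ε) ε ×ˢ P.dom)) :
    ContDiffAt ℝ ∞ (fun p : ℝ × C3 => P.mat (sqrtEnd k (Ht p.1)) p.2) (0, z) := by
  have hU : Set.Ioo (-ε) ε ×ˢ P.dom ∈ nhds ((0 : ℝ), z) :=
    (isOpen_Ioo.prod P.isOpen_dom).mem_nhds ⟨⟨by linarith, hε⟩, hz⟩
  have hM : ContDiffAt ℝ ∞ (fun p : ℝ × C3 => P.mat (Ht p.1) p.2) (0, z) :=
    contDiffAt_matrix.2 fun i j => (hs i j).contDiffAt hU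
  have hG : ContDiffAt ℝ ∞ (fun p : ℝ × C3 => P.gram k p.2) (0, z) :=
    ContDiffAt.comp (g := P.gram k) (f := Prod.snd) ((0 : ℝ), z) (P.contDiffAt_gram hz hk)
      contDiffAt_snd
  refine Strominger.contDiffAt_sqrt (by simp) hM hG.continuousAt ?_ ?_ ?_ <;>
    filter_upwards [hU] with p hp
  · exact P.gram_posDef hp.2 hk
  · exact P.sqrt_mul_gram_posDef hp.2 hk (hH _ hp.1)
  · exact P.sqrt_mul_self hp.2 hk (hH _ hp.1)

end Manifold

end Strominger
end

noncomputable section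
namespace Strominger

open Matrix
open scoped Matrix.Norms.Operator
open scoped ComplexOrder

section Variation

variable {X : Type*} [TopologicalSpace X] [ChartedSpace C3 X]
  {r : ℕ} {E : X → Type*} [∀ x, AddCommGroup (E x)] [∀ x, Module ℂ (E x)]
  [TopologicalSpace (TotalSpace (Fin r → ℂ) E)] [∀ x, TopologicalSpace (E x)]
  [FiberBundle (Fin r → ℂ) E] [VectorBundle ℂ (Fin r → ℂ) E]
  {k : PairingField E} {H δh : EndField E} {w₀ δw : FormField X 2}
  {ε : ℝ} {Ht : ℝ → EndField E} {wt : ℝ → FormField X 2}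

omit [VectorBundle ℂ (Fin r → ℂ) E] in
theorem IsVariation.prod_mem_nhds (h : IsVariation r k H w₀ δh δw ε Ht wt) {U : Set C3}
    (hU : IsOpen U) {z : C3} (hz : z ∈ U) : Set.Ioo (-ε) ε ×ˢ U ∈ nhds ((0 : ℝ), z) :=
  (isOpen_Ioo.prod hU).mem_nhds ⟨⟨by linarith [h.pos], h.pos⟩, hz⟩

omit [VectorBundle ℂ (Fin r → ℂ) E] in
theorem IsVariation.smoothFamily_form (h : IsVariation r k H w₀ δh δw ε Ht wt) (P : Patch r E) :
    SmoothFamily P.dom (fun t => inChart P.chart (wt t)) (inChart P.chart δw) := fun y hy =>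
  ⟨(h.smooth_w P.chart P.chart_mem).contDiffAt (h.prod_mem_nhds P.chart.open_target hy.1),
    h.deriv_w P.chart P.chart_mem y hy.1⟩

omit [VectorBundle ℂ (Fin r → ℂ) E] in
theorem IsVariation.smoothFamily_mat (h : IsVariation r k H w₀ δh δw ε Ht wt) (P : Patch r E) :
    SmoothFamily P.dom (fun t => P.mat (Ht t)) (P.mat (deltaH k H δh)) :=
  smoothFamily_matrix.2 fun i j y hy =>
    ⟨(h.smooth_H P i j).contDiffAt (h.prod_mem_nhds P.isOpen_dom hy), h.deriv_H P y hy i j⟩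

/-- The Gram matrices of a smooth family of metrics. -/
theorem Patch.smoothFamily_gram (P : Patch r E) (hk : IsHermitianMetric r k)
    {δH : EndField E}
    (h : SmoothFamily P.dom (fun t => P.mat (Ht t)) (P.mat δH)) :
    SmoothFamily P.dom (fun t => P.gram (metricOf k (Ht t)))
      (fun y => P.mat δH y * P.gram k y) := by
  have hG : SmoothFamily P.dom (fun _ => P.gram k) (fun _ => 0) :=
    smoothFamily_const fun y hy => P.contDiffAt_gram hy hk
  have h1 : SmoothFamily P.dom (fun t y => P.mat (Ht t) y * P.gram k y)
      (fun y => P.mat δH y * P.gram k y) := fun y hy =>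
    ⟨(h y hy).1.mul (hG y hy).1, (h y hy).2.mul_const (P.gram k y)⟩
  refine h1.congr fun y hy => ?_
  have hU : Set.univ ×ˢ P.dom ∈ nhds ((0 : ℝ), y) :=
    (isOpen_univ.prod P.isOpen_dom).mem_nhds ⟨trivial, hy⟩
  filter_upwards [hU] with p hp
  exact P.gram_metricOf hp.2 hk (Ht p.1)

/-- The first variation of the curvature along `H^{1/2} δh H^{1/2}`. -/
theorem Patch.hasDerivAt_curvH (P : Patch r E) (hk : IsHermitianMetric r k)
    (hH : IsMetricOne r k H) (h0 : Ht 0 = H)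
    (h : SmoothFamily P.dom (fun t => P.mat (Ht t)) (P.mat (deltaH k H δh))) {z : C3}
    (hz : z ∈ P.dom) (i j : Fin r) :
    HasDerivAt (fun t => curvH P k (Ht t) z i j)
      (mdelbar (dprime (P.gram (metricOf k H))
        (fun y => P.mat (sqrtEnd k H) y * P.mat δh y * (P.mat (sqrtEnd k H) y)⁻¹)) z i j) 0 := by
  have hu : ∀ y ∈ P.dom, IsUnit (P.gram (metricOf k H) y) := fun y hy => by
    rw [P.gram_metricOf hy hk]
    exact (P.mat_mul_gram_posDef hy hk hH.symm hH.pos).isUnit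
  have h1 := (P.smoothFamily_gram hk h).hasDerivAt_curvature P.isOpen_dom
    (by rw [h0]; exact hu) hz i j
  rw [h0] at h1
  refine h1.congr_deriv ?_
  refine congrFun (congrFun (mdelbar_dprime_congr ?_) i) j
  filter_upwards [P.isOpen_dom.mem_nhds hz] with y hy
  have hGdet := (isUnit_iff_isUnit_det _).1 (P.gram_posDef hy hk).isUnit
  have hSdet := (isUnit_iff_isUnit_det _).1 (P.isUnit_sqrt hy hk hH)
  have e1 : P.mat (deltaH k H δh) y =
      P.mat (sqrtEnd k H) y * P.mat δh y * P.mat (sqrtEnd k H) y := by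
    rw [← P.mat_comp hy, ← P.mat_comp hy]
    rfl
  rw [P.gram_metricOf hy hk, e1, ← P.sqrt_mul_self hy hk hH, Matrix.mul_inv_rev,
    Matrix.mul_inv_rev, Matrix.mul_assoc _ (P.gram k y), ← Matrix.mul_assoc (P.gram k y),
    Matrix.mul_nonsing_inv _ hGdet, Matrix.one_mul, ← Matrix.mul_assoc,
    Matrix.mul_nonsing_inv_cancel_right _ _ hSdet]

theorem Patch.deltaF_eq (P : Patch r E) (hk : IsHermitianMetric r k)
    (hH : IsMetricOne r k H) (hδh : IsSmoothEnd r δh) {z : C3} (hz : z ∈ P.dom) :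
    deltaF P k H δh z = mdelbar (dprime (P.gram (metricOf k H))
        (fun y => P.mat (sqrtEnd k H) y * P.mat δh y * (P.mat (sqrtEnd k H) y)⁻¹)) z := by
  have hδ : ∀ y ∈ P.dom, ContDiffAt ℝ ∞ (P.mat (deltaH k H δh)) y := fun y hy => by
    have hS := P.contDiffAt_sqrt hy hk hH
    refine ((hS.mul (P.contDiffAt_mat hy hδh)).mul hS).congr_of_eventuallyEq ?_
    filter_upwards [P.isOpen_dom.mem_nhds hy] with x hx
    change _ = P.mat (sqrtEnd k H) x * P.mat δh x * P.mat (sqrtEnd k H) x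
    rw [← P.mat_comp hx, ← P.mat_comp hx]
    rfl
  have hfam : SmoothFamily P.dom
      (fun (t : ℝ) => P.mat (fun x => H x + (t : ℂ) • deltaH k H δh x)) (P.mat (deltaH k H δh)) := by
    have h1 : SmoothFamily P.dom (fun (t : ℝ) y => P.mat H y + t • P.mat (deltaH k H δh) y)
        (P.mat (deltaH k H δh)) := fun y hy =>
      ⟨ContDiffAt.add (ContDiffAt.comp (g := P.mat H) (f := Prod.snd) ((0 : ℝ), y)
          (P.contDiffAt_mat hy hH.smooth) contDiffAt_snd)
        (contDiffAt_fst.smul (ContDiffAt.comp (g := P.mat (deltaH k H δh)) (f := Prod.snd)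
          ((0 : ℝ), y) (hδ y hy) contDiffAt_snd)), by
        simpa using ((hasDerivAt_id (0 : ℝ)).smul_const (P.mat (deltaH k H δh) y)).const_add
          (P.mat H y)⟩
    refine h1.congr fun y hy => ?_
    have hU : Set.univ ×ˢ P.dom ∈ nhds ((0 : ℝ), y) :=
      (isOpen_univ.prod P.isOpen_dom).mem_nhds ⟨trivial, hy⟩
    filter_upwards [hU] with p hp
    exact P.mat_add_smul hp.2 _ _ _
  funext i j
  exact (P.hasDerivAt_curvH hk hH (by funext x; simp) hfam hz i j).deriv

/-- The curvature of the tangent bundle is differentiable along families of metrics. -/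
theorem hasDerivAt_tangentCurv {U : Set C3} (hU : IsOpen U) {wt : ℝ → C3 → CForm 2}
    {δw : C3 → CForm 2} (h : SmoothFamily U wt δw) (hw : ∀ y ∈ U, IsReal11 (wt 0 y))
    (hp : ∀ y ∈ U, IsPositive (wt 0 y)) {z : C3} (hz : z ∈ U) (i j : Fin 3) :
    HasDerivAt (fun t => tangentCurv (wt t) z i j) (deltaR (wt 0) δw z i j) 0 := by
  have hu : ∀ y ∈ U, IsUnit (tangentGram (wt 0) y) := fun y hy =>
    (tangentGram_posDef (hw y hy) (hp y hy)).isUnit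
  have h1 := h.tangentGram.hasDerivAt_curvature hU hu hz i j
  have hlin : SmoothFamily U (fun (t : ℝ) y => wt 0 y + t • δw y) δw := fun y hy =>
    ⟨ContDiffAt.add (ContDiffAt.comp (g := wt 0) (f := Prod.snd) ((0 : ℝ), y)
          (h.contDiffAt_base hy) contDiffAt_snd)
        (contDiffAt_fst.smul (ContDiffAt.comp (g := δw) (f := Prod.snd)
          ((0 : ℝ), y) (h.contDiffAt_deriv hU hy) contDiffAt_snd)), by
        simpa using ((hasDerivAt_id (0 : ℝ)).smul_const (δw y)).const_add (wt 0 y)⟩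
  have e0 : (fun y => wt 0 y + (0 : ℝ) • δw y) = wt 0 := by
    funext y
    exact (congrArg (wt 0 y + ·) (zero_smul ℝ (δw y))).trans (add_zero _)
  have h2 := hlin.tangentGram.hasDerivAt_curvature hU (by rw [e0]; exact hu) hz i j
  rw [e0] at h2
  refine h1.congr_deriv ?_
  exact h2.deriv.symm

end Variation

end Strominger
end

noncomputable section
namespace Strominger

open Matrix
open scoped Matrix.Norms.Operator
open scoped ComplexOrder

section Linearization

variable {X : Type*} [TopologicalSpace X] [ChartedSpace C3 X]
  {r : ℕ} {E : X → Type*} [∀ x, AddCommGroup (E x)] [∀ x, Module ℂ (E x)]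
  [TopologicalSpace (TotalSpace (Fin r → ℂ) E)] [∀ x, TopologicalSpace (E x)]
  [FiberBundle (Fin r → ℂ) E]
  {k : PairingField E} {H δh : EndField E} {w₀ δw : FormField X 2} {Ω : FormField X 3}
  {ε : ℝ} {Ht : ℝ → EndField E} {wt : ℝ → FormField X 2}

theorem IsVariation.unitFamily (h : IsVariation r k H w₀ δh δw ε Ht wt) (P : Patch r E)
    (hw₀ : IsHermitianForm w₀) (hΩ : IsHolomorphicThreeForm Ω)
    (hnorm : ∀ φ ∈ atlas C3 X, ∀ z ∈ φ.target, formNorm (inChart φ w₀ z) (inChart φ Ω z) = 1)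
    (hδw : IsReal11Form δw) :
    UnitFamily P.dom (fun t => inChart P.chart (wt t)) (inChart P.chart δw)
      (inChart P.chart Ω) := by
  have h0 := h.zero_w
  have hm := P.chart_mem
  refine ⟨P.isOpen_dom, h.smoothFamily_form P, ?_, ?_, ?_, ?_, ?_, ?_⟩ <;> intro y hy
  · simp only [h0]; exact (hw₀.1 _ hm).2 y hy.1
  · simp only [h0]; exact hw₀.2 _ hm y hy.1
  · exact (hδw _ hm).2 y hy.1
  · exact (hΩ _ hm).1.contDiffAt (P.chart.open_target.mem_nhds hy.1)
  · exact (hΩ _ hm).2.1 y hy.1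
  · simp only [h0]; exact hnorm _ hm y hy.1

theorem wedge_smul_right_two {r p : ℕ} (T : MForm r p) (α β : CForm 2) (i j : Fin r) :
    swedge T (wedge α β + wedge β α) i j = ((2 : ℂ) • swedge T (wedge α β)) i j := by
  rw [wedge_two_comm β α]
  change wedge (T i j) (wedge α β + wedge α β) = (2 : ℂ) • wedge (T i j) (wedge α β)
  rw [wedge_add_right]
  ext v
  exact (two_mul _).symm

theorem hasDerivAt_conj_swedge_sq {A B : ℝ → Matrix (Fin r) (Fin r) ℂ}
    {F : ℝ → MForm r 2} {D F₀ : MForm r 2} {w : ℝ → CForm 2} {w₀ δw : CForm 2}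
    {A₀ B₀ : Matrix (Fin r) (Fin r) ℂ} (hA₀ : A 0 = A₀) (hB₀ : B 0 = B₀) (hF₀ : F 0 = F₀)
    (hw₀ : w 0 = w₀)
    (hA : ∀ i j, DifferentiableAt ℝ (fun t => A t i j) 0)
    (hB : ∀ i j, DifferentiableAt ℝ (fun t => B t i j) 0)
    (hF : ∀ i j, HasDerivAt (fun t => F t i j) (D i j) 0) (hw : HasDerivAt w δw 0)
    (h0 : ∀ i j, wedge (F₀ i j) (wedge w₀ w₀) = 0) {f : ℝ → MForm r 6}
    (hf : ∀ t, f t = swedge (rmul (lmul (A t) (F t)) (B t)) (wedge (w t) (w t))) (i j : Fin r) :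
    HasDerivAt (fun t => f t i j)
      ((swedge (rmul (lmul A₀ D) B₀) (wedge w₀ w₀) +
        (2 : ℂ) • swedge (rmul (lmul A₀ F₀) B₀) (wedge w₀ δw) : MForm r 6) i j) 0 := by
  subst hA₀ hB₀ hF₀ hw₀
  have hd := hasDerivAt_conj_swedge hA hB hF (hasDerivAt_wedge hw hw) h0 i j
  rw [Matrix.add_apply, wedge_smul_right_two] at hd
  simp only [hf]
  exact hd

variable [VectorBundle ℂ (Fin r → ℂ) E]

theorem IsVariation.hasDerivAt_curvH (h : IsVariation r k H w₀ δh δw ε Ht wt) (P : Patch r E)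
    (hk : IsHermitianMetric r k) (hH : IsMetricOne r k H) (hδh : IsSmoothEnd r δh)
    {z : C3} (hz : z ∈ P.dom) (i j : Fin r) :
    HasDerivAt (fun t => curvH P k (Ht t) z i j) (deltaF P k H δh z i j) 0 := by
  rw [P.deltaF_eq hk hH hδh hz]
  exact P.hasDerivAt_curvH hk hH h.zero_H (h.smoothFamily_mat P) hz i j

omit [VectorBundle ℂ (Fin r → ℂ) E] in
theorem IsVariation.hasDerivAt_tangentCurv (h : IsVariation r k H w₀ δh δw ε Ht wt)
    (P : Patch r E) (hw₀ : IsHermitianForm w₀) {z : C3} (hz : z ∈ P.dom) (i j : Fin 3) :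
    HasDerivAt (fun t => tangentCurv (inChart P.chart (wt t)) z i j)
      (deltaR (inChart P.chart w₀) (inChart P.chart δw) z i j) 0 := by
  have h0 := h.zero_w
  subst h0
  exact Strominger.hasDerivAt_tangentCurv P.isOpen_dom (h.smoothFamily_form P)
    (fun y hy => (hw₀.1 _ P.chart_mem).2 y hy.1) (fun y hy => hw₀.2 _ P.chart_mem y hy.1) hz i j

theorem IsVariation.hasDerivAt_L1 (h : IsVariation r k H w₀ δh δw ε Ht wt) (P : Patch r E)
    (hk : IsHermitianMetric r k) (hH : IsMetricOne r k H)
    {z : C3} (hz : z ∈ P.dom) (hsol : L1 P k H w₀ z = 0) (i j : Fin r) :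
    HasDerivAt (fun t => L1 P k (Ht t) (wt t) z i j)
      ((swedge (conjSqrt P k H z
          (mdelbar (dprime (P.gram (metricOf k H))
            (fun y => P.mat (sqrtEnd k H) y * P.mat δh y * (P.mat (sqrtEnd k H) y)⁻¹)) z))
          (wedge (inChart P.chart w₀ z) (inChart P.chart w₀ z))
        + (2 : ℂ) • swedge (conjSqrt P k H z (curvH P k H z))
          (wedge (inChart P.chart w₀ z) (inChart P.chart δw z))) i j) 0 := by
  have h0 := h.zero_w
  have h1 := h.zero_H
  subst h0
  subst h1
  have hSu := P.isUnit_sqrt hz hk hH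
  have hSs := P.contDiffAt_sqrt_family hz hk h.pos h.mem_H (h.smooth_H P)
  have hSi := contDiffAt_matrix_inv hSs hSu
  have hw := (h.smoothFamily_form P).hasDerivAt hz
  have hF := fun i j => P.hasDerivAt_curvH hk hH rfl (h.smoothFamily_mat P) hz i j
  simp only [conjSqrt]
  exact hasDerivAt_conj_swedge_sq (A₀ := (P.mat (sqrtEnd k (Ht 0)) z)⁻¹)
    (B₀ := P.mat (sqrtEnd k (Ht 0)) z) (F₀ := curvH P k (Ht 0) z) (w₀ := inChart P.chart (wt 0) z)
    (A := fun t => (P.mat (sqrtEnd k (Ht t)) z)⁻¹) (B := fun t => P.mat (sqrtEnd k (Ht t)) z)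
    (F := fun t => curvH P k (Ht t) z) (w := fun t => inChart P.chart (wt t) z) rfl rfl rfl rfl
    (fun i j => (hasDerivAt_matrix.1 (hasDerivAt_slice (hSi.differentiableAt (by simp)))
      i j).differentiableAt)
    (fun i j => (hasDerivAt_matrix.1 (hasDerivAt_slice (hSs.differentiableAt (by simp)))
      i j).differentiableAt)
    hF hw (wedge_eq_zero_of_conj (Matrix.isUnit_nonsing_inv_iff.2 hSu) hSu hsol)
    (fun t => rfl) i j

theorem conjSqrt_of_parallel (P : Patch r E) (hk : IsHermitianMetric r k)
    (hH : IsMetricOne r k H) (hδh : IsSmoothEnd r δh)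
    (hpar : ∀ y ∈ P.dom, mdelbarZero (P.mat H) y = 0) {z : C3} (hz : z ∈ P.dom) :
    conjSqrt P k H z (mdelbar (dprime (P.gram (metricOf k H))
      (fun y => P.mat (sqrtEnd k H) y * P.mat δh y * (P.mat (sqrtEnd k H) y)⁻¹)) z) =
    mdelbar (dprime (P.gram (metricOf k H)) (P.mat δh)) z := by
  have hG : P.gram (metricOf k H) =ᶠ[nhds z] fun y =>
      P.mat (sqrtEnd k H) y * P.mat (sqrtEnd k H) y * P.gram k y := by
    filter_upwards [P.isOpen_dom.mem_nhds hz] with y hy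
    rw [P.gram_metricOf hy hk, P.sqrt_mul_self hy hk hH]
  rw [mdelbar_dprime_congr_gram hG, mdelbar_dprime_congr_gram hG]
  refine conj_mdelbar_dprime_of_parallel P.isOpen_dom hz
    (fun y hy => P.contDiffAt_gram hy hk) (fun y hy => P.contDiffAt_sqrt hy hk hH)
    (fun y hy => P.contDiffAt_mat hy hδh) (fun y hy => P.gram_posDef hy hk)
    (fun y hy => P.sqrt_mul_gram_posDef hy hk hH) fun y hy v => ?_
  have e : (fun y => P.mat (sqrtEnd k H) y * P.mat (sqrtEnd k H) y) =ᶠ[nhds y] P.mat H := by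
    filter_upwards [P.isOpen_dom.mem_nhds hy] with x hx
    exact P.sqrt_mul_self hx hk hH
  rw [pdelbar_congr e, ← mval_mdelbarZero
    ((P.contDiffAt_mat hy hH.smooth).differentiableAt (by simp)), hpar y hy]
  rfl

theorem IsVariation.hasDerivAt_L2 (h : IsVariation r k H w₀ δh δw ε Ht wt) (P : Patch r E)
    (hw₀ : IsHermitianForm w₀) (hk : IsHermitianMetric r k) (hH : IsMetricOne r k H)
    (hδh : IsSmoothEnd r δh) {z : C3} (hz : z ∈ P.dom) :
    HasDerivAt (fun t => L2 P k (Ht t) (wt t) z)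
      ((2 : ℂ)⁻¹ • extDeriv (dc (inChart P.chart δw)) z
        + (2 : ℂ) • (mtrace (mwedge (deltaF P k H δh z) (curvH P k H z))
          - mtrace (mwedge (deltaR (inChart P.chart w₀) (inChart P.chart δw) z)
              (tangentCurv (inChart P.chart w₀) z)))) 0 := by
  have hF := hasDerivAt_mtrace_mwedge (F := fun t => curvH P k (Ht t) z)
    fun i j => h.hasDerivAt_curvH P hk hH hδh hz i j
  have hR := hasDerivAt_mtrace_mwedge (F := fun t => tangentCurv (inChart P.chart (wt t)) z)
    fun i j => h.hasDerivAt_tangentCurv P hw₀ hz i j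
  have hd := ((((h.smoothFamily_form P).dc P.isOpen_dom).extDeriv P.isOpen_dom).const_smul
    (2 : ℂ)⁻¹).hasDerivAt hz
  refine (hd.add (hF.sub hR)).congr_deriv ?_
  rw [h.zero_H, h.zero_w]
  have h2 : ∀ (x y : CForm 4), (2 : ℂ) • x - (2 : ℂ) • y = (2 : ℂ) • (x - y) := fun x y => by
    ext v; exact (mul_sub _ _ _).symm
  exact congrArg (fun x : CForm 4 => _ + x) (h2 _ _)

omit [VectorBundle ℂ (Fin r → ℂ) E] in
theorem IsVariation.hasDerivAt_L3 (h : IsVariation r k H w₀ δh δw ε Ht wt) (P : Patch r E)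
    (hw₀ : IsHermitianForm w₀) (hΩ : IsHolomorphicThreeForm Ω)
    (hnorm : ∀ φ ∈ atlas C3 X, ∀ z ∈ φ.target, formNorm (inChart φ w₀ z) (inChart φ Ω z) = 1)
    (hδw : IsReal11Form δw) {z : C3} (hz : z ∈ P.dom) :
    HasDerivAt (fun t => L3 P.chart w₀ Ω (wt t) z)
      ((2 : ℂ) • codiff (inChart P.chart w₀) (inChart P.chart δw) z
        - codiff (inChart P.chart w₀)
            (fun y => formInner (inChart P.chart w₀ y) (inChart P.chart δw y)
              (inChart P.chart w₀ y) • inChart P.chart w₀ y) z) 0 := by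
  exact (h.unitFamily P hw₀ hΩ hnorm hδw).hasDerivAt_star_extDeriv hz
    (congrArg (inChart P.chart) h.zero_w) fun t => rfl

end Linearization

end Strominger
end

noncomputable section
namespace Strominger

open Matrix
open scoped Matrix.Norms.Operator
open scoped ComplexOrder

/-! ### The exponential of an endomorphism -/

section Basis

variable {r : ℕ} {W : Type*} [AddCommGroup W] [Module ℂ W] (b b' : Module.Basis (Fin r) ℂ W)

theorem exists_matOf_conj : ∃ Q : Matrix (Fin r) (Fin r) ℂ, IsUnit Q ∧
    ∀ A : W →ₗ[ℂ] W, matOf b A = Q * matOf b' A * Q⁻¹ := by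
  have h1 : (b'.toMatrix b)ᵀ * (b.toMatrix b')ᵀ = 1 := by
    rw [← transpose_mul, b.toMatrix_mul_toMatrix_flip, transpose_one]
  refine ⟨(b'.toMatrix b)ᵀ, IsUnit.of_mul_eq_one _ h1, fun A => ?_⟩
  rw [Matrix.inv_eq_right_inv h1, matOf, matOf,
    ← basis_toMatrix_mul_linearMap_toMatrix_mul_basis_toMatrix b b' b b' A, transpose_mul,
    transpose_mul, Matrix.mul_assoc]

/-- The exponential of an endomorphism, computed in a basis. -/
def expIn (A : W →ₗ[ℂ] W) : W →ₗ[ℂ] W := ofMat b (NormedSpace.exp (matOf b A))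

theorem matOf_expIn (A : W →ₗ[ℂ] W) :
    matOf b (expIn b' A) = NormedSpace.exp (matOf b A) := by
  obtain ⟨Q, hQ, h⟩ := exists_matOf_conj b b'
  rw [h, expIn, matOf_ofMat, h A, Matrix.exp_conj _ _ hQ]

variable {b} {k : W → W → ℂ}

theorem expIn_symm (hk : IsHerm k) (hpos : ∀ u, u ≠ 0 → 0 < (k u u).re) {A : W →ₗ[ℂ] W}
    (hA : ∀ u v, k (A u) v = k u (A v)) (u v : W) :
    k (expIn b A u) v = k u (expIn b A v) := by
  have hG := (hk.posDef_iff (b := b)).2 hpos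
  have hM := (hk.comp hA).isHermitian (b := b)
  rw [hk.gram_comp] at hM
  refine hk.symm_of_isHermitian (b := b) ?_ u v
  rw [matOf_expIn, IsHermitian, conjTranspose_mul, hG.isHermitian.eq]
  exact (exp_mul_of_isHermitian_mul hG hM).symm

theorem expIn_half_comp (A : W →ₗ[ℂ] W) :
    expIn b ((2 : ℂ)⁻¹ • A) ∘ₗ expIn b ((2 : ℂ)⁻¹ • A) = expIn b A := by
  apply matOf_injective b
  have hm : matOf b A = matOf b ((2 : ℂ)⁻¹ • A) + matOf b ((2 : ℂ)⁻¹ • A) := by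
    ext i j
    simp only [matOf_apply, LinearMap.smul_apply, map_smul, Finsupp.smul_apply, Matrix.add_apply,
      smul_eq_mul]
    ring
  rw [matOf_comp, matOf_expIn, matOf_expIn, hm, Matrix.exp_add_of_commute _ _ (Commute.refl _)]

theorem expIn_injective (A : W →ₗ[ℂ] W) : Function.Injective (expIn b A) := by
  have h : IsUnit (LinearMap.det (expIn b A)) := by
    rw [← det_matOf b, matOf_expIn]
    exact (isUnit_iff_isUnit_det _).1 (Matrix.isUnit_exp _)
  have : FiniteDimensional ℂ W := b.finiteDimensional_of_finite
  exact (LinearEquiv.ofIsUnitDet (f := expIn b A) (v := b) (v' := b) (by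
    rw [LinearMap.det_toMatrix]; exact h)).injective

theorem expIn_pos (hk : IsHerm k) (hpos : ∀ u, u ≠ 0 → 0 < (k u u).re) {A : W →ₗ[ℂ] W}
    (hA : ∀ u v, k (A u) v = k u (A v)) {u : W} (hu : u ≠ 0) : 0 < (k (expIn b A u) u).re := by
  have hs : ∀ u v, k (((2 : ℂ)⁻¹ • A) u) v = k u (((2 : ℂ)⁻¹ • A) v) := by
    intro u v
    rw [LinearMap.smul_apply, LinearMap.smul_apply, hk.smul_left, ← hk.conj_symm _ u,
      hk.smul_left, map_mul, hk.conj_symm, hA, map_inv₀, Complex.conj_ofNat]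
  rw [← expIn_half_comp, LinearMap.comp_apply, expIn_symm hk hpos hs]
  exact hpos _ fun h0 => hu (expIn_injective _ (h0.trans (map_zero _).symm))

theorem det_expIn (hk : IsHerm k) (hpos : ∀ u, u ≠ 0 → 0 < (k u u).re) {A : W →ₗ[ℂ] W}
    (hA : ∀ u v, k (A u) v = k u (A v)) :
    LinearMap.det (expIn b A) = Complex.exp (LinearMap.trace ℂ W A) := by
  have hG := (hk.posDef_iff (b := b)).2 hpos
  have hM := (hk.comp hA).isHermitian (b := b)
  rw [hk.gram_comp] at hM
  rw [← det_matOf b, matOf_expIn, det_exp_of_isHermitian_mul hG hM, trace_matOf]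

end Basis

section Manifold

variable {X : Type*} [TopologicalSpace X] [ChartedSpace C3 X]
  {r : ℕ} {E : X → Type*} [∀ x, AddCommGroup (E x)] [∀ x, Module ℂ (E x)]
  [TopologicalSpace (TotalSpace (Fin r → ℂ) E)] [∀ x, TopologicalSpace (E x)]
  [FiberBundle (Fin r → ℂ) E] [VectorBundle ℂ (Fin r → ℂ) E]
  {k : PairingField E} {H δh : EndField E}

variable (r E) in
/-- A basis of a fibre. -/
def fibreBasis (x : X) : Module.Basis (Fin r) ℂ (E x) :=
  Module.Basis.ofEquivFun ((trivializationAt (Fin r → ℂ) E x).linearEquivAt ℂ x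
    (mem_baseSet_trivializationAt _ _ x))

variable (r k H δh) in
/-- The curve `H^{1/2} exp(t δh) H^{1/2}`. -/
def expCurve (t : ℝ) : EndField E := fun x =>
  sqrtEnd k H x ∘ₗ expIn (fibreBasis r E x) ((t : ℂ) • δh x) ∘ₗ sqrtEnd k H x

omit [ChartedSpace C3 X] in
theorem expCurve_apply (t : ℝ) (x : X) (u : E x) : expCurve r k H δh t x u =
    sqrtEnd k H x (expIn (fibreBasis r E x) ((t : ℂ) • δh x) (sqrtEnd k H x u)) := rfl

theorem mat_expCurve (P : Patch r E) {z : C3} (hz : z ∈ P.dom) (t : ℝ) :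
    P.mat (expCurve r k H δh t) z =
      P.mat (sqrtEnd k H) z * NormedSpace.exp (t • P.mat δh z) * P.mat (sqrtEnd k H) z := by
  have h : P.mat (fun x => expIn (fibreBasis r E x) ((t : ℂ) • δh x)) z =
      NormedSpace.exp (t • P.mat δh z) := by
    rw [P.mat_eq hz, matOf_expIn]
    congr 1
    ext i j
    rw [Matrix.smul_apply, P.mat_eq hz]
    simp only [matOf_apply, LinearMap.smul_apply, map_smul, Finsupp.smul_apply]
    exact (Complex.real_smul).symm
  rw [← h, ← P.mat_comp hz, ← P.mat_comp hz]
  rfl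

theorem expCurve_zero (hk : IsHermitianMetric r k) (hH : IsMetricOne r k H) :
    expCurve r k H δh 0 = H := by
  funext x
  have h : expIn (fibreBasis r E x) (((0 : ℝ) : ℂ) • δh x) = LinearMap.id := by
    apply matOf_injective (fibreBasis r E x)
    rw [matOf_expIn]
    simp [matOf, NormedSpace.exp_zero]
  rw [expCurve, h, LinearMap.id_comp]
  exact (isSqrt_sqrtEnd hk hH x).2.2

theorem contDiff_exp_matrix : ContDiff ℝ ∞ (NormedSpace.exp : Matrix (Fin r) (Fin r) ℂ → _) :=
  contDiff_iff_contDiffAt.2 fun x => (NormedSpace.exp_analytic (𝕂 := ℝ) x).contDiffAt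

theorem contDiffAt_expCurve (P : Patch r E) (hk : IsHermitianMetric r k)
    (hH : IsMetricOne r k H) (hδh : IsSmoothEnd r δh) {z : C3} (hz : z ∈ P.dom) (t : ℝ) :
    ContDiffAt ℝ ∞ (fun p : ℝ × C3 => P.mat (expCurve r k H δh p.1) p.2) (t, z) := by
  have hS : ContDiffAt ℝ ∞ (fun p : ℝ × C3 => P.mat (sqrtEnd k H) p.2) (t, z) :=
    ContDiffAt.comp (g := P.mat (sqrtEnd k H)) (f := Prod.snd) (t, z)
      (P.contDiffAt_sqrt hz hk hH) contDiffAt_snd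
  have hh : ContDiffAt ℝ ∞ (fun p : ℝ × C3 => P.mat δh p.2) (t, z) :=
    ContDiffAt.comp (g := P.mat δh) (f := Prod.snd) (t, z) (P.contDiffAt_mat hz hδh) contDiffAt_snd
  have he : ContDiffAt ℝ ∞ (fun p : ℝ × C3 => NormedSpace.exp (p.1 • P.mat δh p.2)) (t, z) :=
    ContDiffAt.comp (g := NormedSpace.exp) (f := fun p : ℝ × C3 => p.1 • P.mat δh p.2) (t, z)
      contDiff_exp_matrix.contDiffAt (contDiffAt_fst.smul hh)
  refine ((hS.mul he).mul hS).congr_of_eventuallyEq ?_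
  have hU : Set.univ ×ˢ P.dom ∈ nhds (t, z) :=
    (isOpen_univ.prod P.isOpen_dom).mem_nhds ⟨trivial, hz⟩
  filter_upwards [hU] with p hp
  exact mat_expCurve P hp.2 p.1

theorem hasDerivAt_expCurve (P : Patch r E) {z : C3} (hz : z ∈ P.dom) (i j : Fin r) :
    HasDerivAt (fun t => P.mat (expCurve r k H δh t) z i j) (P.mat (deltaH k H δh) z i j) 0 := by
  refine hasDerivAt_matrix.1 ?_ i j
  have h1 := hasDerivAt_exp_smul_const (𝕂 := ℝ) (P.mat δh z) (0 : ℝ)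
  rw [zero_smul, NormedSpace.exp_zero, one_mul] at h1
  have h2 := (h1.const_mul (P.mat (sqrtEnd k H) z)).mul_const (P.mat (sqrtEnd k H) z)
  have e : P.mat (deltaH k H δh) z =
      P.mat (sqrtEnd k H) z * P.mat δh z * P.mat (sqrtEnd k H) z := by
    rw [← P.mat_comp hz, ← P.mat_comp hz]
    rfl
  rw [e]
  exact h2.congr_of_eventuallyEq (Filter.Eventually.of_forall fun t => mat_expCurve P hz t)

theorem isMetricOne_expCurve (hk : IsHermitianMetric r k) (hH : IsMetricOne r k H)
    (hδh : IsHerZero r k δh) (t : ℝ) : IsMetricOne r k (expCurve r k H δh t) := by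
  have hs : ∀ x u v, k x (((t : ℂ) • δh x) u) v = k x u (((t : ℂ) • δh x) v) := by
    intro x u v
    have hx := hk.isHerm x
    rw [LinearMap.smul_apply, LinearMap.smul_apply, hx.smul_left, ← hx.conj_symm _ u,
      hx.smul_left, map_mul, hx.conj_symm, hδh.symm]
    simp
  refine ⟨fun P i j z hz => ?_, fun x u v => ?_, fun x u hu => ?_, fun x => ?_⟩
  · have h1 : ContDiffAt ℝ ∞ (fun y : C3 => P.mat (expCurve r k H δh t) y) z :=
      ContDiffAt.comp (g := fun p : ℝ × C3 => P.mat (expCurve r k H δh p.1) p.2)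
        (f := fun y : C3 => (t, y)) z (contDiffAt_expCurve P hk hH hδh.smooth hz t)
        (contDiffAt_const.prodMk contDiffAt_id)
    exact (contDiffAt_matrix.1 h1 i j).contDiffWithinAt
  · obtain ⟨h1, -, -⟩ := isSqrt_sqrtEnd hk hH x
    rw [expCurve_apply, expCurve_apply, h1, expIn_symm (hk.isHerm x) (hk.pos x) (hs x), h1]
  · obtain ⟨h1, h2, -⟩ := isSqrt_sqrtEnd hk hH x
    rw [expCurve_apply, h1]
    refine expIn_pos (hk.isHerm x) (hk.pos x) (hs x) fun h0 => ?_
    have h3 := h2 u hu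
    rw [h0] at h3
    have : k x 0 u = 0 := by
      have := (hk.isHerm x).smul_left 0 0 u
      rwa [zero_smul, zero_mul] at this
    rw [this] at h3
    simp at h3
  · obtain ⟨-, -, h3⟩ := isSqrt_sqrtEnd hk hH x
    have h4 := congrArg LinearMap.det h3
    rw [LinearMap.det_comp, hH.det] at h4
    rw [expCurve, LinearMap.det_comp, LinearMap.det_comp, det_expIn (hk.isHerm x) (hk.pos x) (hs x),
      map_smul, hδh.trace, smul_zero, Complex.exp_zero, one_mul, h4]

end Manifold

end Strominger
end

noncomputable section
namespace Strominger

/-! ### Linear curves of hermitian forms -/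

theorem isOpen_isPositive : IsOpen {w : CForm 2 | IsPositive w} := by
  refine isOpen_forall_pos (Q := fun (w : CForm 2) (u : C3) => (w ![u, Complex.I • u]).re) ?_ ?_
  · refine Complex.continuous_re.comp ?_
    refine ContinuousEval.continuous_eval.comp (f := fun p : CForm 2 × C3 =>
      (p.1, (![p.2, Complex.I • p.2] : Fin 2 → C3))) (continuous_fst.prodMk ?_)
    refine continuous_pi fun i => ?_
    fin_cases i
    · exact continuous_snd
    · exact continuous_snd.const_smul Complex.I
  · intro w c u
    have h : (![c • u, Complex.I • c • u] : Fin 2 → C3) =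
        fun i => c • (![u, Complex.I • u] : Fin 2 → C3) i := by
      funext i
      fin_cases i
      · rfl
      · exact smul_comm _ _ _
    have h2 : w ![c • u, Complex.I • c • u] = (c ^ 2 : ℝ) • w ![u, Complex.I • u] := by
      rw [h]
      exact (w.map_smul_univ (fun _ => c) _).trans (by simp)
    rw [h2, Complex.smul_re, smul_eq_mul]

section Manifold

variable {X : Type*} [TopologicalSpace X] [ChartedSpace C3 X] 

theorem exists_mfderiv_symm [IsManifold 𝓘(ℂ, C3) ω X] {φ : OpenPartialHomeomorph X C3}
    (hφ : φ ∈ atlas C3 X) {z : C3} (hz : z ∈ φ.target) : ∃ T : C3 ≃L[ℂ] C3,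
    (mfderiv 𝓘(ℝ, C3) 𝓘(ℝ, C3) φ.symm z : C3 →L[ℝ] C3) = (T : C3 →L[ℂ] C3).restrictScalars ℝ := by
  have hd := (mdifferentiable_of_mem_atlas (I := 𝓘(ℂ, C3)) hφ).symm
  let T : C3 ≃L[ℂ] C3 := hd.mfderiv hz
  have h1 : HasMFDerivAt 𝓘(ℂ, C3) 𝓘(ℂ, C3) φ.symm z (T : C3 →L[ℂ] C3) :=
    (hd.mdifferentiableAt hz).hasMFDerivAt
  have h2 : HasMFDerivAt 𝓘(ℝ, C3) 𝓘(ℝ, C3) φ.symm z ((T : C3 →L[ℂ] C3).restrictScalars ℝ) :=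
    ⟨h1.1, HasFDerivWithinAt.restrictScalars ℝ h1.2⟩
  exact ⟨T, h2.mfderiv⟩

theorem isPositive_inChart_iff [IsManifold 𝓘(ℂ, C3) ω X] {φ : OpenPartialHomeomorph X C3}
    (hφ : φ ∈ atlas C3 X) {z : C3} (hz : z ∈ φ.target) (w : FormField X 2) :
    IsPositive (inChart φ w z) ↔ IsPositive (w (φ.symm z) : CForm 2) := by
  obtain ⟨T, hT⟩ := exists_mfderiv_symm hφ hz
  have h : ∀ u, inChart φ w z ![u, Complex.I • u] =
      (w (φ.symm z) : CForm 2) ![T u, Complex.I • T u] := by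
    intro u
    refine (congrArg (fun L : C3 →L[ℝ] C3 => (w (φ.symm z) : CForm 2).compContinuousLinearMap L
      ![u, Complex.I • u]) hT).trans (congrArg (w (φ.symm z) : CForm 2) (funext fun i => ?_))
    fin_cases i
    · rfl
    · exact T.map_smul _ _
  refine ⟨fun hp u hu => ?_, fun hp u hu => ?_⟩
  · have := hp (T.symm u) (by simpa using hu)
    rwa [h, T.apply_symm_apply] at this
  · rw [h]
    exact hp _ (by simpa using hu)

/-- The curve `w₀ + t δw`. -/
def lineCurve (w₀ δw : FormField X 2) (t : ℝ) : FormField X 2 :=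
  fun x => (w₀ x : CForm 2) + t • (δw x : CForm 2)

theorem lineCurve_zero (w₀ δw : FormField X 2) : lineCurve w₀ δw 0 = w₀ := by
  funext x
  exact (congrArg ((w₀ x : CForm 2) + ·) (zero_smul ℝ (δw x : CForm 2))).trans (add_zero _)

theorem inChart_lineCurve (φ : OpenPartialHomeomorph X C3) (w₀ δw : FormField X 2) (t : ℝ)
    (z : C3) : inChart φ (lineCurve w₀ δw t) z = inChart φ w₀ z + t • inChart φ δw z := rfl

variable {w₀ δw : FormField X 2}

theorem contDiffOn_lineCurve (hw₀ : IsReal11Form w₀) (hδw : IsReal11Form δw)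
    {φ : OpenPartialHomeomorph X C3} (hφ : φ ∈ atlas C3 X) (s : Set ℝ) :
    ContDiffOn ℝ ∞ (fun p : ℝ × C3 => inChart φ (lineCurve w₀ δw p.1) p.2) (s ×ˢ φ.target) := by
  have hm : Set.MapsTo Prod.snd (s ×ˢ φ.target) φ.target := fun p hp => hp.2
  exact ((hw₀ φ hφ).1.comp contDiffOn_snd hm).add
    (contDiffOn_fst.smul ((hδw φ hφ).1.comp contDiffOn_snd hm))

theorem isReal11Form_lineCurve (hw₀ : IsReal11Form w₀) (hδw : IsReal11Form δw) (t : ℝ) :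
    IsReal11Form (lineCurve w₀ δw t) := by
  refine fun φ hφ => ⟨(hw₀ φ hφ).1.add ((hδw φ hφ).1.const_smul t), fun z hz => ?_⟩
  obtain ⟨h1, h2⟩ := (hw₀ φ hφ).2 z hz
  obtain ⟨h3, h4⟩ := (hδw φ hφ).2 z hz
  rw [inChart_lineCurve]
  refine ⟨fun u v => ?_, fun v => ?_⟩
  · simp only [ContinuousAlternatingMap.add_apply, ContinuousAlternatingMap.smul_apply, h1, h3]
  · simp only [ContinuousAlternatingMap.add_apply, ContinuousAlternatingMap.smul_apply,
      Complex.add_im, Complex.smul_im, h2, h4, smul_zero, add_zero]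

theorem eventually_isHermitianForm_lineCurve [CompactSpace X] [IsManifold 𝓘(ℂ, C3) ω X]
    (hw₀ : IsHermitianForm w₀) (hδw : IsReal11Form δw) :
    ∀ᶠ t in nhds (0 : ℝ), IsHermitianForm (lineCurve w₀ δw t) := by
  have key : ∀ x₀ : X, ∀ᶠ p : ℝ × X in nhds (0, x₀),
      IsPositive (lineCurve w₀ δw p.1 p.2 : CForm 2) := by
    intro x₀
    set φ := chartAt C3 x₀ with hφ
    have ha : φ ∈ atlas C3 X := chart_mem_atlas C3 x₀
    have hx : x₀ ∈ φ.source := mem_chart_source C3 x₀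
    have hc : ContinuousAt (fun p : ℝ × C3 => inChart φ (lineCurve w₀ δw p.1) p.2) (0, φ x₀) :=
      (contDiffOn_lineCurve hw₀.1 hδw ha Set.univ).continuousOn.continuousAt
        ((isOpen_univ.prod φ.open_target).mem_nhds ⟨trivial, φ.map_source hx⟩)
    have h0 : IsPositive (inChart φ (lineCurve w₀ δw 0) (φ x₀)) := by
      rw [lineCurve_zero]
      exact hw₀.2 φ ha _ (φ.map_source hx)
    have hp := hc (isOpen_isPositive.mem_nhds h0)
    have hg : ContinuousAt (fun p : ℝ × X => (p.1, φ p.2)) (0, x₀) :=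
      continuousAt_fst.prodMk (ContinuousAt.comp (g := φ) (f := Prod.snd) (x := ((0 : ℝ), x₀))
        (φ.continuousAt hx) continuousAt_snd)
    have hs : ∀ᶠ p : ℝ × X in nhds (0, x₀), p.2 ∈ φ.source :=
      continuousAt_snd.eventually (φ.open_source.mem_nhds hx)
    filter_upwards [hg hp, hs] with p h1 h2
    have h3 := (isPositive_inChart_iff ha (φ.map_source h2) (lineCurve w₀ δw p.1)).1 h1
    rwa [φ.left_inv h2] at h3
  filter_upwards [isCompact_univ.eventually_forall_of_forall_eventually
    (P := fun t x => IsPositive (lineCurve w₀ δw t x : CForm 2)) fun x _ => key x] with t ht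
  exact ⟨isReal11Form_lineCurve hw₀.1 hδw t, fun φ hφ z hz =>
    (isPositive_inChart_iff hφ hz _).2 (ht _ trivial)⟩

variable {r : ℕ} {E : X → Type*} [∀ x, AddCommGroup (E x)] [∀ x, Module ℂ (E x)]
  [TopologicalSpace (TotalSpace (Fin r → ℂ) E)] [∀ x, TopologicalSpace (E x)]
  [FiberBundle (Fin r → ℂ) E] [VectorBundle ℂ (Fin r → ℂ) E]
  {k : PairingField E} {H δh : EndField E}

theorem exists_isVariation [CompactSpace X] [IsManifold 𝓘(ℂ, C3) ω X]
    (hk : IsHermitianMetric r k) (hH : IsMetricOne r k H) (hδh : IsHerZero r k δh)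
    (hw₀ : IsHermitianForm w₀) (hδw : IsReal11Form δw) :
    ∃ ε Ht wt, IsVariation r k H w₀ δh δw ε Ht wt := by
  obtain ⟨ε, hε, h⟩ := Metric.eventually_nhds_iff.1 (eventually_isHermitianForm_lineCurve hw₀ hδw)
  refine ⟨ε, expCurve r k H δh, lineCurve w₀ δw, hε, fun t _ => isMetricOne_expCurve hk hH hδh t,
    fun t ht => h ?_, fun P i j p hp => ?_, fun φ hφ => contDiffOn_lineCurve hw₀.1 hδw hφ _,
    expCurve_zero hk hH, lineCurve_zero w₀ δw, fun P z hz i j => hasDerivAt_expCurve P hz i j, fun φ hφ z hz => ?_⟩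
  · rw [Real.dist_eq, sub_zero]
    exact abs_lt.2 ht
  · exact (contDiffAt_matrix.1 (contDiffAt_expCurve P hk hH hδh.smooth hp.2 p.1) i
      j).contDiffWithinAt
  · have h1 := ((hasDerivAt_id (0 : ℝ)).smul_const (inChart φ δw z)).const_add (inChart φ w₀ z)
    rw [one_smul] at h1
    exact h1

end Manifold

end Strominger
end

open Strominger in
theorem proposition3p2
    {X : Type*} [TopologicalSpace X] [T2Space X] [CompactSpace X]
    [ChartedSpace C3 X] [IsManifold 𝓘(ℂ, C3) ω X]
    {r : ℕ} {E : X → Type*} [∀ x, AddCommGroup (E x)] [∀ x, Module ℂ (E x)]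
    [TopologicalSpace (TotalSpace (Fin r → ℂ) E)] [∀ x, TopologicalSpace (E x)]
    [FiberBundle (Fin r → ℂ) E] [VectorBundle ℂ (Fin r → ℂ) E]
    [ContMDiffVectorBundle ω (Fin r → ℂ) E 𝓘(ℂ, C3)]
    (w₀ : FormField X 2) (hw₀ : IsKahlerForm w₀)
    (Ω : FormField X 3) (hΩ : IsHolomorphicThreeForm Ω)
    (hnorm : ∀ φ ∈ atlas C3 X, ∀ z ∈ φ.target, formNorm (inChart φ w₀ z) (inChart φ Ω z) = 1)
    (k : PairingField E) (hk : IsHermitianMetric r k)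
    (H : EndField E) (hH : IsMetricOne r k H)
    (hsol : IsSolution r k w₀ Ω H w₀)
    (δh : EndField E) (hδh : IsHerZero r k δh)
    (δw : FormField X 2) (hδw : IsReal11Form δw) :
    (∃ ε Ht wt, IsVariation r k H w₀ δh δw ε Ht wt) ∧
    ∀ ε Ht wt, IsVariation r k H w₀ δh δw ε Ht wt →
      ∀ P : Patch r E, ∀ z ∈ P.dom,
        -- the curvatures are differentiable, with derivatives `δF_H(δh)` and `δR_{w₀}(δw)`
        (∀ i j, HasDerivAt (fun t => curvH P k (Ht t) z i j) (deltaF P k H δh z i j) 0) ∧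
        (∀ i j, HasDerivAt (fun t => tangentCurv (inChart P.chart (wt t)) z i j)
          (deltaR (inChart P.chart w₀) (inChart P.chart δw) z i j) 0) ∧
        -- `δL₁`
        (∀ i j, HasDerivAt (fun t => L1 P k (Ht t) (wt t) z i j)
          ((swedge (conjSqrt P k H z
              (mdelbar (dprime (P.gram (metricOf k H))
                (fun y => P.mat (sqrtEnd k H) y * P.mat δh y * (P.mat (sqrtEnd k H) y)⁻¹)) z))
              (wedge (inChart P.chart w₀ z) (inChart P.chart w₀ z))
            + (2 : ℂ) • swedge (conjSqrt P k H z (curvH P k H z))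
              (wedge (inChart P.chart w₀ z) (inChart P.chart δw z))) i j) 0) ∧
        -- `δL₁` when `H` is parallel
        ((∀ Q : Patch r E, ∀ y ∈ Q.dom, mdelbarZero (Q.mat H) y = 0) →
          ∀ i j, HasDerivAt (fun t => L1 P k (Ht t) (wt t) z i j)
            ((swedge (mdelbar (dprime (P.gram (metricOf k H)) (P.mat δh)) z)
                (wedge (inChart P.chart w₀ z) (inChart P.chart w₀ z))
              + (2 : ℂ) • swedge (conjSqrt P k H z (curvH P k H z))
                (wedge (inChart P.chart w₀ z) (inChart P.chart δw z))) i j) 0) ∧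
        -- `δL₂`
        HasDerivAt (fun t => L2 P k (Ht t) (wt t) z)
          ((2 : ℂ)⁻¹ • extDeriv (dc (inChart P.chart δw)) z
            + (2 : ℂ) • (mtrace (mwedge (deltaF P k H δh z) (curvH P k H z))
              - mtrace (mwedge (deltaR (inChart P.chart w₀) (inChart P.chart δw) z)
                  (tangentCurv (inChart P.chart w₀) z)))) 0 ∧
        -- `δL₃`
        HasDerivAt (fun t => L3 P.chart w₀ Ω (wt t) z)
          ((2 : ℂ) • codiff (inChart P.chart w₀) (inChart P.chart δw) z
            - codiff (inChart P.chart w₀)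
                (fun y => formInner (inChart P.chart w₀ y) (inChart P.chart δw y)
                  (inChart P.chart w₀ y) • inChart P.chart w₀ y) z) 0 := by
  refine ⟨exists_isVariation hk hH hδh hw₀.1 hδw, fun ε Ht wt h P z hz => ?_⟩
  have h1 := h.hasDerivAt_L1 P hk hH hz (hsol P z hz).1
  refine ⟨h.hasDerivAt_curvH P hk hH hδh.smooth hz, h.hasDerivAt_tangentCurv P hw₀.1 hz, h1,
    fun hpar => ?_, h.hasDerivAt_L2 P hw₀.1 hk hH hδh.smooth hz,
    h.hasDerivAt_L3 P hw₀.1 hΩ hnorm hδw hz⟩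
  rwa [conjSqrt_of_parallel P hk hH hδh.smooth (hpar P) hz] at h1
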